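/- Let $(X,\check X,R,\check R,\Pi)$ be a based (reduced) root datum with Weyl group $W$, let $\mathfrak h=\mathbb C\otimes_{\mathbb Z}\check X$ and $\mathfrak h^*=\mathbb C\otimes_{\mathbb Z} X$, and let $c:R\to\mathbb Z_{>0}$ be $W$-invariant. The graded Hecke algebra $\mathbb H$ is the $\mathbb C$-algebra generated by $t_w$ ($w\in W$), $\omega\in\mathfrak h^*$ (linearly, and commuting with each other) and a central element $r$, with $t_wt_{w'}=t_{ww'}$, $t_1=1$ and $\omega t_{s}=t_{s}s(\omega)+r\,c_\alpha\,\omega(\check\alpha)$ for $s=s_\alpha$, $\alpha\in\Pi$. If $R_\Delta\subset R$ is a root subsystem and $\Delta$ is the set of simple roots of its positive system $R_\Delta\cap R^+$, then $\mathbb H_\Delta$ denotes the graded Hecke algebra attached in the same way to $\mathfrak h$, $\Delta$ and the Weyl group of $R_\Delta$. It carries the conjugate-linear anti-automorphism with $t_w^*=t_{w^{-1}}$, $r^*=r$, $\omega^*=-\overline\omega+r\sum_{\alpha\in R_\Delta\cap R^+}c_\alpha\,\overline\omega(\check\alpha)\,t_{s_\alpha}$, and an $\mathbb H_\Delta$-module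 is unitary if it has a positive definite Hermitian form with $\langle xu,v\rangle=\langle u,x^*v\rangle$. A Langlands parameter $(M,\sigma,\nu)$ for $\mathbb H$ consists of a subset $\Pi_M\subset\Pi$, an irreducible finite dimensional tempered module $\sigma$ of $\mathbb H_{M_0}$ (the graded Hecke algebra with the roots of $M$ and with $\mathfrak h$ replaced by the span of $\check\Pi_M$; tempered means $\mathrm{Re}\,\omega_i(\lambda)\le 0$ for all weights $\lambda$ of $\sigma$ and all fundamental weights $\omega_i$), and $\nu\in\mathfrak t=\{\nu\in\mathfrak h:\alpha(\nu)=0\ \forall\alpha\in\Pi_M\}$ with $\mathrm{Re}\,\alpha(\nu)>0$ for all $\alpha\in\Pi\setminus\Pi_M$. With $\mathbb H_M=\mathbb H_{\Pi_M}=\mathbb H_{M_0}\otimes S(\mathfrak t^*)$, $L(M,\sigma,\nu)$ is the unique irreducible quotient of $\mathbb H\otimes_{\mathbb H_M}(\sigma\otimes\mathbb C_\nu)$. Langlands parameters and quotients for $\mathbb H_\Delta$ with $\Pi_M\subset\Delta$ are defined in the same way. Let $(M,\sigma,\nu)$ be a Langlands parameter for $\mathbb H$. Write $\nu=\mathrm{Re}\,\nu+\sqrt{-1}\,\mathrm{Im}\,\nu$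 with $\mathrm{Re}\,\nu,\mathrm{Im}\,\nu\in\mathfrak h_{\mathbb R}$, and assume $\mathrm{Im}\,\nu\ne0$. Let $R_{M_1}=\{\alpha\in R:\alpha(\mathrm{Im}\,\nu)=0\}$, let $\Delta_{M_1}\supset\Pi_M$ be the set of simple roots of $R_{M_1}\cap R^+$, and let $\mathbb H_{M_1}=\mathbb H_{\Delta_{M_1}}$. Assume that $r$ acts on $\sigma$ by a real number, and that every $\alpha\in R$ with $\alpha(\mathrm{Im}\,\lambda+\mathrm{Im}\,\nu)=0$ for some weight $\lambda$ of $\sigma$ belongs to $R_{M_1}$. (Both assumptions hold when $\sigma$ has real central character.) Then: 1. There is $w\in W$ with $w\Delta_{M_1}\subset\Pi$. For every such $w$, let $I(M_1,U)=\mathbb H\otimes_{\mathbb H_{M_1}}U$, where $\mathbb H_{M_1}\cong\mathbb H_{w\Delta_{M_1}}\subset\mathbb H$ is embedded by $t_g\mapsto t_{wgw^{-1}}$, $\omega\mapsto w\omega$, $r\mapsto r$. Then $$L(M,\sigma,\nu)\;\cong\; I\bigl(M_1,\,L_{M_1}(M,\sigma,\mathrm{Re}\,\nu)\otimes\mathbb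 C_{\sqrt{-1}\,\mathrm{Im}\,\nu}\bigr).$$ 2. $L(M,\sigma,\nu)$ is a unitary $\mathbb H$-module if and only if $L_{M_1}(M,\sigma,\mathrm{Re}\,\nu)$ is a unitary $\mathbb H_{M_1}$-module. 3. If $\sigma$ has real central character, then so has $L_{M_1}(M,\sigma,\mathrm{Re}\,\nu)$. -/

import Mathlib

open scoped TensorProduct ComplexConjugate

noncomputable section

namespace GradedHecke

/-! ### Graded affine Hecke algebras by generators and relations -/

/-- The generators of a graded Hecke algebra: `t_w` for `w` in the Weyl group `W`, the central
parameter `r`, and the elements `ω` of the vector space `E` (which is the dual of the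
Cartan space). -/
inductive Gen (W E : Type*)
  | t (w : W)
  | r
  | x (ω : E)

section Presentation

variable {W E D : Type*} [Group W] [AddCommGroup E] [Module ℂ E]

/-- The defining relations. The type `D` indexes the simple roots, `s d` is the simple reflection
in `W`, `α d` the simple root, `αv d` the evaluation of elements of `E` on the simple coroot, and
`c d` the parameter. The subalgebra generated by the `t_w` is a quotient of `ℂ[W]`, the one
generated by `E` is a quotient of the symmetric algebra of `E`, `r` is central, and
`ω t_s = t_s s(ω) + r c_α ω(α^∨)`. -/
inductive Rel (s : D → W) (α : D → E) (αv : D → Module.Dual ℂ E) (c : D → ℂ) :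
    FreeAlgebra ℂ (Gen W E) → FreeAlgebra ℂ (Gen W E) → Prop
  | t_one : Rel s α αv c (FreeAlgebra.ι ℂ (Gen.t 1)) 1
  | t_mul (w w' : W) : Rel s α αv c
      (FreeAlgebra.ι ℂ (Gen.t w) * FreeAlgebra.ι ℂ (Gen.t w')) (FreeAlgebra.ι ℂ (Gen.t (w * w')))
  | r_t (w : W) : Rel s α αv c
      (FreeAlgebra.ι ℂ Gen.r * FreeAlgebra.ι ℂ (Gen.t w))
      (FreeAlgebra.ι ℂ (Gen.t w) * FreeAlgebra.ι ℂ Gen.r)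
  | r_x (ω : E) : Rel s α αv c
      (FreeAlgebra.ι ℂ Gen.r * FreeAlgebra.ι ℂ (Gen.x ω))
      (FreeAlgebra.ι ℂ (Gen.x ω) * FreeAlgebra.ι ℂ Gen.r)
  | x_add (ω ω' : E) : Rel s α αv c
      (FreeAlgebra.ι ℂ (Gen.x (ω + ω')))
      (FreeAlgebra.ι ℂ (Gen.x ω) + FreeAlgebra.ι ℂ (Gen.x ω'))
  | x_smul (z : ℂ) (ω : E) : Rel s α αv c
      (FreeAlgebra.ι ℂ (Gen.x (z • ω))) (z • FreeAlgebra.ι ℂ (Gen.x ω))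
  | x_comm (ω ω' : E) : Rel s α αv c
      (FreeAlgebra.ι ℂ (Gen.x ω) * FreeAlgebra.ι ℂ (Gen.x ω'))
      (FreeAlgebra.ι ℂ (Gen.x ω') * FreeAlgebra.ι ℂ (Gen.x ω))
  | cross (d : D) (ω : E) : Rel s α αv c
      (FreeAlgebra.ι ℂ (Gen.x ω) * FreeAlgebra.ι ℂ (Gen.t (s d)))
      (FreeAlgebra.ι ℂ (Gen.t (s d)) * FreeAlgebra.ι ℂ (Gen.x (ω - αv d ω • α d)) +
        (c d * αv d ω) • FreeAlgebra.ι ℂ Gen.r)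

variable (s : D → W) (α : D → E) (αv : D → Module.Dual ℂ E) (c : D → ℂ)

/-- The graded Hecke algebra with the given simple reflections, roots, coroots and parameters. -/
abbrev Alg := RingQuot (Rel s α αv c)

namespace Alg

variable {s α αv c}

/-- The generator `t_w`. -/
def t (w : W) : Alg s α αv c := RingQuot.mkAlgHom ℂ _ (FreeAlgebra.ι ℂ (Gen.t w))

/-- The generator `r`. -/
def r : Alg s α αv c := RingQuot.mkAlgHom ℂ _ (FreeAlgebra.ι ℂ Gen.r)

/-- The generator `ω ∈ E`. -/
def x (ω : E) : Alg s α αv c := RingQuot.mkAlgHom ℂ _ (FreeAlgebra.ι ℂ (Gen.x ω))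

lemma t_one : (t 1 : Alg s α αv c) = 1 := by
  simpa [t] using RingQuot.mkAlgHom_rel ℂ (Rel.t_one (s := s) (α := α) (αv := αv) (c := c))

lemma t_mul (w w' : W) : (t w * t w' : Alg s α αv c) = t (w * w') := by
  simpa [t] using
    RingQuot.mkAlgHom_rel ℂ (Rel.t_mul (s := s) (α := α) (αv := αv) (c := c) w w')

lemma r_t (w : W) : (r * t w : Alg s α αv c) = t w * r := by
  simpa [t, r] using RingQuot.mkAlgHom_rel ℂ (Rel.r_t (s := s) (α := α) (αv := αv) (c := c) w)

lemma r_x (ω : E) : (r * x ω : Alg s α αv c) = x ω * r := by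
  simpa [x, r] using RingQuot.mkAlgHom_rel ℂ (Rel.r_x (s := s) (α := α) (αv := αv) (c := c) ω)

lemma x_add (ω ω' : E) : (x (ω + ω') : Alg s α αv c) = x ω + x ω' := by
  simpa [x] using
    RingQuot.mkAlgHom_rel ℂ (Rel.x_add (s := s) (α := α) (αv := αv) (c := c) ω ω')

lemma x_smul (z : ℂ) (ω : E) : (x (z • ω) : Alg s α αv c) = z • x ω := by
  simpa [x] using
    RingQuot.mkAlgHom_rel ℂ (Rel.x_smul (s := s) (α := α) (αv := αv) (c := c) z ω)

lemma x_comm (ω ω' : E) : (x ω * x ω' : Alg s α αv c) = x ω' * x ω := by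
  simpa [x] using
    RingQuot.mkAlgHom_rel ℂ (Rel.x_comm (s := s) (α := α) (αv := αv) (c := c) ω ω')

lemma cross (d : D) (ω : E) : (x ω * t (s d) : Alg s α αv c) =
    t (s d) * x (ω - αv d ω • α d) + (c d * αv d ω) • r := by
  simpa [x, t, r] using
    RingQuot.mkAlgHom_rel ℂ (Rel.cross (s := s) (α := α) (αv := αv) (c := c) d ω)

/-- The universal property of the presentation. -/
def lift {B : Type*} [Ring B] [Algebra ℂ B] (fT : W → B) (fR : B) (fX : E → B)
    (h1 : fT 1 = 1) (hm : ∀ w w', fT w * fT w' = fT (w * w'))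
    (hrt : ∀ w, fR * fT w = fT w * fR) (hrx : ∀ ω, fR * fX ω = fX ω * fR)
    (hadd : ∀ ω ω', fX (ω + ω') = fX ω + fX ω') (hsmul : ∀ (z : ℂ) ω, fX (z • ω) = z • fX ω)
    (hcomm : ∀ ω ω', fX ω * fX ω' = fX ω' * fX ω)
    (hcross : ∀ d ω, fX ω * fT (s d) =
      fT (s d) * fX (ω - αv d ω • α d) + (c d * αv d ω) • fR) :
    Alg s α αv c →ₐ[ℂ] B :=
  RingQuot.liftAlgHom ℂ ⟨FreeAlgebra.lift ℂ (fun g => match g with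
    | Gen.t w => fT w
    | Gen.r => fR
    | Gen.x ω => fX ω), by
      intro a b h
      induction h with
      | t_one => simpa using h1
      | t_mul w w' => simpa using hm w w'
      | r_t w => simpa using hrt w
      | r_x ω => simpa using hrx ω
      | x_add ω ω' => simpa using hadd ω ω'
      | x_smul z ω => simpa using hsmul z ω
      | x_comm ω ω' => simpa using hcomm ω ω'
      | cross d ω => simpa using hcross d ω⟩

end Alg

end Presentation

/-! ### Representations of algebras -/

section Representations

variable {A B : Type*} [Ring A] [Algebra ℂ A] [Ring B] [Algebra ℂ B]
variable {V V' : Type*} [AddCommGroup V] [Module ℂ V] [AddCommGroup V'] [Module ℂ V']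

/-- `N` is stable under the action of `A`. -/
def IsStable (ρ : A →ₐ[ℂ] Module.End ℂ V) (N : Submodule ℂ V) : Prop :=
  ∀ a : A, ∀ v ∈ N, ρ a v ∈ N

/-- The `A`-module `V` is simple. -/
def IsIrreducible (ρ : A →ₐ[ℂ] Module.End ℂ V) : Prop :=
  Nontrivial V ∧ ∀ N : Submodule ℂ V, IsStable ρ N → N = ⊥ ∨ N = ⊤

/-- The `A`-modules `V` and `V'` are isomorphic. -/
def AreIsomorphic (ρ : A →ₐ[ℂ] Module.End ℂ V) (ρ' : A →ₐ[ℂ] Module.End ℂ V') : Prop :=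
  ∃ e : V ≃ₗ[ℂ] V', ∀ a v, e (ρ a v) = ρ' a (e v)

/-- The quotient of an `A`-module by a stable subspace. -/
def quotientRep (ρ : A →ₐ[ℂ] Module.End ℂ V) (N : Submodule ℂ V) (hN : IsStable ρ N) :
    A →ₐ[ℂ] Module.End ℂ (V ⧸ N) :=
  AlgHom.ofLinearMap
    { toFun := fun a => N.mapQ N (ρ a) (fun v hv => hN a v hv)
      map_add' := fun a b => by ext v; simp
      map_smul' := fun z a => by ext v; simp }
    (by ext v; simp)
    (fun a b => by ext v; simp)

/-- The sum of all proper submodules; it is the unique maximal proper submodule whenever there is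
one. -/
def radical (ρ : A →ₐ[ℂ] Module.End ℂ V) : Submodule ℂ V :=
  sSup {N | IsStable ρ N ∧ N ≠ ⊤}

lemma isStable_radical (ρ : A →ₐ[ℂ] Module.End ℂ V) : IsStable ρ (radical ρ) := by
  intro a v hv
  suffices h : radical ρ ≤ (radical ρ).comap (ρ a) from h hv
  refine sSup_le fun N hN v hv => ?_
  exact (le_sSup hN : N ≤ radical ρ) (hN.1 a v hv)

/-- For a module with a unique irreducible quotient, this is that quotient. -/
def irreducibleQuotient (ρ : A →ₐ[ℂ] Module.End ℂ V) : A →ₐ[ℂ] Module.End ℂ (V ⧸ radical ρ) :=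
  quotientRep ρ (radical ρ) (isStable_radical ρ)

/-- The relations `b j(a) ⊗ v = b ⊗ a v` that define `B ⊗_A V` as a quotient of `B ⊗_ℂ V`, where
`B` is a right `A`-module through `j`. -/
def inducedRel (j : A →ₐ[ℂ] B) (ρ : A →ₐ[ℂ] Module.End ℂ V) : Submodule ℂ (B ⊗[ℂ] V) :=
  Submodule.span ℂ {z | ∃ (b : B) (a : A) (v : V), z = (b * j a) ⊗ₜ[ℂ] v - b ⊗ₜ[ℂ] ρ a v}

/-- The vector space `B ⊗_A V`. -/
abbrev Induced (j : A →ₐ[ℂ] B) (ρ : A →ₐ[ℂ] Module.End ℂ V) := (B ⊗[ℂ] V) ⧸ inducedRel j ρ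

/-- The action of `B` on `B ⊗_ℂ V` by left multiplication. -/
def freeRep (B V : Type*) [Ring B] [Algebra ℂ B] [AddCommGroup V] [Module ℂ V] :
    B →ₐ[ℂ] Module.End ℂ (B ⊗[ℂ] V) :=
  AlgHom.ofLinearMap
    { toFun := fun b => (LinearMap.mulLeft ℂ b).rTensor V
      map_add' := fun a b => by ext x v; simp [add_mul, TensorProduct.add_tmul]
      map_smul' := fun z a => by ext x v; simp [TensorProduct.smul_tmul'] }
    (by ext x v; simp)
    (fun a b => by ext x v; simp)

lemma isStable_inducedRel (j : A →ₐ[ℂ] B) (ρ : A →ₐ[ℂ] Module.End ℂ V) :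
    IsStable (freeRep B V) (inducedRel j ρ) := by
  intro b' z hz
  suffices h : inducedRel j ρ ≤ (inducedRel j ρ).comap (freeRep B V b') from h hz
  refine Submodule.span_le.2 ?_
  rintro _ ⟨b, a, v, rfl⟩
  refine Submodule.subset_span ⟨b' * b, a, v, ?_⟩
  simp [freeRep, mul_assoc]

/-- The induced `B`-module `B ⊗_A V`. -/
def inducedRep (j : A →ₐ[ℂ] B) (ρ : A →ₐ[ℂ] Module.End ℂ V) :
    B →ₐ[ℂ] Module.End ℂ (Induced j ρ) :=
  quotientRep (freeRep B V) (inducedRel j ρ) (isStable_inducedRel j ρ)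

section Weights

variable {W E D : Type*} [Group W] [AddCommGroup E] [Module ℂ E]
variable {s : D → W} {α : D → E} {αv : D → Module.Dual ℂ E} {c : D → ℂ}

/-- The generalized weight space of the commuting operators `ω ∈ E`, for the functional `l`. -/
def weightSpace (ρ : Alg s α αv c →ₐ[ℂ] Module.End ℂ V) (l : E →ₗ[ℂ] ℂ) : Submodule ℂ V :=
  ⨅ ω : E, (ρ (Alg.x ω)).maxGenEigenspace (l ω)

/-- The generator `r` acts by a real scalar. -/
def HasRealParameter (ρ : Alg s α αv c →ₐ[ℂ] Module.End ℂ V) : Prop :=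
  ∃ r₀ : ℝ, ∀ v, ρ Alg.r v = (r₀ : ℂ) • v

end Weights

end Representations

/-! ### The Hecke algebras of a based root datum and of its subsystems -/

section RootDatum

variable {ι X Y : Type*} [AddCommGroup X] [AddCommGroup Y]

/-- The Cartan space `𝔥 = ℂ ⊗ Y`, where `Y` is the cocharacter lattice. -/
abbrev Cartan (Y : Type*) [AddCommGroup Y] := ℂ ⊗[ℤ] Y

/-- The dual Cartan space `𝔥^* = ℂ ⊗ X`, where `X` is the character lattice. -/
abbrev CartanDual (X : Type*) [AddCommGroup X] := ℂ ⊗[ℤ] X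

/-- The real part `z ⊗ y ↦ Re z ⊗ y` on `𝔥`. -/
def rePart : Cartan Y →+ Cartan Y :=
  (LinearMap.rTensor Y
    ((Complex.ofRealHom.toAddMonoidHom.comp Complex.reAddGroupHom).toIntLinearMap)).toAddMonoidHom

/-- The imaginary part `z ⊗ y ↦ Im z ⊗ y` on `𝔥`, so that `ν = Re ν + √-1 Im ν`, with `Re ν` and
`Im ν` real. -/
def imPart : Cartan Y →+ Cartan Y :=
  (LinearMap.rTensor Y
    ((Complex.ofRealHom.toAddMonoidHom.comp Complex.imAddGroupHom).toIntLinearMap)).toAddMonoidHom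

/-- The complex conjugation `z ⊗ x ↦ conj z ⊗ x` on `𝔥^*`. -/
def conjDual : CartanDual X →+ CartanDual X :=
  (LinearMap.rTensor X
    ((starRingEnd ℂ).toAddMonoidHom.toIntLinearMap)).toAddMonoidHom

@[simp] lemma rePart_tmul (z : ℂ) (y : Y) : rePart (z ⊗ₜ[ℤ] y) = (z.re : ℂ) ⊗ₜ[ℤ] y := rfl

@[simp] lemma imPart_tmul (z : ℂ) (y : Y) : imPart (z ⊗ₜ[ℤ] y) = (z.im : ℂ) ⊗ₜ[ℤ] y := rfl

@[simp] lemma conjDual_tmul (z : ℂ) (y : X) : conjDual (z ⊗ₜ[ℤ] y) = (conj z) ⊗ₜ[ℤ] y := rfl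

lemma rePart_add_imPart (ν : Cartan Y) : rePart ν + Complex.I • imPart ν = ν := by
  induction ν using TensorProduct.induction_on with
  | zero => simp
  | tmul z y =>
    rw [rePart_tmul, imPart_tmul, TensorProduct.smul_tmul', ← TensorProduct.add_tmul]
    congr 1
    rw [smul_eq_mul, mul_comm, Complex.re_add_im]
  | add a b ha hb =>
    rw [map_add, map_add, smul_add]
    nth_rewrite 3 [← ha]
    nth_rewrite 3 [← hb]
    abel

variable (P : RootPairing ι ℤ X Y)

/-- The complex bilinear pairing between `𝔥^*` and `𝔥` that extends the one between `X` and `Y`. -/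
def pair : CartanDual X →ₗ[ℂ] Cartan Y →ₗ[ℂ] ℂ :=
  LinearMap.liftBaseChange ℂ
    { toFun := fun u =>
        LinearMap.liftBaseChange ℂ ((Int.castAddHom ℂ).toIntLinearMap ∘ₗ P.toLinearMap u)
      map_add' := fun a b => by ext; simp
      map_smul' := fun a b => by ext; simp }

@[simp] lemma pair_tmul (z z' : ℂ) (u : X) (y : Y) :
    pair P (z ⊗ₜ[ℤ] u) (z' ⊗ₜ[ℤ] y) = z * (z' * (P.toLinearMap u y : ℂ)) := by
  simp [pair]

/-- The root `α_i` as an element of `𝔥^*`. -/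
def rootC (i : ι) : CartanDual X := (1 : ℂ) ⊗ₜ[ℤ] P.root i

/-- The coroot `α_i^∨` as an element of `𝔥`. -/
def corootC (i : ι) : Cartan Y := (1 : ℂ) ⊗ₜ[ℤ] P.coroot i

lemma pair_rootC_rePart (i : ι) (ν : Cartan Y) :
    pair P (rootC P i) (rePart ν) = ((pair P (rootC P i) ν).re : ℂ) := by
  induction ν using TensorProduct.induction_on with
  | zero => simp
  | tmul z y => simp [rootC]
  | add a b ha hb => simp [ha, hb]

lemma pair_rootC_imPart (i : ι) (ν : Cartan Y) :
    pair P (rootC P i) (imPart ν) = ((pair P (rootC P i) ν).im : ℂ) := by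
  induction ν using TensorProduct.induction_on with
  | zero => simp
  | tmul z y => simp [rootC]
  | add a b ha hb => simp [ha, hb]

variable (Δ : Set ι)

/-- The reflection group generated by the reflections in the roots of `Δ`. -/
def weyl : Subgroup P.Aut := Subgroup.closure (RootPairing.Equiv.reflection P '' Δ)

/-- The simple reflection attached to an element of `Δ`. -/
def simpleRefl (d : Δ) : weyl P Δ :=
  ⟨RootPairing.Equiv.reflection P d, Subgroup.subset_closure ⟨d, d.2, rfl⟩⟩

/-- The roots generated by `Δ`, namely the transforms of the elements of `Δ` under the group
generated by the reflections in `Δ`. -/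
def generatedRoots : Set ι := {i | ∃ w ∈ weyl P Δ, ∃ d ∈ Δ, i = w • d}

lemma smul_rootC (w : P.Aut) (i : ι) : w • P.root i = P.root (w • i) :=
  (RootPairing.Equiv.root_indexEquiv_eq_smul P i w).symm

lemma pairing_smul (w : P.Aut) (u : X) (i : ι) :
    P.toLinearMap (w • u) (P.coroot (w • i)) = P.toLinearMap u (P.coroot i) := by
  have h := RootPairing.Hom.weight_coweight_transpose_apply P P (P.coroot (w • i)) w.toHom
  have h2 : w.toHom.coweightMap (P.coroot (w • i)) = P.coroot i := by
    rw [RootPairing.Hom.coroot_coweightMap_apply]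
    congr 1
    exact w.toHom.indexEquiv.symm_apply_apply i
  rw [h2] at h
  exact congrArg (fun f => f u) h

lemma reflection_smul_eq (w : P.Aut) (i : ι) :
    RootPairing.Equiv.reflection P (w • i) = w * RootPairing.Equiv.reflection P i * w⁻¹ := by
  rw [eq_mul_inv_iff_mul_eq]
  apply RootPairing.Equiv.weightHom_injective P
  ext u
  change RootPairing.Equiv.reflection P (w • i) • w • u =
    w • RootPairing.Equiv.reflection P i • u
  rw [RootPairing.Equiv.reflection_smul, RootPairing.Equiv.reflection_smul,
    RootPairing.reflection_apply, RootPairing.reflection_apply, smul_sub, smul_comm w,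
    smul_rootC]
  have h : P.coroot' (w • i) (w • u) = P.coroot' i u := pairing_smul P w u i
  rw [h]

lemma reflection_mem_weyl_of_generatedRoots {i : ι} (hi : i ∈ generatedRoots P Δ) :
    RootPairing.Equiv.reflection P i ∈ weyl P Δ := by
  obtain ⟨w, hw, d, hd, rfl⟩ := hi
  rw [reflection_smul_eq]
  exact mul_mem (mul_mem hw (Subgroup.subset_closure ⟨d, hd, rfl⟩)) (inv_mem hw)

/-- The linear action of an automorphism (in particular of a Weyl group element) on `𝔥^*`. -/
def act (w : P.Aut) : CartanDual X →ₗ[ℂ] CartanDual X :=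
  LinearMap.baseChange ℂ (RootPairing.Equiv.weightHom P w).toLinearMap

lemma act_tmul (w : P.Aut) (z : ℂ) (u : X) : act P w (z ⊗ₜ[ℤ] u) = z ⊗ₜ[ℤ] (w • u) := rfl

lemma act_rootC (w : P.Aut) (i : ι) : act P w (rootC P i) = rootC P (w • i) := by
  rw [rootC, act_tmul, smul_rootC, rootC]

lemma pair_act (w : P.Aut) (ω : CartanDual X) (i : ι) :
    pair P (act P w ω) (corootC P (w • i)) = pair P ω (corootC P i) := by
  induction ω using TensorProduct.induction_on with
  | zero => simp
  | tmul z u => rw [act_tmul, corootC, corootC, pair_tmul, pair_tmul, pairing_smul]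
  | add a b ha hb => simp [ha, hb]

variable (c : ι → ℕ)

/-- The graded Hecke algebra `ℍ_Δ` attached to `𝔥` and the roots generated by `Δ`, where `Δ` is
the set of simple roots of a subsystem. For the set `Π` of all simple roots this is `ℍ`. -/
abbrev HeckeAlg :=
  Alg (simpleRefl P Δ) (fun d : Δ => rootC P d) (fun d : Δ => (pair P).flip (corootC P d))
    (fun d : Δ => (c d : ℂ))

/-- The subspace of `𝔥` spanned by the coroots of `Δ`. -/
def coSpan : Submodule ℂ (Cartan Y) := Submodule.span ℂ (corootC P '' Δ)

/-- The coroot of an element of `Δ` as an element of the span of these coroots. -/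
def coSpanCoroot (d : Δ) : coSpan P Δ :=
  ⟨corootC P d, Submodule.subset_span ⟨d, d.2, rfl⟩⟩

/-- The restriction of functionals from `𝔥` to the span of the coroots of `Δ`. -/
def restrictDual : CartanDual X →ₗ[ℂ] Module.Dual ℂ (coSpan P Δ) :=
  (coSpan P Δ).subtype.dualMap ∘ₗ pair P

/-- The graded Hecke algebra attached to the same roots as `ℍ_Δ`, but with `𝔥` replaced by the
span of the coroots of `Δ`. For `Δ = Π_M` this is `ℍ_{M_0}`. -/
abbrev HeckeAlg₀ :=
  Alg (simpleRefl P Δ) (fun d : Δ => restrictDual P Δ (rootC P d))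
    (fun d : Δ => Module.Dual.eval ℂ (coSpan P Δ) (coSpanCoroot P Δ d))
    (fun d : Δ => (c d : ℂ))

/-- The subspace `𝔱` of `𝔥` on which the roots of `Δ` vanish. -/
def annih : Submodule ℂ (Cartan Y) where
  carrier := {ν | ∀ d ∈ Δ, pair P (rootC P d) ν = 0}
  zero_mem' := fun d _ => map_zero _
  add_mem' := fun {a b} ha hb d hd => by rw [map_add, ha d hd, hb d hd, add_zero]
  smul_mem' := fun z a ha d hd => by rw [map_smul, ha d hd, smul_zero]

variable {Δ}

lemma rePart_mem_annih {ν : Cartan Y} (hν : ν ∈ annih P Δ) : rePart ν ∈ annih P Δ :=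
  fun d hd => by rw [pair_rootC_rePart, hν d hd]; simp

variable {Δ' : Set ι}

/-- The natural homomorphism `ℍ_Δ → ℍ_Δ'` for `Δ ⊆ Δ'`. -/
def incl (h : Δ ⊆ Δ') : HeckeAlg P Δ c →ₐ[ℂ] HeckeAlg P Δ' c :=
  Alg.lift
    (fun w => Alg.t ⟨w, Subgroup.closure_mono (Set.image_mono h) w.2⟩) Alg.r Alg.x
    Alg.t_one (fun _ _ => Alg.t_mul _ _) (fun _ => Alg.r_t _) Alg.r_x Alg.x_add Alg.x_smul
    Alg.x_comm (fun d ω => Alg.cross (s := simpleRefl P Δ') ⟨d, h d.2⟩ ω)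

variable {c}

lemma conj_mem_weyl (w : P.Aut) (h : ∀ d ∈ Δ, w • d ∈ Δ') {g : P.Aut} (hg : g ∈ weyl P Δ) :
    w * g * w⁻¹ ∈ weyl P Δ' := by
  suffices hle : weyl P Δ ≤ (weyl P Δ').comap (MulAut.conj w).toMonoidHom from hle hg
  refine (Subgroup.closure_le _).2 ?_
  rintro _ ⟨d, hd, rfl⟩
  change w * _ * w⁻¹ ∈ weyl P Δ'
  rw [← reflection_smul_eq]
  exact Subgroup.subset_closure ⟨w • d, h d hd, rfl⟩

/-- For an automorphism `w` that maps `Δ` into `Δ'` and preserves the parameters, the homomorphism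
`ℍ_Δ → ℍ_Δ'` with `t_g ↦ t_{w g w⁻¹}`, `ω ↦ w ω`, `r ↦ r`. It is the isomorphism from `ℍ_Δ` to
`ℍ_{wΔ}`, followed by the natural homomorphism from `ℍ_{wΔ}` to `ℍ_Δ'`. -/
def conjHom (w : P.Aut) (h : ∀ d ∈ Δ, w • d ∈ Δ') (hc : ∀ i, c (w • i) = c i) :
    HeckeAlg P Δ c →ₐ[ℂ] HeckeAlg P Δ' c :=
  Alg.lift
    (fun g => Alg.t ⟨w * g * w⁻¹, conj_mem_weyl P w h g.2⟩) Alg.r (fun ω => Alg.x (act P w ω))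
    (by rw [← Alg.t_one]; congr 1; ext1; simp)
    (fun g g' => by rw [Alg.t_mul]; congr 1; ext1; change _ * _ * _ * (_ * _ * _) = _ * (_ * _) * _; group)
    (fun g => Alg.r_t _) (fun ω => Alg.r_x _)
    (fun ω ω' => by rw [map_add, Alg.x_add]) (fun z ω => by rw [map_smul, Alg.x_smul])
    (fun ω ω' => Alg.x_comm _ _)
    (fun d ω => by
      have key := Alg.cross (s := simpleRefl P Δ') (α := fun d : Δ' => rootC P d)
        (αv := fun d : Δ' => (pair P).flip (corootC P d)) (c := fun d : Δ' => (c d : ℂ))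
        ⟨w • d, h d d.2⟩ (act P w ω)
      have hs : simpleRefl P Δ' ⟨w • d, h d d.2⟩ =
          ⟨w * (simpleRefl P Δ d : P.Aut) * w⁻¹, conj_mem_weyl P w h (simpleRefl P Δ d).2⟩ :=
        Subtype.ext (reflection_smul_eq P w d)
      rw [hs] at key
      simp only [LinearMap.flip_apply, pair_act, hc] at key
      rw [key]
      simp only [LinearMap.flip_apply, map_sub, map_smul, act_rootC])

variable (c)

lemma add_scalar_comm {A : Type*} [Ring A] [Algebra ℂ A] {a b : A} (h : a * b = b * a)
    (z z' : ℂ) : (a + algebraMap ℂ A z) * (b + algebraMap ℂ A z') =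
      (b + algebraMap ℂ A z') * (a + algebraMap ℂ A z) :=
  ((Commute.add_right (show Commute a b from h) (Algebra.commutes z' a).symm).add_left
    (Algebra.commutes z (b + algebraMap ℂ A z'))).eq

/-- The homomorphism `ℍ_M = ℍ_{M_0} ⊗ S(𝔱^*) → ℍ_{M_0}` given by evaluation of `S(𝔱^*)` at
`ν ∈ 𝔱`. As `ω ∈ 𝔥^*` is the sum of its restriction to the span of the coroots and of its
restriction to `𝔱`, it maps `ω` to the former plus the scalar `ω(ν)`. The pullback of an
`ℍ_{M_0}`-module `σ` along it is the `ℍ_M`-module `σ ⊗ ℂ_ν`. -/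
def evalAt (ν : Cartan Y) (hν : ν ∈ annih P Δ) : HeckeAlg P Δ c →ₐ[ℂ] HeckeAlg₀ P Δ c :=
  Alg.lift Alg.t Alg.r
    (fun ω => Alg.x (restrictDual P Δ ω) + algebraMap ℂ _ (pair P ω ν))
    Alg.t_one Alg.t_mul Alg.r_t
    (fun ω => by rw [mul_add, add_mul, Alg.r_x, Algebra.commutes])
    (fun ω ω' => by
      rw [map_add, Alg.x_add, map_add, LinearMap.add_apply, map_add]; abel)
    (fun z ω => by
      rw [map_smul, Alg.x_smul, map_smul, LinearMap.smul_apply, smul_add, smul_eq_mul, map_mul,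
        ← Algebra.smul_def])
    (fun _ _ => add_scalar_comm (Alg.x_comm _ _) _ _)
    (fun d ω => by
      have key := Alg.cross (s := simpleRefl P Δ)
        (α := fun d : Δ => restrictDual P Δ (rootC P d))
        (αv := fun d : Δ => Module.Dual.eval ℂ (coSpan P Δ) (coSpanCoroot P Δ d))
        (c := fun d : Δ => (c d : ℂ)) d (restrictDual P Δ ω)
      have h1 : Module.Dual.eval ℂ (coSpan P Δ) (coSpanCoroot P Δ d) (restrictDual P Δ ω) =
          (pair P).flip (corootC P d) ω := rfl
      rw [h1, ← map_smul, ← map_sub] at key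
      rw [add_mul, key, mul_add, map_sub (pair P), LinearMap.sub_apply, map_smul (pair P),
        LinearMap.smul_apply, hν d d.2, smul_zero, sub_zero, Algebra.commutes]
      abel)

/-- The automorphism `ω ↦ ω + ω(χ)` of `ℍ_Δ`, for `χ` in the common kernel of the roots of `Δ`.
The pullback of an `ℍ_Δ`-module `U` along it is the `ℍ_Δ`-module `U ⊗ ℂ_χ`. -/
def shift (χ : Cartan Y) (hχ : χ ∈ annih P Δ) : HeckeAlg P Δ c →ₐ[ℂ] HeckeAlg P Δ c :=
  Alg.lift Alg.t Alg.r
    (fun ω => Alg.x ω + algebraMap ℂ _ (pair P ω χ))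
    Alg.t_one Alg.t_mul Alg.r_t
    (fun ω => by rw [mul_add, add_mul, Alg.r_x, Algebra.commutes])
    (fun ω ω' => by
      rw [Alg.x_add, map_add, LinearMap.add_apply, map_add]; abel)
    (fun z ω => by
      rw [Alg.x_smul, map_smul, LinearMap.smul_apply, smul_add, smul_eq_mul, map_mul,
        ← Algebra.smul_def])
    (fun _ _ => add_scalar_comm (Alg.x_comm _ _) _ _)
    (fun d ω => by
      rw [add_mul, Alg.cross, mul_add, map_sub (pair P), LinearMap.sub_apply, map_smul (pair P),
        LinearMap.smul_apply, hχ d d.2, smul_zero, sub_zero, Algebra.commutes]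
      abel)

/-! ### The `*`-operation and unitary modules -/

variable {P}
variable (b : P.Base) (Δ)

/-- The positive roots of the subsystem generated by `Δ`. -/
def posRoots : Set ι := {i | i ∈ generatedRoots P Δ ∧ b.IsPos i}

/-- The reflection in a positive root of the subsystem, as an element of its Weyl group. -/
def posRefl (i : posRoots Δ b) : weyl P Δ :=
  ⟨RootPairing.Equiv.reflection P i, reflection_mem_weyl_of_generatedRoots P Δ i.2.1⟩

/-- The graph of the `*`-operation of `ℍ_Δ`, that is, of the conjugate-linear anti-automorphism with
`t_w^* = t_{w⁻¹}`, `r^* = r` and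
`ω^* = - conj ω + r ∑_{α > 0} c_α (conj ω)(α^∨) t_{s_α}`. -/
inductive IsStar : HeckeAlg P Δ c → HeckeAlg P Δ c → Prop
  | t (w : weyl P Δ) : IsStar (Alg.t w) (Alg.t w⁻¹)
  | r : IsStar Alg.r Alg.r
  | x (ω : CartanDual X) : IsStar (Alg.x ω)
      (-Alg.x (conjDual ω) + Alg.r * ∑ᶠ i : posRoots Δ b,
        ((c i : ℂ) * pair P (conjDual ω) (corootC P i)) • Alg.t (posRefl Δ b i))
  | add {h h' k k' : HeckeAlg P Δ c} :
      IsStar h h' → IsStar k k' → IsStar (h + k) (h' + k')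
  | smul (z : ℂ) {h h' : HeckeAlg P Δ c} : IsStar h h' → IsStar (z • h) (conj z • h')
  | mul {h h' k k' : HeckeAlg P Δ c} :
      IsStar h h' → IsStar k k' → IsStar (h * k) (k' * h')

variable {Δ c}
variable {V : Type*} [AddCommGroup V] [Module ℂ V]

/-- An `ℍ_Δ`-module is unitary if it carries a positive definite Hermitian form (linear in the
first variable) such that `⟨h u, v⟩ = ⟨u, h^* v⟩` for all `h`. -/
def IsUnitary (ρ : HeckeAlg P Δ c →ₐ[ℂ] Module.End ℂ V) : Prop :=
  ∃ B : V →ₗ[ℂ] V →ₗ⋆[ℂ] ℂ,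
    (∀ u v, B v u = conj (B u v)) ∧ (∀ v, v ≠ 0 → 0 < (B v v).re) ∧
      ∀ h h', IsStar Δ c b h h' → ∀ u v, B (ρ h u) v = B u (ρ h' v)

/-! ### Weights, temperedness, central characters -/

/-- `l ∈ 𝔥` is a weight of an `ℍ_Δ`-module. -/
def IsWeight (ρ : HeckeAlg P Δ c →ₐ[ℂ] Module.End ℂ V) (l : Cartan Y) : Prop :=
  weightSpace ρ ((pair P).flip l) ≠ ⊥

/-- `l`, in the span of the coroots of `Π_M`, is a weight of an `ℍ_{M_0}`-module. -/
def IsWeight₀ (σ : HeckeAlg₀ P Δ c →ₐ[ℂ] Module.End ℂ V) (l : coSpan P Δ) : Prop :=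
  weightSpace σ (Module.Dual.eval ℂ (coSpan P Δ) l) ≠ ⊥

/-- An irreducible `ℍ_{M_0}`-module is tempered if `Re ω_i(l) ≤ 0` for all its weights `l` and all
fundamental weights `ω_i`, where `(ω_i)` is the basis dual to the basis of simple coroots. -/
def IsTempered (σ : HeckeAlg₀ P Δ c →ₐ[ℂ] Module.End ℂ V) : Prop :=
  IsIrreducible σ ∧ ∀ l, IsWeight₀ σ l → ∀ (i : Δ) (ω : Module.Dual ℂ (coSpan P Δ)),
    ω (coSpanCoroot P Δ i) = 1 → (∀ j : Δ, j ≠ i → ω (coSpanCoroot P Δ j) = 0) → (ω l).re ≤ 0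

/-- The central character `(r₀, W(M) l)` of the irreducible `ℍ_Δ`-module is real, that is, `r` acts
by a real scalar and the weights are real. (The central character is the orbit of any weight, and
all weights lie in this orbit.) -/
def HasRealCentralCharacter (ρ : HeckeAlg P Δ c →ₐ[ℂ] Module.End ℂ V) : Prop :=
  HasRealParameter ρ ∧ ∀ l, IsWeight ρ l → imPart l = 0

/-- The same for `ℍ_{M_0}`-modules. -/
def HasRealCentralCharacter₀ (σ : HeckeAlg₀ P Δ c →ₐ[ℂ] Module.End ℂ V) : Prop :=
  HasRealParameter σ ∧ ∀ l, IsWeight₀ σ l → imPart (l : Cartan Y) = 0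

/-! ### Standard modules and Langlands quotients -/

/-- The standard module `X(M, σ, ν) = ℍ_Δ' ⊗_{ℍ_M} (σ ⊗ ℂ_ν)` of `ℍ_Δ'`. -/
def standardRep (h : Δ ⊆ Δ') (σ : HeckeAlg₀ P Δ c →ₐ[ℂ] Module.End ℂ V) (ν : Cartan Y)
    (hν : ν ∈ annih P Δ) :
    HeckeAlg P Δ' c →ₐ[ℂ] Module.End ℂ (Induced (incl P c h) (σ.comp (evalAt P c ν hν))) :=
  inducedRep (incl P c h) (σ.comp (evalAt P c ν hν))

/-- The underlying space of the Langlands quotient. -/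
abbrev LanglandsSpace (h : Δ ⊆ Δ') (σ : HeckeAlg₀ P Δ c →ₐ[ℂ] Module.End ℂ V) (ν : Cartan Y)
    (hν : ν ∈ annih P Δ) :=
  Induced (incl P c h) (σ.comp (evalAt P c ν hν)) ⧸ radical (standardRep h σ ν hν)

/-- The Langlands quotient `L(M, σ, ν)` of `ℍ_Δ'`, the unique irreducible quotient of the standard
module. -/
def langlandsQuotient (h : Δ ⊆ Δ') (σ : HeckeAlg₀ P Δ c →ₐ[ℂ] Module.End ℂ V) (ν : Cartan Y)
    (hν : ν ∈ annih P Δ) :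
    HeckeAlg P Δ' c →ₐ[ℂ] Module.End ℂ (LanglandsSpace h σ ν hν) :=
  irreducibleQuotient (standardRep h σ ν hν)

/-- `(M, σ, ν)` is a Langlands parameter for `ℍ_Δ'`: `σ` is a (finite dimensional) irreducible
tempered `ℍ_{M_0}`-module, and `ν ∈ 𝔱` satisfies `Re α(ν) > 0` for the simple roots outside
`Π_M = Δ`. -/
structure IsLanglandsParameter (Δ' : Set ι) (σ : HeckeAlg₀ P Δ c →ₐ[ℂ] Module.End ℂ V)
    (ν : Cartan Y) : Prop where
  subset : Δ ⊆ Δ'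
  finite : FiniteDimensional ℂ V
  tempered : IsTempered σ
  mem : ν ∈ annih P Δ
  pos : ∀ i ∈ Δ', i ∉ Δ → 0 < (pair P (rootC P i) ν).re

/-! ### The centralizer of the imaginary part -/

variable (P) in
/-- The roots `R_{M_1}` that vanish on `Im ν`. -/
def centralizerRoots (ν : Cartan Y) : Set ι := {i | pair P (rootC P i) (imPart ν) = 0}

/-- The simple roots of `R_{M_1}` for the positive system `R_{M_1} ∩ R⁺`, namely the positive roots
of `R_{M_1}` that are not sums of two positive roots of `R_{M_1}`. -/
def centralizerSimple (ν : Cartan Y) : Set ι :=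
  {i | (i ∈ centralizerRoots P ν ∧ b.IsPos i) ∧
    ∀ j k, (j ∈ centralizerRoots P ν ∧ b.IsPos j) → (k ∈ centralizerRoots P ν ∧ b.IsPos k) →
      P.root i ≠ P.root j + P.root k}

lemma subset_centralizerSimple {ν : Cartan Y} (hΔ : Δ ⊆ b.support) (hν : ν ∈ annih P Δ) :
    Δ ⊆ centralizerSimple b ν := by
  intro i hi
  refine ⟨⟨?_, RootPairing.Base.isPos_of_mem_support (hΔ hi)⟩, ?_⟩
  · change pair P (rootC P i) (imPart ν) = 0
    rw [pair_rootC_imPart, hν i hi]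
    simp
  · intro j k hj hk h
    have h1 := b.height_add h
    have h2 := RootPairing.Base.height_one_of_mem_support (hΔ hi)
    have h3 : 0 < b.height j := hj.2
    have h4 : 0 < b.height k := hk.2
    omega

/-- The purely imaginary element `√-1 Im ν` is killed by the roots of `M_1`. -/
lemma I_smul_imPart_mem_annih (ν : Cartan Y) :
    Complex.I • imPart ν ∈ annih P (centralizerSimple b ν) :=
  Submodule.smul_mem _ _ fun _ hd => hd.1.1

end RootDatum

end GradedHecke

end

open GradedHecke

/-!
The imaginary part of a weight of a Hecke module is a real functional on the characters, and the
proof separates modules by these imaginary parts. Let `κ` be the imaginary part of one weight of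
`σ ⊗ ℂ_ν`, and let `Δ` be the set of simple roots of the centralizer of the imaginary part of `ν`.
The stabilizer of `κ` in the Weyl group is generated by reflections (`mem_weyl_of_fixed`), and the
condition on the weights of `σ` puts it inside the Weyl group `W_Δ` (`exists_block`). The orbit of
`κ` therefore splits into disjoint blocks `u W_Δ κ`, indexed by the cosets `u W_Δ`
(`inv_mul_mem_of_not_disjoint`), and a module generated by `σ ⊗ ℂ_ν` is the direct sum of the
corresponding sums `wtSum` of generalized weight spaces. The element `t_u` maps the first block to
the block of `u` and the blocks of shorter elements (`t_mem_wtSum_blk`). Since `r` acts by a real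
number, a reflection that changes the block loses no vector in doing so: a vector that `t_s` kept in
its block could be taken to be an eigenvector of weight `λ` with `λ(α) = ± c_α r` real, so that `λ`
and `s λ` would have the same imaginary part (`eq_zero_of_t_simple_mem`). Hence every nonzero
submodule meets every block (`exists_mem_blk`).

Modules induced from the subalgebra attached to `w Δ` are realized on functions on the Weyl group
that are equivariant for `W_Δ` (`fnRep`, `fnMap_bijective`). This gives their dimension, and shows
that the inducing module embeds, without a Poincaré-Birkhoff-Witt theorem for the algebras.

For the isomorphism, `w` is the shortest element of its coset (`IsStandardizing.len_le`). The
component of `t_w v` in the block of `w` is then equivariant in `v` (`twist_apply`), and it defines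
a homomorphism to the standard module of `ℍ` from the module induced from the twisted standard
module of `ℍ_Δ`. It is surjective since the component determines `v`, and the dimensions agree
(`areIsomorphic_inducedRep_incl`). The block of `w` in a module induced from `w Δ` is the inducing
module, and it is met by every nonzero submodule; so the radical of the induced module comes from
the radical of the inducing module (`ker_indQuotient_eq_radical`), and the isomorphism passes to the
Langlands quotients (`areIsomorphic_langlandsQuotient`).

For unitarity, the twist by a purely imaginary character is harmless (`IsUnitary.comp_shift`). An
invariant form on the inducing module yields one on the function model by summation of the values
(`isUnitary_inducedRep`). Conversely, an invariant form on the induced module is restricted to the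
inducing module. The adjoints of `ω` in `ℍ` and in the subalgebra differ by reflections in roots
outside `w Δ`, and the restricted form is invariant because the inducing module is orthogonal to its
translates by elements outside the Weyl group of `w Δ` (`form_t_eq_zero`,
`isUnitary_of_injective`); this is again a comparison of imaginary parts, by descending induction on
the length.

Finally, if `σ` has real central character, the same block argument with `κ = 0` shows that all
weights of the Langlands quotient of `ℍ_Δ` are real (`hasRealCentralCharacter_langlandsQuotient`).
-/

open scoped TensorProduct ComplexConjugate

noncomputable section

namespace GradedHecke

local notation "𝓈" => RootPairing.Equiv.reflection

/-! ### Positive roots and reflections -/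

section RootCombinatorics

variable {ι X Y : Type*} [AddCommGroup X] [AddCommGroup Y]
variable {P : RootPairing ι ℤ X Y}

/-- The index of the negative of the root with index `i`. -/
def opp (P : RootPairing ι ℤ X Y) (i : ι) : ι := P.reflectionPerm i i

@[simp] lemma root_opp (i : ι) : P.root (opp P i) = -P.root i := by
  simp [opp, RootPairing.root_reflectionPerm]

@[simp] lemma coroot_opp (i : ι) : P.coroot (opp P i) = -P.coroot i := by
  simp [opp, RootPairing.coroot_reflectionPerm]

@[simp] lemma opp_opp (i : ι) : opp P (opp P i) = i := by
  apply P.root.injective; simp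

lemma smul_opp (g : P.Aut) (i : ι) : g • opp P i = opp P (g • i) := by
  apply P.root.injective
  rw [← smul_rootC, root_opp, root_opp, smul_neg, smul_rootC]

lemma root_reflection_smul (i j : ι) :
    P.root (𝓈 P i • j) = P.root j - P.pairing j i • P.root i := by
  rw [← smul_rootC, RootPairing.Equiv.reflection_smul, RootPairing.reflection_apply_root]

lemma reflection_smul_self (i : ι) : 𝓈 P i • i = opp P i := rfl

lemma reflection_mul_self (i : ι) : 𝓈 P i * 𝓈 P i = 1 := by
  nth_rewrite 1 [← RootPairing.Equiv.reflection_inv P i]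
  exact inv_mul_cancel _

lemma reflection_smul_reflection_smul (i j : ι) : 𝓈 P i • 𝓈 P i • j = j := by
  rw [← mul_smul, reflection_mul_self, one_smul]

lemma opp_eq_reflection_iff (i : ι) : 𝓈 P (opp P i) = 𝓈 P i := by
  rw [← reflection_smul_self, reflection_smul_eq, mul_assoc, mul_inv_cancel, mul_one]

lemma isPos_opp (b : P.Base) (i : ι) : b.IsPos (opp P i) ↔ ¬ b.IsPos i :=
  RootPairing.Base.IsPos.neg_iff_not b i

lemma height_reflection_smul (b : P.Base) (i j : ι) :
    b.height (𝓈 P i • j) = b.height j - P.pairing j i * b.height i := by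
  have h : P.root (𝓈 P i • j) = P.root j + (-P.pairing j i) • P.root i := by
    rw [root_reflection_smul]; module
  rw [b.height_add_zsmul h]
  simp only [smul_eq_mul]; ring

variable (b : P.Base)

/-- The Weyl group element given by a word in the roots. -/
def wordProd (P : RootPairing ι ℤ X Y) (l : List ι) : P.Aut := (l.map (𝓈 P)).prod

lemma wordProd_cons (a : ι) (l : List ι) : wordProd P (a :: l) = 𝓈 P a * wordProd P l := by
  simp [wordProd]

/-- The length of an element of the Weyl group with respect to the simple reflections. -/
def len (g : P.Aut) : ℕ :=
  sInf {n | ∃ l : List ι, (∀ i ∈ l, i ∈ b.support) ∧ wordProd P l = g ∧ l.length = n}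

lemma len_le {l : List ι} (hl : ∀ i ∈ l, i ∈ b.support) : len b (wordProd P l) ≤ l.length :=
  Nat.sInf_le ⟨l, hl, rfl, rfl⟩

lemma exists_word {g : P.Aut} (hg : g ∈ weyl P (b.support : Set ι)) :
    ∃ l : List ι, (∀ i ∈ l, i ∈ b.support) ∧ wordProd P l = g ∧ l.length = len b g := by
  suffices h : {n | ∃ l : List ι, (∀ i ∈ l, i ∈ b.support) ∧ wordProd P l = g ∧
      l.length = n}.Nonempty from Nat.sInf_mem h
  suffices h : ∃ l : List ι, (∀ i ∈ l, i ∈ b.support) ∧ wordProd P l = g by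
    obtain ⟨l, h1, h2⟩ := h
    exact ⟨_, l, h1, h2, rfl⟩
  induction hg using Subgroup.closure_induction with
  | mem x hx =>
    obtain ⟨d, hd, rfl⟩ := hx
    exact ⟨[d], by simpa using hd, by simp [wordProd]⟩
  | one => exact ⟨[], by simp, by simp [wordProd]⟩
  | mul x y _ _ hx hy =>
    obtain ⟨l, h1, rfl⟩ := hx
    obtain ⟨l', h1', rfl⟩ := hy
    refine ⟨l ++ l', ?_, by simp [wordProd]⟩
    intro i hi
    rcases List.mem_append.1 hi with h | h
    exacts [h1 i h, h1' i h]
  | inv x _ hx =>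
    obtain ⟨l, h1, rfl⟩ := hx
    refine ⟨l.reverse, by simpa using h1, ?_⟩
    rw [wordProd, wordProd, List.prod_inv_reverse, List.map_reverse, List.map_map]
    congr 2
    exact List.map_congr_left fun a _ => (RootPairing.Equiv.reflection_inv P a).symm

lemma len_one : len b (1 : P.Aut) = 0 := by
  have := len_le b (l := ([] : List ι)) (by simp)
  simpa [wordProd] using this

lemma len_simple_mul_le {d : ι} (hd : d ∈ b.support) {g : P.Aut}
    (hg : g ∈ weyl P (b.support : Set ι)) : len b (𝓈 P d * g) ≤ len b g + 1 := by
  obtain ⟨l, h1, rfl, h2⟩ := exists_word b hg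
  rw [← wordProd_cons, ← h2]
  exact len_le b (by simpa using ⟨hd, h1⟩)

variable [Finite ι]

/-- A simple reflection permutes the positive roots other than the simple root itself. -/
lemma isPos_simple_smul {d i : ι} (hd : d ∈ b.support) (hi : b.IsPos i) (hne : i ≠ d) :
    b.IsPos (𝓈 P d • i) := by
  classical
  obtain ⟨f, hf0, hf⟩ := b.exists_root_eq_sum_nat_or_neg i
  replace hf : P.root i = ∑ j ∈ b.support, f j • P.root j := by
    refine hf.resolve_right fun h => ?_
    have h1 : P.root i = ∑ j ∈ b.support, (-(f j : ℤ)) • P.root j := by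
      simp [h, Finset.sum_neg_distrib]
    have h2 := RootPairing.Base.height_eq_sum (f := fun j => -(f j : ℤ)) h1
    have h3 : 0 < b.height i := hi
    have h4 : ∑ j ∈ b.support, (-(f j : ℤ)) ≤ 0 := Finset.sum_nonpos fun j _ => by simp
    omega
  -- A coefficient other than that of `d` is unchanged by the reflection, and its sign decides the
  -- sign of the root.
  by_cases hk : ∃ k, k ≠ d ∧ f k ≠ 0
  · obtain ⟨k, hkd, hk⟩ := hk
    let g : ι → ℤ := fun j => (f j : ℤ) - if j = d then P.pairing i d else 0
    have hg : P.root (𝓈 P d • i) = ∑ j ∈ b.support, g j • P.root j := by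
      rw [root_reflection_smul, hf]
      simp only [g, sub_smul, Finset.sum_sub_distrib, ite_smul, zero_smul, natCast_zsmul]
      rw [Finset.sum_ite_eq' b.support d, if_pos hd]
    have hgs : g.support ⊆ b.support := by
      intro j hj
      by_cases hjd : j = d
      · exact hjd ▸ hd
      · apply hf0
        simpa [g, hjd] using hj
    have hpos : 0 < g := by
      rw [← b.not_nonpos_iff_pos_of_sum_mem_range_root g (hg ▸ ⟨_, rfl⟩) hgs]
      intro h
      have := h k
      simp only [g, hkd, if_false, sub_zero, Pi.zero_apply] at this
      omega
    change 0 < b.height _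
    rw [RootPairing.Base.height_eq_sum hg]
    refine Finset.sum_pos' (fun j _ => hpos.le j) ⟨k, hf0 hk, ?_⟩
    simp only [g, hkd, if_false, sub_zero]
    omega
  · push Not at hk
    exfalso
    have h1 : P.root i = f d • P.root d := by
      rw [hf]
      refine Finset.sum_eq_single_of_mem d hd fun j _ hj => by rw [hk j hj, zero_smul]
    have := Module.IsReflexive.of_isPerfPair P.toLinearMap
    have := Module.IsReflexive.of_isPerfPair P.flip.toLinearMap
    have : IsAddTorsionFree X := .of_isTorsionFree ℤ X
    have : IsAddTorsionFree Y := .of_isTorsionFree ℤ Y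
    have h2 := b.eq_one_or_neg_one_of_mem_support_of_smul_mem d hd (f d : ℤ)
      ⟨i, by rw [h1, natCast_zsmul]⟩
    have h3 : f d = 1 := by omega
    rw [h3, one_smul] at h1
    exact hne (P.root.injective h1)

/-- A positive root that is not simple is moved to a positive root of smaller height by some
simple reflection. -/
lemma exists_simple_height_lt {i : ι} (hi : b.IsPos i) :
    ∃ d ∈ b.support, 0 < P.pairing i d ∧
      (i ≠ d → b.IsPos (𝓈 P d • i) ∧ b.height (𝓈 P d • i) < b.height i) := by
  have := Module.IsReflexive.of_isPerfPair P.toLinearMap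
  obtain ⟨d, hd, h⟩ := hi.exists_mem_support_pos_pairingIn
  rw [P.zero_lt_pairingIn_iff'] at h
  replace h : 0 < P.pairing i d := by
    rw [← P.algebraMap_pairingIn ℤ]; simpa using h
  refine ⟨d, hd, h, fun hne => ⟨isPos_simple_smul b hd hi hne, ?_⟩⟩
  rw [height_reflection_smul, RootPairing.Base.height_one_of_mem_support hd]
  omega

/-- A positive root that is not simple is the sum of two positive roots. -/
lemma exists_add_of_not_mem_support {i : ι} (hi : b.IsPos i) (hs : i ∉ b.support) :
    ∃ j k, b.IsPos j ∧ b.IsPos k ∧ P.root i = P.root j + P.root k := by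
  by_contra hcon
  refine hs ?_
  refine RootPairing.Base.IsPos.induction_on_add (b := b)
    (p := fun i => (∀ j k, b.IsPos j → b.IsPos k → P.root i ≠ P.root j + P.root k) →
      i ∈ b.support ∨ ¬ b.IsPos i) hi (fun j hj _ => Or.inl hj) ?_ ?_ |>.resolve_right
        (fun h => h hi)
  · intro j k l hl _ hk hcon
    by_cases hj : b.IsPos j
    · exact absurd hl (hcon j k hj (RootPairing.Base.isPos_of_mem_support hk))
    · right
      intro hlpos
      have h1 := b.height_add hl
      have h2 := RootPairing.Base.height_one_of_mem_support hk
      have h3 : ¬ 0 < b.height j := hj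
      have h4 := b.height_ne_zero j
      have h5 : 0 < b.height l := hlpos
      omega
  · push Not at hcon
    exact hcon

/-- Every reflection is a product of simple reflections, by induction on the height of the root. -/
lemma reflection_mem_weyl_support (i : ι) : 𝓈 P i ∈ weyl P (b.support : Set ι) := by
  suffices H : ∀ n : ℕ, ∀ i, b.IsPos i → b.height i ≤ n → 𝓈 P i ∈ weyl P (b.support : Set ι) by
    by_cases hi : b.IsPos i
    · exact H (b.height i).toNat i hi (Int.self_le_toNat _)
    · rw [← opp_eq_reflection_iff]
      exact H (b.height (opp P i)).toNat _ ((isPos_opp b i).2 hi) (Int.self_le_toNat _)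
  intro n
  induction n with
  | zero => intro i hi h; exact absurd hi (not_lt.2 (by simpa using h))
  | succ n ih =>
    intro i hi hn
    obtain ⟨d, hd, -, hlt⟩ := exists_simple_height_lt b hi
    have hdm : 𝓈 P d ∈ weyl P (b.support : Set ι) := Subgroup.subset_closure ⟨d, hd, rfl⟩
    by_cases hid : i = d
    · exact hid ▸ hdm
    · obtain ⟨h1, h2⟩ := hlt hid
      have h3 := ih _ h1 (by push_cast at hn; omega)
      rw [reflection_smul_eq] at h3
      have h4 := mul_mem (mul_mem (inv_mem hdm) h3) hdm
      rwa [← mul_assoc, ← mul_assoc, inv_mul_cancel, one_mul, inv_mul_cancel_right] at h4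

lemma weyl_support : weyl P (b.support : Set ι) = P.weylGroup := by
  apply le_antisymm
  · exact Subgroup.closure_mono (Set.image_subset_range _ _)
  · refine (Subgroup.closure_le _).2 ?_
    rintro _ ⟨i, rfl⟩
    exact reflection_mem_weyl_support b i

/-- The strong exchange condition. -/
lemma exists_shorter_word (l : List ι) (hl : ∀ i ∈ l, i ∈ b.support) (i : ι) (hi : b.IsPos i)
    (hneg : ¬ b.IsPos ((wordProd P l)⁻¹ • i)) :
    ∃ l' : List ι, (∀ i ∈ l', i ∈ b.support) ∧ l'.length < l.length ∧
      𝓈 P i * wordProd P l = wordProd P l' := by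
  induction l generalizing i with
  | nil => simp [wordProd, hi] at hneg
  | cons a l ih =>
    have ha : a ∈ b.support := hl a (by simp)
    have hl' : ∀ i ∈ l, i ∈ b.support := fun i hi => hl i (by simp [hi])
    by_cases hia : i = a
    · subst hia
      exact ⟨l, hl', by simp, by rw [wordProd_cons, ← mul_assoc, reflection_mul_self, one_mul]⟩
    · obtain ⟨l', h1, h2, h3⟩ := ih hl' (𝓈 P a • i) (isPos_simple_smul b ha hi hia) (by
        rw [wordProd_cons, mul_inv_rev, mul_smul, RootPairing.Equiv.reflection_inv] at hneg
        exact hneg)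
      refine ⟨a :: l', by simpa using ⟨ha, h1⟩, by simpa using h2, ?_⟩
      rw [wordProd_cons, wordProd_cons, ← h3, reflection_smul_eq, RootPairing.Equiv.reflection_inv]
      simp only [← mul_assoc, reflection_mul_self, one_mul]

/-- A reflection in a positive root that `g⁻¹` makes negative shortens `g`. -/
lemma len_reflection_mul_lt {g : P.Aut} (hg : g ∈ weyl P (b.support : Set ι)) {i : ι}
    (hi : b.IsPos i) (hneg : ¬ b.IsPos (g⁻¹ • i)) : len b (𝓈 P i * g) < len b g := by
  obtain ⟨l, h1, rfl, h2⟩ := exists_word b hg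
  obtain ⟨l', h1', h2', h3⟩ := exists_shorter_word b l h1 i hi hneg
  rw [h3, ← h2]
  exact (len_le b h1').trans_lt h2'

/-- A reflection in a positive root that `g⁻¹` keeps positive lengthens `g`. -/
lemma len_lt_reflection_mul {g : P.Aut} (hg : g ∈ weyl P (b.support : Set ι)) {i : ι}
    (hi : b.IsPos i) (hpos : b.IsPos (g⁻¹ • i)) : len b g < len b (𝓈 P i * g) := by
  have h := len_reflection_mul_lt b (g := 𝓈 P i * g)
    (mul_mem (reflection_mem_weyl_support b i) hg) hi (by
      rw [mul_inv_rev, mul_smul, RootPairing.Equiv.reflection_inv, reflection_smul_self, smul_opp,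
        isPos_opp, not_not]
      exact hpos)
  rwa [← mul_assoc, reflection_mul_self, one_mul] at h

/-- An element of the Weyl group other than `1` is shortened by some simple reflection. -/
lemma exists_descent {g : P.Aut} (hg : g ∈ weyl P (b.support : Set ι)) (hne : g ≠ 1) :
    ∃ d ∈ b.support, ¬ b.IsPos (g⁻¹ • d) ∧ len b g = len b (𝓈 P d * g) + 1 := by
  obtain ⟨l, h1, rfl, h2⟩ := exists_word b hg
  cases l with
  | nil => exact absurd rfl hne
  | cons a l =>
    have ha : a ∈ b.support := h1 a (by simp)
    have hl' : ∀ i ∈ l, i ∈ b.support := fun i hi => h1 i (by simp [hi])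
    have e : 𝓈 P a * wordProd P (a :: l) = wordProd P l := by
      rw [wordProd_cons, ← mul_assoc, reflection_mul_self, one_mul]
    have h3 := len_le b hl'
    have h4 := len_simple_mul_le b ha hg
    have h5 := len_simple_mul_le b ha (g := wordProd P l)
      (e ▸ mul_mem (Subgroup.subset_closure ⟨a, ha, rfl⟩) hg)
    rw [← wordProd_cons] at h5
    rw [List.length_cons] at h2
    refine ⟨a, ha, fun hpos => ?_, by rw [e]; omega⟩
    have h6 := len_lt_reflection_mul b hg (RootPairing.Base.isPos_of_mem_support ha) hpos
    rw [e] at h6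
    omega

/-- An element of the Weyl group that preserves positivity is trivial. -/
lemma eq_one_of_isPos {g : P.Aut} (hg : g ∈ weyl P (b.support : Set ι))
    (h : ∀ d ∈ b.support, b.IsPos (g⁻¹ • d)) : g = 1 := by
  by_contra hne
  obtain ⟨d, hd, h1, -⟩ := exists_descent b hg hne
  exact h1 (h d hd)

/-- An element of the Weyl group is determined by the permutation of the roots that it induces. -/
lemma finite_weyl : Finite (weyl P (b.support : Set ι)) := by
  let f : weyl P (b.support : Set ι) → (ι → ι) := fun g i => (g : P.Aut) • i
  refine Finite.of_injective f fun g g' h => ?_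
  have h1 : (g : P.Aut)⁻¹ * g' = 1 := by
    refine eq_one_of_isPos b (mul_mem (inv_mem g.2) g'.2) fun d hd => ?_
    have h2 : (g : P.Aut) • d = (g' : P.Aut) • d := congrFun h d
    rw [mul_inv_rev, inv_inv, mul_smul, h2, inv_smul_smul]
    exact RootPairing.Base.isPos_of_mem_support hd
  exact Subtype.ext (inv_mul_eq_one.1 h1)

end RootCombinatorics

/-! ### Roots vanishing on a real functional -/

section Functional

variable {ι X Y : Type*} [AddCommGroup X] [AddCommGroup Y]
variable {P : RootPairing ι ℤ X Y}

lemma reflection_smul_weight (i : ι) (x : X) :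
    𝓈 P i • x = x - P.toLinearMap x (P.coroot i) • P.root i := by
  rw [RootPairing.Equiv.reflection_smul, RootPairing.reflection_apply]
  rfl

lemma map_reflection_smul (κ : X →+ ℝ) (i : ι) (x : X) :
    κ (𝓈 P i • x) = κ x - P.toLinearMap x (P.coroot i) * κ (P.root i) := by
  rw [reflection_smul_weight, map_sub, map_zsmul, zsmul_eq_mul]

lemma map_root_reflection_smul (κ : X →+ ℝ) (i j : ι) :
    κ (P.root (𝓈 P i • j)) = κ (P.root j) - P.pairing j i * κ (P.root i) := by
  rw [root_reflection_smul, map_sub, map_zsmul, zsmul_eq_mul]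

lemma smul_reflection_smul (w : P.Aut) (i j : ι) :
    w • 𝓈 P i • j = 𝓈 P (w • i) • w • j := by
  rw [reflection_smul_eq, mul_smul, mul_smul, inv_smul_smul]

/-- A group generated by reflections in roots on which `κ` vanishes fixes `κ`. -/
lemma map_smul_of_mem_weyl (κ : X →+ ℝ) {Δ : Set ι} (hΔ : ∀ d ∈ Δ, κ (P.root d) = 0) {g : P.Aut}
    (hg : g ∈ weyl P Δ) (x : X) : κ (g • x) = κ x := by
  induction hg using Subgroup.closure_induction generalizing x with
  | mem g hg =>
    obtain ⟨d, hd, rfl⟩ := hg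
    rw [map_reflection_smul, hΔ d hd, mul_zero, sub_zero]
  | one => rw [one_smul]
  | mul g g' _ _ h h' => rw [mul_smul, h, h']
  | inv g _ h => rw [← h, smul_inv_smul]

lemma opp_mem_generatedRoots {Δ : Set ι} {i : ι} (hi : i ∈ generatedRoots P Δ) :
    opp P i ∈ generatedRoots P Δ := by
  obtain ⟨w, hw, d, hd, rfl⟩ := hi
  refine ⟨w * 𝓈 P d, mul_mem hw (Subgroup.subset_closure ⟨d, hd, rfl⟩), d, hd, ?_⟩
  rw [mul_smul, reflection_smul_self, smul_opp]

lemma smul_mem_generatedRoots {Δ : Set ι} {i : ι} {g : P.Aut} (hg : g ∈ weyl P Δ) :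
    g • i ∈ generatedRoots P Δ ↔ i ∈ generatedRoots P Δ := by
  have H : ∀ g ∈ weyl P Δ, ∀ i ∈ generatedRoots P Δ, g • i ∈ generatedRoots P Δ := by
    rintro g hg _ ⟨w, hw, d, hd, rfl⟩
    exact ⟨g * w, mul_mem hg hw, d, hd, (mul_smul _ _ _).symm⟩
  refine ⟨fun h => ?_, H g hg i⟩
  simpa using H _ (inv_mem hg) _ h

lemma subset_generatedRoots {Δ : Set ι} {d : ι} (hd : d ∈ Δ) : d ∈ generatedRoots P Δ :=
  ⟨1, one_mem _, d, hd, (one_smul _ _).symm⟩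

lemma opp_mem_generatedRoots_iff {Δ : Set ι} {i : ι} :
    opp P i ∈ generatedRoots P Δ ↔ i ∈ generatedRoots P Δ :=
  ⟨fun h => by simpa using opp_mem_generatedRoots h, opp_mem_generatedRoots⟩

variable [Finite ι] (b : P.Base)

/-- The positive system of the roots that are positive for the lexicographic order given by `κ`
and then by the base is conjugate to the standard one. -/
lemma exists_smul_isPos_iff (κ : X →+ ℝ) : ∃ w ∈ weyl P (b.support : Set ι), ∀ i,
    b.IsPos (w • i) ↔ (0 < κ (P.root i) ∨ (κ (P.root i) = 0 ∧ b.IsPos i)) := by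
  have := finite_weyl b
  set Q : ι → Prop := fun i => 0 < κ (P.root i) ∨ (κ (P.root i) = 0 ∧ b.IsPos i) with hQ
  have hQ_or : ∀ i, ¬ Q i → Q (opp P i) := by
    intro i hi
    simp only [hQ, not_or, not_and, not_lt] at hi
    simp only [hQ, root_opp, map_neg, isPos_opp, neg_pos, neg_eq_zero]
    rcases hi.1.lt_or_eq with h | h
    exacts [Or.inl h, Or.inr ⟨h, hi.2 h⟩]
  have hQ_and : ∀ i, Q i → ¬ Q (opp P i) := by
    intro i hi hi'
    simp only [hQ, root_opp, map_neg, isPos_opp, neg_pos, neg_eq_zero] at hi hi'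
    rcases hi with h | h <;> rcases hi' with h' | h'
    · linarith
    · linarith [h'.1]
    · linarith [h.1]
    · exact h'.2 h.2
  have hQ_add : ∀ i j k, P.root k = P.root i + P.root j → Q i → Q j → Q k := by
    intro i j k hk hi hj
    have hκ : κ (P.root k) = κ (P.root i) + κ (P.root j) := by rw [hk, map_add]
    simp only [hQ, hκ] at hi hj ⊢
    rcases hi with h | h <;> rcases hj with h' | h'
    · left; linarith
    · left; linarith [h'.1]
    · left; linarith [h.1]
    · exact Or.inr ⟨by linarith [h.1, h'.1], h.2.add h'.2 hk⟩
  -- `Q` is the positive system of the functional `κ` perturbed by the given one. An element `w`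
  -- that makes the fewest members of `Q` negative maps `Q` onto the positive roots.
  obtain ⟨w, hw⟩ := Finite.exists_min
    (fun w : weyl P (b.support : Set ι) => {i | Q i ∧ ¬ b.IsPos ((w : P.Aut) • i)}.ncard)
  have hsimple : ∀ d ∈ b.support, Q ((w : P.Aut)⁻¹ • d) := by
    intro d hd
    by_contra hcon
    refine absurd (hw (simpleRefl P _ ⟨d, hd⟩ * w)) (not_le.2 ?_)
    refine Set.ncard_lt_ncard ?_ (Set.toFinite _)
    refine ⟨fun i hi => ⟨hi.1, fun hpos => hi.2 ?_⟩, fun hsub => ?_⟩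
    · change b.IsPos ((𝓈 P d * (w : P.Aut)) • i)
      rw [mul_smul]
      refine isPos_simple_smul b hd hpos fun h => hcon ?_
      rw [← h, inv_smul_smul]
      exact hi.1
    · have h1 : opp P ((w : P.Aut)⁻¹ • d) ∈ {i | Q i ∧ ¬ b.IsPos ((w : P.Aut) • i)} := by
        refine ⟨hQ_or _ hcon, ?_⟩
        rw [smul_opp, smul_inv_smul, isPos_opp, not_not]
        exact RootPairing.Base.isPos_of_mem_support hd
      refine (hsub h1).2 ?_
      change b.IsPos ((𝓈 P d * (w : P.Aut)) • _)
      rw [mul_smul, smul_opp, smul_inv_smul, smul_opp, reflection_smul_self, opp_opp]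
      exact RootPairing.Base.isPos_of_mem_support hd
  have hpos : ∀ i, b.IsPos i → Q ((w : P.Aut)⁻¹ • i) := by
    intro i hi
    refine RootPairing.Base.IsPos.induction_on_add (b := b)
      (p := fun i => Q ((w : P.Aut)⁻¹ • i)) hi hsimple ?_
    intro i j k hk hi hj
    refine hQ_add _ _ _ ?_ hi (hsimple j hj)
    rw [← smul_rootC, hk, smul_add, smul_rootC, smul_rootC]
  refine ⟨w, w.2, fun i => ⟨fun h => ?_, fun h => ?_⟩⟩
  · simpa using hpos _ h
  · by_contra hcon
    rw [← isPos_opp, ← smul_opp] at hcon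
    refine hQ_and i h ?_
    simpa using hpos _ hcon

/-- The stabilizer of a real functional in the Weyl group is generated by reflections. -/
lemma mem_weyl_of_fixed (κ : X →+ ℝ) {u : P.Aut} (hu : u ∈ weyl P (b.support : Set ι))
    (hfix : ∀ x : X, κ (u • x) = κ x) : u ∈ weyl P {i | κ (P.root i) = 0} := by
  -- the case of a dominant functional, by induction on the length
  have key : ∀ n : ℕ, ∀ κ : X →+ ℝ, (∀ i, b.IsPos i → 0 ≤ κ (P.root i)) →
      ∀ u ∈ weyl P (b.support : Set ι), (∀ x : X, κ (u • x) = κ x) → len b u ≤ n →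
        u ∈ weyl P {i | κ (P.root i) = 0} := by
    intro n
    induction n with
    | zero =>
      intro κ hκ u hu hfix hn
      by_cases h1 : u = 1
      · rw [h1]; exact one_mem _
      · obtain ⟨d, -, -, h⟩ := exists_descent b hu h1
        omega
    | succ n ih =>
      intro κ hκ u hu hfix hn
      by_cases h1 : u = 1
      · rw [h1]; exact one_mem _
      · obtain ⟨d, hd, hneg, hlen⟩ := exists_descent b hu h1
        have hdW : 𝓈 P d ∈ weyl P (b.support : Set ι) := Subgroup.subset_closure ⟨d, hd, rfl⟩
        have e1 : κ (P.root (u⁻¹ • d)) = κ (P.root d) := by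
          rw [← hfix (P.root (u⁻¹ • d)), smul_rootC, smul_inv_smul]
        have e2 : κ (P.root (u⁻¹ • d)) ≤ 0 := by
          have := hκ _ ((isPos_opp b _).2 hneg)
          rw [root_opp, map_neg] at this
          linarith
        have e3 := hκ d (RootPairing.Base.isPos_of_mem_support hd)
        have e4 : κ (P.root d) = 0 := by linarith
        have h2 := ih κ hκ (𝓈 P d * u) (mul_mem hdW hu) (fun x => by
          rw [mul_smul, map_reflection_smul, e4, mul_zero, sub_zero, hfix]) (by omega)
        have h3 : 𝓈 P d ∈ weyl P {i | κ (P.root i) = 0} :=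
          Subgroup.subset_closure ⟨d, e4, rfl⟩
        have h4 := mul_mem h3 h2
        rwa [← mul_assoc, reflection_mul_self, one_mul] at h4
  -- Conjugation by `w` makes `κ` dominant.
  obtain ⟨w, hw, hpos⟩ := exists_smul_isPos_iff b κ
  let κ' : X →+ ℝ := κ.comp (DistribSMul.toAddMonoidHom X w⁻¹)
  have hκ' : ∀ x, κ' x = κ (w⁻¹ • x) := fun x => rfl
  have h1 := key _ κ' (fun i hi => by
    rw [hκ', smul_rootC]
    have := (hpos (w⁻¹ • i)).1 (by rwa [smul_inv_smul])
    rcases this with h | h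
    exacts [h.le, h.1.ge]) (w * u * w⁻¹) (mul_mem (mul_mem hw hu) (inv_mem hw)) (fun x => by
      rw [hκ', hκ', mul_smul, mul_smul, inv_smul_smul, hfix]) le_rfl
  have h2 := conj_mem_weyl P (Δ' := {i | κ (P.root i) = 0}) w⁻¹ (fun d hd => by
    change κ (P.root (w⁻¹ • d)) = 0
    rw [← smul_rootC]
    exact hd) h1
  have e : w⁻¹ * (w * u * w⁻¹) * w⁻¹⁻¹ = u := by group
  rwa [e] at h2

/-- The indecomposable elements among the positive roots on which `κ` vanishes. -/
def kernelSimple (κ : X →+ ℝ) : Set ι :=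
  {i | (κ (P.root i) = 0 ∧ b.IsPos i) ∧
    ∀ j k, (κ (P.root j) = 0 ∧ b.IsPos j) → (κ (P.root k) = 0 ∧ b.IsPos k) →
      P.root i ≠ P.root j + P.root k}

/-- The simple roots of the subsystem `κ = 0` are conjugate to simple roots. The element `w` carries
the roots with `κ > 0` to positive roots, so that a positive root of the subsystem is decomposable
in it if its image under `w` is decomposable. -/
lemma exists_smul_kernelSimple (κ : X →+ ℝ) : ∃ w ∈ weyl P (b.support : Set ι),
    ∀ d ∈ kernelSimple b κ, w • d ∈ b.support := by
  obtain ⟨w, hw, hpos⟩ := exists_smul_isPos_iff b κ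
  refine ⟨w, hw, fun d hd => ?_⟩
  by_contra hcon
  obtain ⟨j, k, hj, hk, hsum⟩ := exists_add_of_not_mem_support b ((hpos d).2 (Or.inr hd.1)) hcon
  have hj' := (hpos (w⁻¹ • j)).1 (by rwa [smul_inv_smul])
  have hk' := (hpos (w⁻¹ • k)).1 (by rwa [smul_inv_smul])
  have hd' : P.root d = P.root (w⁻¹ • j) + P.root (w⁻¹ • k) := by
    rw [← smul_rootC, ← smul_rootC, ← smul_add, ← hsum, smul_rootC, inv_smul_smul]
  have hκ : κ (P.root (w⁻¹ • j)) + κ (P.root (w⁻¹ • k)) = 0 := by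
    rw [← map_add, ← hd']; exact hd.1.1
  refine hd.2 _ _ ?_ ?_ hd' <;>
  · rcases hj' with h | h <;> rcases hk' with h' | h'
    · linarith
    · linarith [h'.1]
    · linarith [h.1]
    · first | exact h | exact h'

omit [Finite ι] in
/-- An element that maps the simple roots of the subsystem `κ = 0` to simple roots preserves the
positivity of the roots in this subsystem. -/
lemma isPos_smul_of_kernelSimple (κ : X →+ ℝ) {w : P.Aut}
    (hw : ∀ d ∈ kernelSimple b κ, w • d ∈ b.support) {i : ι} (hi : κ (P.root i) = 0) :
    b.IsPos i ↔ b.IsPos (w • i) := by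
  have H : ∀ n : ℕ, ∀ i, κ (P.root i) = 0 → b.IsPos i → b.height i ≤ n → b.IsPos (w • i) := by
    intro n
    induction n with
    | zero => intro i _ hi h; exact absurd hi (not_lt.2 (by simpa using h))
    | succ n ih =>
      intro i hi hpos hn
      by_cases hs : i ∈ kernelSimple b κ
      · exact RootPairing.Base.isPos_of_mem_support (hw i hs)
      · have : ∃ j k, (κ (P.root j) = 0 ∧ b.IsPos j) ∧ (κ (P.root k) = 0 ∧ b.IsPos k) ∧
            P.root i = P.root j + P.root k := by
          by_contra hcon
          push Not at hcon
          exact hs ⟨⟨hi, hpos⟩, fun j k hj hk => hcon j k hj hk⟩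
        obtain ⟨j, k, hj, hk, hsum⟩ := this
        have h1 := b.height_add hsum
        have h2 : 0 < b.height j := hj.2
        have h3 : 0 < b.height k := hk.2
        refine (ih j hj.1 hj.2 (by push_cast at hn; omega)).add
          (ih k hk.1 hk.2 (by push_cast at hn; omega)) (k := w • i) ?_
        rw [← smul_rootC, hsum, smul_add, smul_rootC, smul_rootC]
  refine ⟨fun h => H (b.height i).toNat i hi h (Int.self_le_toNat _), fun h => ?_⟩
  by_contra hcon
  rw [← isPos_opp] at hcon
  have := H (b.height (opp P i)).toNat _ (by rw [root_opp, map_neg, hi, neg_zero]) hcon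
    (Int.self_le_toNat _)
  rw [smul_opp, isPos_opp] at this
  exact this h

/-- The roots on which `κ` vanishes are generated by the indecomposable positive ones. -/
lemma generatedRoots_kernelSimple (κ : X →+ ℝ) :
    generatedRoots P (kernelSimple b κ) = {i | κ (P.root i) = 0} := by
  apply Set.Subset.antisymm
  · rintro _ ⟨w, hw, d, hd, rfl⟩
    change κ (P.root (w • d)) = 0
    rw [← smul_rootC, map_smul_of_mem_weyl κ (fun d hd => hd.1.1) hw]
    exact hd.1.1
  · obtain ⟨w, hw, hpos⟩ := exists_smul_isPos_iff b κ
    have hposinv : ∀ i, b.IsPos i → 0 < κ (P.root (w⁻¹ • i)) ∨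
        (κ (P.root (w⁻¹ • i)) = 0 ∧ b.IsPos (w⁻¹ • i)) := by
      intro i hi
      exact (hpos (w⁻¹ • i)).1 (by rwa [smul_inv_smul])
    -- For `w` as in `exists_smul_isPos_iff`, the inverse images of simple roots on which `κ`
    -- vanishes are indecomposable; other roots are reached from them by induction on the height of
    -- the image.
    have hsimple : ∀ d ∈ b.support, κ (P.root (w⁻¹ • d)) = 0 →
        w⁻¹ • d ∈ kernelSimple b κ := by
      intro d hd h0
      refine ⟨⟨h0, ?_⟩, fun j k hj hk hsum => ?_⟩
      · rcases hposinv d (RootPairing.Base.isPos_of_mem_support hd) with h | h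
        · linarith
        · exact h.2
      · have h1 : 0 < b.height (w • j) := (hpos j).2 (Or.inr hj)
        have h2 : 0 < b.height (w • k) := (hpos k).2 (Or.inr hk)
        have h3 : P.root d = P.root (w • j) + P.root (w • k) := by
          rw [← smul_rootC, ← smul_rootC, ← smul_add, ← hsum, smul_rootC, smul_inv_smul]
        have h4 := b.height_add h3
        have h5 := RootPairing.Base.height_one_of_mem_support hd
        omega
    have H : ∀ n : ℕ, ∀ i, b.IsPos i → κ (P.root (w⁻¹ • i)) = 0 → b.height i ≤ n →
        w⁻¹ • i ∈ generatedRoots P (kernelSimple b κ) := by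
      intro n
      induction n with
      | zero => intro i hi _ h; exact absurd hi (not_lt.2 (by simpa using h))
      | succ n ih =>
        intro i hi h0 hn
        obtain ⟨d, hd, hpair, hlt⟩ := exists_simple_height_lt b hi
        by_cases hid : i = d
        · exact subset_generatedRoots (hsimple i (hid ▸ hd) h0)
        · obtain ⟨h1, h2⟩ := hlt hid
          have e : w⁻¹ • 𝓈 P d • i = 𝓈 P (w⁻¹ • d) • w⁻¹ • i := by
            rw [smul_reflection_smul]
          have hpd : P.pairing (w⁻¹ • i) (w⁻¹ • d) = P.pairing i d := by
            rw [← RootPairing.root_coroot_eq_pairing, ← RootPairing.root_coroot_eq_pairing,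
              ← smul_rootC, pairing_smul]
          have h3 : κ (P.root (w⁻¹ • 𝓈 P d • i)) = -(P.pairing i d * κ (P.root (w⁻¹ • d))) := by
            rw [e, map_root_reflection_smul, h0, hpd, zero_sub]
          have h4 : 0 ≤ κ (P.root (w⁻¹ • d)) := by
            rcases hposinv d (RootPairing.Base.isPos_of_mem_support hd) with h | h
            exacts [h.le, h.1.ge]
          have h5 : 0 ≤ κ (P.root (w⁻¹ • 𝓈 P d • i)) := by
            rcases hposinv _ h1 with h | h
            exacts [h.le, h.1.ge]
          have hpair' : (0 : ℝ) < P.pairing i d := by exact_mod_cast hpair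
          have h6 : κ (P.root (w⁻¹ • d)) = 0 := by
            by_contra hne
            have := mul_pos hpair' (lt_of_le_of_ne h4 (Ne.symm hne))
            linarith
          have h7 := ih _ h1 (by rw [h3, h6, mul_zero, neg_zero]) (by push_cast at hn; omega)
          rw [e] at h7
          exact (smul_mem_generatedRoots
            (Subgroup.subset_closure ⟨_, hsimple d hd h6, rfl⟩)).1 h7
    have H' : ∀ i, b.IsPos (w • i) → κ (P.root i) = 0 →
        i ∈ generatedRoots P (kernelSimple b κ) := by
      intro i hi h0
      have := H _ (w • i) hi (by rwa [inv_smul_smul]) (Int.self_le_toNat _)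
      rwa [inv_smul_smul] at this
    intro i hi
    by_cases h : b.IsPos (w • i)
    · exact H' i h hi
    · rw [← isPos_opp, ← smul_opp] at h
      rw [← opp_mem_generatedRoots_iff]
      exact H' _ h (by rw [root_opp, map_neg, show κ (P.root i) = 0 from hi, neg_zero])

/-! ### Conjugating a subsystem to a standard one -/

/-- The automorphism `w` maps `Δ` into the base, and preserves the positivity of the roots generated
by `Δ`. -/
structure IsStandardizing (Δ : Set ι) (w : P.Aut) : Prop where
  mem : ∀ d ∈ Δ, w • d ∈ (b.support : Set ι)
  pos : ∀ i ∈ generatedRoots P Δ, b.IsPos i ↔ b.IsPos (w • i)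

omit [Finite ι] in
lemma isStandardizing_one {Δ : Set ι} (h : Δ ⊆ b.support) : IsStandardizing b Δ (1 : P.Aut) :=
  ⟨fun d hd => by rw [one_smul]; exact h hd, fun i _ => by rw [one_smul]⟩

variable {b} {Δ : Set ι} {w : P.Aut}

lemma IsStandardizing.isPos_smul_reflection (hw : IsStandardizing b Δ w) {d i : ι} (hd : d ∈ Δ)
    (hi : b.IsPos (w • i)) (hne : i ≠ d) : b.IsPos (w • 𝓈 P d • i) := by
  have e : w • 𝓈 P d • i = 𝓈 P (w • d) • w • i := by
    rw [smul_reflection_smul]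
  rw [e]
  exact isPos_simple_smul b (hw.mem d hd) hi fun h => hne (smul_left_cancel _ h)

/-- The Weyl group of `Δ` permutes the roots outside the subsystem whose image under `w` is
positive. -/
lemma IsStandardizing.isPos_smul_smul (hw : IsStandardizing b Δ w) {g : P.Aut} (hg : g ∈ weyl P Δ)
    {i : ι} (hi : i ∉ generatedRoots P Δ) : b.IsPos (w • g • i) ↔ b.IsPos (w • i) := by
  have H1 : ∀ d ∈ Δ, ∀ i ∉ generatedRoots P Δ, b.IsPos (w • i) → b.IsPos (w • 𝓈 P d • i) := by
    intro d hd i hi h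
    exact hw.isPos_smul_reflection hd h fun e => hi (e ▸ subset_generatedRoots hd)
  revert i
  induction hg using Subgroup.closure_induction with
  | mem x hx =>
    intro i hi
    obtain ⟨d, hd, rfl⟩ := hx
    refine ⟨fun h => ?_, H1 d hd i hi⟩
    have := H1 d hd (𝓈 P d • i) (by
      rwa [smul_mem_generatedRoots (Subgroup.subset_closure ⟨d, hd, rfl⟩)]) h
    rwa [reflection_smul_reflection_smul] at this
  | one => intro i hi; rw [one_smul]
  | mul x y hx hy h h' =>
    intro i hi
    rw [mul_smul]
    exact Iff.trans (h (i := y • i) (by rwa [smul_mem_generatedRoots hy])) (h' hi)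
  | inv x hx h =>
    intro i hi
    have := h (i := x⁻¹ • i) (by rwa [smul_mem_generatedRoots (inv_mem hx)])
    rw [smul_inv_smul] at this
    exact this.symm

/-- The Weyl group of `Δ` contains no reflections other than those in the roots of the subsystem. -/
lemma IsStandardizing.reflection_mem_iff (hw : IsStandardizing b Δ w) {i : ι} :
    𝓈 P i ∈ weyl P Δ ↔ i ∈ generatedRoots P Δ := by
  refine ⟨fun h => ?_, reflection_mem_weyl_of_generatedRoots P Δ⟩
  by_contra hi
  have := hw.isPos_smul_smul h hi
  rw [reflection_smul_self, smul_opp, isPos_opp] at this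
  tauto

/-- A standardizing element of the Weyl group is the shortest element of its coset. -/
lemma IsStandardizing.len_le (hw : IsStandardizing b Δ w) (hwW : w ∈ weyl P (b.support : Set ι))
    {g : P.Aut} (hg : g ∈ weyl P Δ) : len b w ≤ len b (w * g) := by
  -- For `h` with `w h` shortest in the coset, `w h w⁻¹` preserves positivity, and so is `1`.
  obtain ⟨h, hmin⟩ := exists_minimalFor_of_wellFoundedLT (fun g => g ∈ weyl P Δ)
    (fun g => len b (w * g)) ⟨1, one_mem _⟩
  have hle : ∀ g ∈ weyl P Δ, len b (w * h) ≤ len b (w * g) := by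
    intro g hg
    by_contra hcon
    push Not at hcon
    exact absurd (hmin.2 hg hcon.le) (not_le.2 hcon)
  have hΔW : ∀ g ∈ weyl P Δ, g ∈ weyl P (b.support : Set ι) := by
    intro g hg
    refine (Subgroup.closure_le _).2 ?_ hg
    rintro _ ⟨d, -, rfl⟩
    exact reflection_mem_weyl_support b d
  have hhW := hΔW h hmin.1
  have hpos : ∀ i ∈ generatedRoots P Δ, b.IsPos i → b.IsPos (h⁻¹ • i) := by
    intro i hi hip
    by_contra hcon
    have h1 := len_reflection_mul_lt b (g := w * h) (mul_mem hwW hhW) (i := w • i)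
      ((hw.pos i hi).1 hip) (by rwa [mul_inv_rev, mul_smul, inv_smul_smul])
    rw [reflection_smul_eq] at h1
    have h2 := hle (𝓈 P i * h) (mul_mem (reflection_mem_weyl_of_generatedRoots P Δ hi) hmin.1)
    have e : w * 𝓈 P i * w⁻¹ * (w * h) = w * (𝓈 P i * h) := by group
    rw [e] at h1
    omega
  have h1 : w * h * w⁻¹ = 1 := by
    refine eq_one_of_isPos b (mul_mem (mul_mem hwW hhW) (inv_mem hwW)) fun d hd => ?_
    have hd' := RootPairing.Base.isPos_of_mem_support hd
    have e : (w * h * w⁻¹)⁻¹ • d = w • h⁻¹ • w⁻¹ • d := by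
      rw [mul_inv_rev, mul_inv_rev, inv_inv, mul_smul, mul_smul]
    rw [e]
    by_cases hgen : w⁻¹ • d ∈ generatedRoots P Δ
    · rw [← hw.pos _ ((smul_mem_generatedRoots (inv_mem hmin.1)).2 hgen)]
      refine hpos _ hgen ?_
      rwa [hw.pos _ hgen, smul_inv_smul]
    · rwa [hw.isPos_smul_smul (inv_mem hmin.1) hgen, smul_inv_smul]
  have h2 : h = 1 := by rwa [mul_inv_eq_one, mul_eq_left] at h1
  have h3 := hle g hg
  rwa [h2, mul_one] at h3

lemma isStandardizing_kernelSimple (κ : X →+ ℝ) {w : P.Aut}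
    (hw : ∀ d ∈ kernelSimple b κ, w • d ∈ b.support) :
    IsStandardizing b (kernelSimple b κ) w :=
  ⟨hw, fun i hi => isPos_smul_of_kernelSimple b κ hw (by
    rw [generatedRoots_kernelSimple] at hi; exact hi)⟩

end Functional

/-! ### Weights of commuting families of operators -/

section CommutingFamily

open Module

variable {E V U : Type*} [AddCommGroup E] [Module ℂ E] [AddCommGroup V] [Module ℂ V]
  [AddCommGroup U] [Module ℂ U]

/-- The generalized weight space of a linear family of operators. -/
def wt (f : E →ₗ[ℂ] End ℂ V) (χ : E →ₗ[ℂ] ℂ) : Submodule ℂ V :=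
  ⨅ ω : E, (f ω).maxGenEigenspace (χ ω)

/-- The sum of the generalized weight spaces for the weights in the set `S`. -/
def wtSum (f : E →ₗ[ℂ] End ℂ V) (S : Set (E →ₗ[ℂ] ℂ)) : Submodule ℂ V :=
  ⨆ χ ∈ S, wt f χ

lemma wt_le_wtSum {f : E →ₗ[ℂ] End ℂ V} {S : Set (E →ₗ[ℂ] ℂ)} {χ : E →ₗ[ℂ] ℂ} (h : χ ∈ S) :
    wt f χ ≤ wtSum f S := le_iSup₂_of_le χ h le_rfl

lemma wtSum_mono {f : E →ₗ[ℂ] End ℂ V} {S T : Set (E →ₗ[ℂ] ℂ)} (h : S ⊆ T) :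
    wtSum f S ≤ wtSum f T := biSup_mono h

lemma wtSum_union {f : E →ₗ[ℂ] End ℂ V} {S T : Set (E →ₗ[ℂ] ℂ)} :
    wtSum f (S ∪ T) = wtSum f S ⊔ wtSum f T := iSup_union

lemma map_mem_wt {f : E →ₗ[ℂ] End ℂ V} {f' : E →ₗ[ℂ] End ℂ U} {g : U →ₗ[ℂ] V}
    (hg : ∀ ω u, g (f' ω u) = f ω (g u)) {χ : E →ₗ[ℂ] ℂ} {u : U} (hu : u ∈ wt f' χ) :
    g u ∈ wt f χ := by
  rw [wt, End.mem_iInf_maxGenEigenspace_iff] at hu ⊢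
  intro ω
  obtain ⟨k, hk⟩ := hu ω
  refine ⟨k, ?_⟩
  have this : ∀ (k : ℕ) u, ((f ω - χ ω • (1 : End ℂ V)) ^ k) (g u) =
      g (((f' ω - χ ω • (1 : End ℂ U)) ^ k) u) := by
    intro k
    induction k with
    | zero => intro u; simp
    | succ k ih =>
      intro u
      rw [pow_succ, Module.End.mul_apply, pow_succ, Module.End.mul_apply, ← ih]
      congr 1
      simp [hg]
  rw [this, hk, map_zero]

lemma map_mem_wtSum {f : E →ₗ[ℂ] End ℂ V} {f' : E →ₗ[ℂ] End ℂ U} {g : U →ₗ[ℂ] V}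
    (hg : ∀ ω u, g (f' ω u) = f ω (g u)) {S : Set (E →ₗ[ℂ] ℂ)} {u : U} (hu : u ∈ wtSum f' S) :
    g u ∈ wtSum f S := by
  suffices h : wtSum f' S ≤ (wtSum f S).comap g from h hu
  refine iSup₂_le fun χ hχ u hu => ?_
  exact wt_le_wtSum hχ (map_mem_wt hg hu)

/-- Weights of a family precomposed with a linear map. -/
lemma mem_wtSum_comp {E' : Type*} [AddCommGroup E'] [Module ℂ E'] {f : E →ₗ[ℂ] End ℂ V}
    (a : E' →ₗ[ℂ] E) {S : Set (E →ₗ[ℂ] ℂ)} {v : V} (hv : v ∈ wtSum f S) :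
    v ∈ wtSum (f ∘ₗ a) ((fun χ => χ ∘ₗ a) '' S) := by
  suffices h : wtSum f S ≤ wtSum (f ∘ₗ a) ((fun χ => χ ∘ₗ a) '' S) from h hv
  refine iSup₂_le fun χ hχ v hv => ?_
  refine wt_le_wtSum (Set.mem_image_of_mem _ hχ) ?_
  rw [wt, Submodule.mem_iInf] at hv ⊢
  exact fun ω => hv (a ω)

omit [AddCommGroup E] [Module ℂ E] in
/-- A stable subspace of a generalized weight space contains an eigenvector. -/
lemma exists_eigenvector_of_le [FiniteDimensional ℂ V] {f : E → End ℂ V}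
    (hf : ∀ ω ω', Commute (f ω) (f ω')) {N : Submodule ℂ V} (hN : ∀ ω, ∀ v ∈ N, f ω v ∈ N)
    (hne : N ≠ ⊥) {χ : E → ℂ} (hχ : N ≤ ⨅ ω : E, (f ω).maxGenEigenspace (χ ω)) :
    ∃ v ∈ N, v ≠ 0 ∧ ∀ ω, f ω v = χ ω • v := by
  -- On a minimal stable subspace, each of the commuting nilpotent operators `f ω - χ ω` has a
  -- kernel that is stable and nonzero, so that these operators vanish.
  obtain ⟨M, ⟨hMN, hM, hMne⟩, hmin⟩ := WellFounded.has_min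
    (wellFounded_lt (α := Submodule ℂ V))
    {M | M ≤ N ∧ (∀ ω, ∀ v ∈ M, f ω v ∈ M) ∧ M ≠ ⊥} ⟨N, le_rfl, hN, hne⟩
  obtain ⟨v, hv, hv0⟩ := M.ne_bot_iff.1 hMne
  refine ⟨v, hMN hv, hv0, fun ω => ?_⟩
  let g : End ℂ V := f ω - χ ω • 1
  have hgM : ∀ v ∈ M, g v ∈ M := fun v hv =>
    M.sub_mem (hM ω v hv) (M.smul_mem _ hv)
  have hker : M ⊓ LinearMap.ker g = M := by
    by_contra hcon
    refine hmin (M ⊓ LinearMap.ker g) ⟨inf_le_left.trans hMN, ?_, ?_⟩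
      (lt_of_le_of_ne inf_le_left hcon)
    · rintro ω' v ⟨hv, hv'⟩
      refine ⟨hM ω' v hv, ?_⟩
      have hc : Commute g (f ω') :=
        (hf ω ω').sub_left ((Commute.one_left _).smul_left _)
      have hv'' : g v = 0 := hv'
      change g (f ω' v) = 0
      rw [← Module.End.mul_apply, hc.eq, Module.End.mul_apply, hv'', map_zero]
    · have h1 := hχ (hMN hv)
      rw [End.mem_iInf_maxGenEigenspace_iff] at h1
      have h2 : ∃ k, (g ^ k) v = 0 := h1 ω
      classical
      have h3 := Nat.find_spec h2
      have h4 : Nat.find h2 ≠ 0 := by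
        intro h0
        rw [h0] at h3
        exact hv0 (by simpa using h3)
      obtain ⟨k, hk⟩ := Nat.exists_eq_succ_of_ne_zero h4
      have h5 := Nat.find_min h2 (m := k) (by omega)
      rw [Submodule.ne_bot_iff]
      refine ⟨(g ^ k) v, ⟨?_, ?_⟩, h5⟩
      · rw [Module.End.pow_apply]
        exact Set.MapsTo.iterate (s := (M : Set V)) (fun v hv => hgM v hv) k hv
      · change g ((g ^ k) v) = 0
        rw [← Module.End.mul_apply, ← pow_succ', ← Nat.succ_eq_add_one, ← hk, h3]
  have h6 : v ∈ M ⊓ LinearMap.ker g := hker.symm ▸ hv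
  have h7 : g v = 0 := h6.2
  exact sub_eq_zero.1 (by simpa [g] using h7)

section

variable [FiniteDimensional ℂ V] {f : E →ₗ[ℂ] End ℂ V}

lemma wtSum_univ (hf : ∀ ω ω', Commute (f ω) (f ω')) : wtSum f Set.univ = ⊤ := by
  have h1 := End.iSup_iInf_maxGenEigenspace_eq_top_of_iSup_maxGenEigenspace_eq_top_of_commute
    (fun ω => f ω) (fun _ _ _ => hf _ _) (fun ω => End.iSup_maxGenEigenspace_eq_top (f ω))
  rw [eq_top_iff, ← h1]
  refine iSup_le fun χ => ?_
  by_cases hbot : (⨅ ω, (f ω).maxGenEigenspace (χ ω)) = ⊥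
  · rw [hbot]; exact bot_le
  · obtain ⟨v, -, hv0, hv⟩ := exists_eigenvector_of_le (f := fun ω => f ω) hf
      (N := ⨅ ω, (f ω).maxGenEigenspace (χ ω)) (fun ω v hv => by
        rw [Submodule.mem_iInf] at hv ⊢
        exact fun ω' => End.mapsTo_maxGenEigenspace_of_comm (hf ω' ω) _ (hv ω')) hbot le_rfl
    -- A family of eigenvalues with a common eigenvector depends linearly on `ω`.
    let χ' : E →ₗ[ℂ] ℂ :=
      { toFun := χ
        map_add' := fun ω ω' => by
          have := hv (ω + ω')
          rw [map_add, LinearMap.add_apply, hv, hv, ← add_smul] at this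
          exact (smul_left_injective ℂ hv0 this).symm
        map_smul' := fun z ω => by
          have := hv (z • ω)
          rw [map_smul, LinearMap.smul_apply, hv, smul_smul] at this
          exact (smul_left_injective ℂ hv0 this).symm }
    exact wt_le_wtSum (f := f) (χ := χ') (Set.mem_univ _)

omit [FiniteDimensional ℂ V] in
/-- Weight spaces for disjoint sets of weights are independent; finite dimension is not needed. -/
lemma disjoint_wtSum (hf : ∀ ω ω', Commute (f ω) (f ω')) {S T : Set (E →ₗ[ℂ] ℂ)}
    (h : Disjoint S T) : Disjoint (wtSum f S) (wtSum f T) := by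
  have h1 := End.independent_iInf_maxGenEigenspace_of_forall_mapsTo (fun ω => f ω)
    (fun ω ω' φ => End.mapsTo_maxGenEigenspace_of_comm (hf ω' ω) φ)
  have h2 : iSupIndep (wt f) := h1.comp (f := fun χ : E →ₗ[ℂ] ℂ => (χ : E → ℂ))
    DFunLike.coe_injective
  exact h2.disjoint_biSup_biSup h

omit [FiniteDimensional ℂ V] in
lemma apply_mem_wt (hf : ∀ ω ω', Commute (f ω) (f ω')) {χ : E →ₗ[ℂ] ℂ} (ω : E) {v : V}
    (hv : v ∈ wt f χ) : f ω v ∈ wt f χ :=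
  map_mem_wt (g := f ω) (fun ω' u => LinearMap.congr_fun (hf ω ω').eq u) hv

omit [FiniteDimensional ℂ V] in
lemma apply_mem_wtSum (hf : ∀ ω ω', Commute (f ω) (f ω')) {S : Set (E →ₗ[ℂ] ℂ)} (ω : E) {v : V}
    (hv : v ∈ wtSum f S) : f ω v ∈ wtSum f S :=
  map_mem_wtSum (g := f ω) (fun ω' u => LinearMap.congr_fun (hf ω ω').eq u) hv

lemma isCompl_wtSum (hf : ∀ ω ω', Commute (f ω) (f ω')) (S : Set (E →ₗ[ℂ] ℂ)) :
    IsCompl (wtSum f S) (wtSum f Sᶜ) :=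
  ⟨disjoint_wtSum hf disjoint_compl_right, by
    rw [codisjoint_iff, ← wtSum_union, Set.union_compl_self, wtSum_univ hf]⟩

lemma exists_add_wtSum (hf : ∀ ω ω', Commute (f ω) (f ω')) (S : Set (E →ₗ[ℂ] ℂ)) (v : V) :
    ∃ a ∈ wtSum f S, ∃ a' ∈ wtSum f Sᶜ, a + a' = v :=
  Submodule.mem_sup.1 ((isCompl_wtSum hf S).sup_eq_top ▸ Submodule.mem_top)

omit [FiniteDimensional ℂ V] in
lemma mem_wtSum_inter (hf : ∀ ω ω', Commute (f ω) (f ω')) {S T : Set (E →ₗ[ℂ] ℂ)} {v : V}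
    (hS : v ∈ wtSum f S) (hT : v ∈ wtSum f T) : v ∈ wtSum f (S ∩ T) := by
  rw [← Set.inter_union_sdiff S T, wtSum_union] at hS
  obtain ⟨a, ha, a', ha', rfl⟩ := Submodule.mem_sup.1 hS
  have h1 : a' ∈ wtSum f T := by
    have := Submodule.sub_mem _ hT (wtSum_mono Set.inter_subset_right ha)
    rwa [add_sub_cancel_left] at this
  have h2 : a' = 0 :=
    (Submodule.disjoint_def.1 (disjoint_wtSum hf Set.disjoint_sdiff_left)) _ ha' h1
  rwa [h2, add_zero]

/-- If `g` intertwines two families modulo a stable subspace `T`, it maps the sum of the weight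
spaces for a set `S` into the sum of `T` and the weight spaces for `S`. -/
lemma map_mem_sup_wtSum (hf : ∀ ω ω', Commute (f ω) (f ω')) {T : Submodule ℂ V}
    (hT : ∀ ω, ∀ v ∈ T, f ω v ∈ T) {f' : E →ₗ[ℂ] End ℂ U} {g : U →ₗ[ℂ] V}
    (hg : ∀ ω u, f ω (g u) - g (f' ω u) ∈ T) {S : Set (E →ₗ[ℂ] ℂ)} {u : U}
    (hu : u ∈ wtSum f' S) : g u ∈ T ⊔ wtSum f S := by
  let q : E →ₗ[ℂ] End ℂ (V ⧸ T) :=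
    { toFun := fun ω => T.mapQ T (f ω) (fun v hv => hT ω v hv)
      map_add' := fun ω ω' => by ext v; simp
      map_smul' := fun z ω => by ext v; simp }
  have hq : ∀ ω v, T.mkQ (f ω v) = q ω (T.mkQ v) := fun ω v => rfl
  have hqc : ∀ ω ω', Commute (q ω) (q ω') := by
    intro ω ω'
    refine LinearMap.ext fun v => ?_
    obtain ⟨v, rfl⟩ := T.mkQ_surjective v
    rw [Module.End.mul_apply, Module.End.mul_apply, ← hq, ← hq, ← hq, ← hq,
      ← Module.End.mul_apply, (hf ω ω').eq, Module.End.mul_apply]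
  have h1 : (T.mkQ ∘ₗ g) u ∈ wtSum q S := map_mem_wtSum (fun ω u => by
    rw [LinearMap.comp_apply, LinearMap.comp_apply, ← hq]
    exact ((Submodule.Quotient.eq T).2 (hg ω u)).symm) hu
  obtain ⟨a, ha, a', ha', hsum⟩ := exists_add_wtSum hf S (g u)
  have h2 : T.mkQ a ∈ wtSum q S := map_mem_wtSum hq ha
  have h3 : T.mkQ a' ∈ wtSum q Sᶜ := map_mem_wtSum hq ha'
  have h4 : T.mkQ a' ∈ wtSum q S := by
    have := Submodule.sub_mem _ h1 h2
    rwa [LinearMap.comp_apply, ← hsum, map_add, add_sub_cancel_left] at this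
  have h5 : T.mkQ a' = 0 :=
    (Submodule.disjoint_def.1 (disjoint_wtSum hqc disjoint_compl_right)) _ h4 h3
  rw [Submodule.mkQ_apply, Submodule.Quotient.mk_eq_zero] at h5
  rw [← hsum, add_comm]
  exact Submodule.add_mem_sup h5 ha

/-- The family of operators on a stable subspace. -/
def restrictFamily (f : E →ₗ[ℂ] End ℂ V) (N : Submodule ℂ V) (hN : ∀ ω, ∀ v ∈ N, f ω v ∈ N) :
    E →ₗ[ℂ] End ℂ N where
  toFun ω := (f ω).restrict (hN ω)
  map_add' ω ω' := by ext v; simp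
  map_smul' z ω := by ext v; simp

omit [FiniteDimensional ℂ V] in
lemma coe_restrictFamily {N : Submodule ℂ V} (hN : ∀ ω, ∀ v ∈ N, f ω v ∈ N) (ω : E) (v : N) :
    (restrictFamily f N hN ω v : V) = f ω v := rfl

omit [FiniteDimensional ℂ V] in
lemma restrictFamily_commute (hf : ∀ ω ω', Commute (f ω) (f ω')) {N : Submodule ℂ V}
    (hN : ∀ ω, ∀ v ∈ N, f ω v ∈ N) (ω ω' : E) :
    Commute (restrictFamily f N hN ω) (restrictFamily f N hN ω') := by
  refine LinearMap.ext fun v => Subtype.ext ?_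
  rw [Module.End.mul_apply, Module.End.mul_apply, coe_restrictFamily, coe_restrictFamily,
    coe_restrictFamily, coe_restrictFamily, ← Module.End.mul_apply, (hf ω ω').eq,
    Module.End.mul_apply]

/-- A stable subspace is the direct sum of its intersections with the weight spaces. -/
lemma mem_of_add_mem (hf : ∀ ω ω', Commute (f ω) (f ω')) {N : Submodule ℂ V}
    (hN : ∀ ω, ∀ v ∈ N, f ω v ∈ N) {S : Set (E →ₗ[ℂ] ℂ)} {a a' : V} (ha : a ∈ wtSum f S)
    (ha' : a' ∈ wtSum f Sᶜ) (h : a + a' ∈ N) : a ∈ N := by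
  have hc := restrictFamily_commute hf hN
  have hs : ∀ ω (v : N), N.subtype (restrictFamily f N hN ω v) = f ω (N.subtype v) :=
    coe_restrictFamily hN
  obtain ⟨x, hx, x', hx', hsum⟩ := exists_add_wtSum hc S ⟨a + a', h⟩
  have h1 : N.subtype x ∈ wtSum f S := map_mem_wtSum hs hx
  have h2 : N.subtype x' ∈ wtSum f Sᶜ := map_mem_wtSum hs hx'
  have h3 : N.subtype x + N.subtype x' = a + a' := by rw [← map_add, hsum]; rfl
  have h4 : N.subtype x - a = a' - N.subtype x' := by
    rw [sub_eq_sub_iff_add_eq_add, h3, add_comm]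
  have h4' : N.subtype x - a ∈ wtSum f Sᶜ := by rw [h4]; exact Submodule.sub_mem _ ha' h2
  have h5 : N.subtype x - a = 0 := Submodule.disjoint_def.1 (isCompl_wtSum hf S).disjoint _
    (Submodule.sub_mem _ h1 ha) h4'
  rw [← sub_eq_zero.1 h5]
  exact x.2

/-- A nonzero stable subspace whose weights lie in `S` contains a simultaneous eigenvector, and the
eigenvalues form a weight in `S`. -/
lemma exists_eigenvector (hf : ∀ ω ω', Commute (f ω) (f ω')) {N : Submodule ℂ V}
    (hN : ∀ ω, ∀ v ∈ N, f ω v ∈ N) (hne : N ≠ ⊥) {S : Set (E →ₗ[ℂ] ℂ)} (hS : N ≤ wtSum f S) :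
    ∃ χ ∈ S, ∃ v ∈ N, v ≠ 0 ∧ ∀ ω, f ω v = χ ω • v := by
  have hc := restrictFamily_commute hf hN
  have hs : ∀ ω (v : N), N.subtype (restrictFamily f N hN ω v) = f ω (N.subtype v) :=
    coe_restrictFamily hN
  have h1 : ∃ χ, wt (restrictFamily f N hN) χ ≠ ⊥ := by
    by_contra hcon
    push Not at hcon
    have h2 := wtSum_univ hc
    have h3 : wtSum (restrictFamily f N hN) Set.univ ≤ ⊥ := iSup₂_le fun χ _ => (hcon χ).le
    obtain ⟨v, hv, hv0⟩ := N.ne_bot_iff.1 hne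
    have h4 : (⟨v, hv⟩ : N) ∈ (⊥ : Submodule ℂ N) := h3 (h2 ▸ Submodule.mem_top)
    exact hv0 (congrArg N.subtype ((Submodule.mem_bot ℂ).1 h4))
  obtain ⟨χ, hχ⟩ := h1
  have hstab : ∀ ω, ∀ v ∈ N ⊓ wt f χ, f ω v ∈ N ⊓ wt f χ := fun ω v hv =>
    ⟨hN ω v hv.1, apply_mem_wt hf ω hv.2⟩
  have hne' : N ⊓ wt f χ ≠ ⊥ := by
    obtain ⟨v, hv, hv0⟩ := Submodule.exists_mem_ne_zero_of_ne_bot hχ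
    have h2 : N.subtype v ∈ wt f χ := map_mem_wt hs hv
    have h3 : N.subtype v ≠ 0 := fun h => hv0 (Subtype.ext h)
    exact (Submodule.ne_bot_iff _).2 ⟨N.subtype v, ⟨v.2, h2⟩, h3⟩
  obtain ⟨v, hv, hv0, hv'⟩ := exists_eigenvector_of_le (f := fun ω => f ω) hf hstab hne'
    (χ := χ) inf_le_right
  refine ⟨χ, ?_, v, hv.1, hv0, hv'⟩
  by_contra hχS
  have hd : Disjoint (wtSum f {χ}) (wtSum f S) :=
    disjoint_wtSum hf (Set.disjoint_singleton_left.2 hχS)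
  exact hv0 (Submodule.disjoint_def.1 hd v (wt_le_wtSum (Set.mem_singleton χ) hv.2) (hS hv.1))

end

end CommutingFamily

/-! ### Calculations in graded Hecke algebras -/

section AlgLemmas

variable {W E D : Type*} [Group W] [AddCommGroup E] [Module ℂ E]
variable {s : D → W} {α : D → E} {αv : D → Module.Dual ℂ E} {c : D → ℂ}
variable {V V' : Type*} [AddCommGroup V] [Module ℂ V] [AddCommGroup V'] [Module ℂ V']

omit [AddCommGroup E] [Module ℂ E] in
lemma induction_of_closure (hs2 : ∀ d, s d * s d = 1) (hs : Subgroup.closure (Set.range s) = ⊤)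
    {p : W → Prop} (h1 : p 1) (hmul : ∀ d w, p w → p (s d * w)) (w : W) : p w := by
  have hw : w ∈ Subgroup.closure (Set.range s) := hs ▸ Subgroup.mem_top w
  induction hw using Subgroup.closure_induction_left with
  | one => exact h1
  | mul_left x hx y _ ih =>
    obtain ⟨d, rfl⟩ := hx
    exact hmul d y ih
  | inv_mul_cancel x hx y _ ih =>
    obtain ⟨d, rfl⟩ := hx
    rw [inv_eq_of_mul_eq_one_left (hs2 d)]
    exact hmul d y ih

lemma Alg.induction {p : Alg s α αv c → Prop} (ht : ∀ w, p (Alg.t w)) (hr : p Alg.r)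
    (hx : ∀ ω, p (Alg.x ω)) (hz : ∀ z : ℂ, p (algebraMap ℂ _ z))
    (hadd : ∀ a b, p a → p b → p (a + b)) (hmul : ∀ a b, p a → p b → p (a * b)) (a) : p a := by
  obtain ⟨y, rfl⟩ := RingQuot.mkAlgHom_surjective ℂ (Rel s α αv c) a
  induction y using FreeAlgebra.induction with
  | grade0 z => rw [AlgHom.commutes]; exact hz z
  | grade1 y =>
    cases y with
    | t w => exact ht w
    | r => exact hr
    | x ω => exact hx ω
  | mul a b ha hb => rw [map_mul]; exact hmul _ _ ha hb
  | add a b ha hb => rw [map_add]; exact hadd _ _ ha hb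

lemma Alg.hom_ext {B : Type*} [Ring B] [Algebra ℂ B] {f g : Alg s α αv c →ₐ[ℂ] B}
    (ht : ∀ w, f (Alg.t w) = g (Alg.t w)) (hr : f Alg.r = g Alg.r)
    (hx : ∀ ω, f (Alg.x ω) = g (Alg.x ω)) : f = g := by
  refine AlgHom.ext fun a => ?_
  refine Alg.induction (p := fun a => f a = g a) ht hr hx (fun z => ?_) (fun a b ha hb => ?_)
    (fun a b ha hb => ?_) a
  · rw [AlgHom.commutes, AlgHom.commutes]
  · rw [map_add, map_add, ha, hb]
  · rw [map_mul, map_mul, ha, hb]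

lemma isStable_of_generators {ρ : Alg s α αv c →ₐ[ℂ] Module.End ℂ V} {N : Submodule ℂ V}
    (ht : ∀ w, ∀ v ∈ N, ρ (Alg.t w) v ∈ N) (hr : ∀ v ∈ N, ρ Alg.r v ∈ N)
    (hx : ∀ ω, ∀ v ∈ N, ρ (Alg.x ω) v ∈ N) : IsStable ρ N := by
  intro a
  refine Alg.induction (p := fun a => ∀ v ∈ N, ρ a v ∈ N) ht hr hx (fun z v hv => ?_)
    (fun a b ha hb v hv => ?_) (fun a b ha hb v hv => ?_) a
  · rw [AlgHom.commutes, Module.algebraMap_end_apply]; exact N.smul_mem _ hv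
  · rw [map_add]; exact N.add_mem (ha v hv) (hb v hv)
  · rw [map_mul]; exact ha _ (hb v hv)

lemma intertwines_of_generators {ρ : Alg s α αv c →ₐ[ℂ] Module.End ℂ V}
    {ρ' : Alg s α αv c →ₐ[ℂ] Module.End ℂ V'} {φ : V →ₗ[ℂ] V'}
    (ht : ∀ w v, φ (ρ (Alg.t w) v) = ρ' (Alg.t w) (φ v))
    (hr : ∀ v, φ (ρ Alg.r v) = ρ' Alg.r (φ v))
    (hx : ∀ ω v, φ (ρ (Alg.x ω) v) = ρ' (Alg.x ω) (φ v)) (a) (v : V) :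
    φ (ρ a v) = ρ' a (φ v) := by
  revert v
  refine Alg.induction (p := fun a => ∀ v, φ (ρ a v) = ρ' a (φ v)) ht hr hx (fun z v => ?_)
    (fun a b ha hb v => ?_) (fun a b ha hb v => ?_) a
  · rw [AlgHom.commutes, AlgHom.commutes, Module.algebraMap_end_apply,
      Module.algebraMap_end_apply, map_smul]
  · rw [map_add, map_add, LinearMap.add_apply, LinearMap.add_apply, map_add, ha, hb]
  · rw [map_mul, map_mul, Module.End.mul_apply, Module.End.mul_apply, ha, hb]

/-- The family of operators by which `E` acts on a module. -/
def opX (ρ : Alg s α αv c →ₐ[ℂ] Module.End ℂ V) : E →ₗ[ℂ] Module.End ℂ V where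
  toFun ω := ρ (Alg.x ω)
  map_add' ω ω' := by rw [Alg.x_add, map_add]
  map_smul' z ω := by rw [Alg.x_smul, map_smul]; rfl

lemma opX_apply (ρ : Alg s α αv c →ₐ[ℂ] Module.End ℂ V) (ω : E) :
    opX ρ ω = ρ (Alg.x ω) := rfl

lemma opX_commute (ρ : Alg s α αv c →ₐ[ℂ] Module.End ℂ V) (ω ω' : E) :
    Commute (opX ρ ω) (opX ρ ω') := by
  change ρ _ * ρ _ = ρ _ * ρ _
  rw [← map_mul, Alg.x_comm, map_mul]

lemma t_t_apply (ρ : Alg s α αv c →ₐ[ℂ] Module.End ℂ V) (w w' : W) (v : V) :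
    ρ (Alg.t w) (ρ (Alg.t w') v) = ρ (Alg.t (w * w')) v := by
  rw [← Alg.t_mul, map_mul]; rfl

lemma t_one_apply (ρ : Alg s α αv c →ₐ[ℂ] Module.End ℂ V) (v : V) :
    ρ (Alg.t 1) v = v := by
  rw [Alg.t_one, map_one]; rfl

lemma r_t_apply (ρ : Alg s α αv c →ₐ[ℂ] Module.End ℂ V) (w : W) (v : V) :
    ρ Alg.r (ρ (Alg.t w) v) = ρ (Alg.t w) (ρ Alg.r v) := by
  rw [← Module.End.mul_apply, ← map_mul, Alg.r_t, map_mul]; rfl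

lemma r_x_apply (ρ : Alg s α αv c →ₐ[ℂ] Module.End ℂ V) (ω : E) (v : V) :
    ρ Alg.r (ρ (Alg.x ω) v) = ρ (Alg.x ω) (ρ Alg.r v) := by
  rw [← Module.End.mul_apply, ← map_mul, Alg.r_x, map_mul]; rfl

lemma cross_apply (ρ : Alg s α αv c →ₐ[ℂ] Module.End ℂ V) (d : D) (ω : E) (v : V) :
    ρ (Alg.x ω) (ρ (Alg.t (s d)) v) =
      ρ (Alg.t (s d)) (ρ (Alg.x (ω - αv d ω • α d)) v) + (c d * αv d ω) • ρ Alg.r v := by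
  rw [← Module.End.mul_apply, ← map_mul, Alg.cross, map_add, map_mul, map_smul]; rfl

/-- The subspace spanned by the translates of `Q` under the elements `t_w`. -/
def tSpan (ρ : Alg s α αv c →ₐ[ℂ] Module.End ℂ V) (Q : Submodule ℂ V) : Submodule ℂ V :=
  ⨆ w : W, Q.map (ρ (Alg.t w))

lemma t_mem_tSpan {ρ : Alg s α αv c →ₐ[ℂ] Module.End ℂ V} {Q : Submodule ℂ V} (w : W) {v : V}
    (hv : v ∈ Q) : ρ (Alg.t w) v ∈ tSpan ρ Q :=
  Submodule.mem_iSup_of_mem (p := fun w : W => Q.map (ρ (Alg.t w))) w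
    (Submodule.mem_map_of_mem hv)

lemma le_tSpan {ρ : Alg s α αv c →ₐ[ℂ] Module.End ℂ V} {Q : Submodule ℂ V} : Q ≤ tSpan ρ Q :=
  fun v hv => by simpa [t_one_apply] using t_mem_tSpan (ρ := ρ) 1 hv

lemma tSpan_le {ρ : Alg s α αv c →ₐ[ℂ] Module.End ℂ V} {Q N : Submodule ℂ V}
    (h : ∀ w, ∀ v ∈ Q, ρ (Alg.t w) v ∈ N) : tSpan ρ Q ≤ N :=
  iSup_le fun w => Submodule.map_le_iff_le_comap.2 (h w)

/-- The subspace spanned by the `t_w`-translates of a subspace that is stable under the elements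
`ω` and `r` is a submodule. -/
lemma isStable_tSpan (hs2 : ∀ d, s d * s d = 1) (hs : Subgroup.closure (Set.range s) = ⊤)
    {ρ : Alg s α αv c →ₐ[ℂ] Module.End ℂ V} {Q : Submodule ℂ V}
    (hr : ∀ v ∈ Q, ρ Alg.r v ∈ Q) (hx : ∀ ω, ∀ v ∈ Q, ρ (Alg.x ω) v ∈ Q) :
    IsStable ρ (tSpan ρ Q) := by
  have ht : ∀ w, ∀ v ∈ tSpan ρ Q, ρ (Alg.t w) v ∈ tSpan ρ Q := by
    intro w
    refine tSpan_le (N := (tSpan ρ Q).comap (ρ (Alg.t w))) fun w' v hv => ?_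
    rw [Submodule.mem_comap, t_t_apply]
    exact t_mem_tSpan _ hv
  have hr' : ∀ v ∈ tSpan ρ Q, ρ Alg.r v ∈ tSpan ρ Q := by
    refine tSpan_le (N := (tSpan ρ Q).comap (ρ Alg.r)) fun w' v hv => ?_
    rw [Submodule.mem_comap, r_t_apply]
    exact t_mem_tSpan _ (hr v hv)
  refine isStable_of_generators ht hr' fun ω => ?_
  refine tSpan_le (N := (tSpan ρ Q).comap (ρ (Alg.x ω))) fun w v hv => ?_
  rw [Submodule.mem_comap]
  revert ω
  refine induction_of_closure hs2 hs (p := fun w => ∀ ω, ρ (Alg.x ω) (ρ (Alg.t w) v) ∈ tSpan ρ Q)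
    (fun ω => ?_) (fun d w ih ω => ?_) w
  · rw [t_one_apply]; exact le_tSpan (hx ω v hv)
  · rw [← t_t_apply, cross_apply]
    exact Submodule.add_mem _ (ht _ _ (ih _))
      (Submodule.smul_mem _ _ (hr' _ (t_mem_tSpan w hv)))

end AlgLemmas

section RootDatumLemmas

variable {ι X Y : Type*} [AddCommGroup X] [AddCommGroup Y]
variable {P : RootPairing ι ℤ X Y} {Δ : Set ι} {c : ι → ℕ}

lemma simpleRefl_mul_self (d : Δ) : simpleRefl P Δ d * simpleRefl P Δ d = 1 :=
  Subtype.ext (reflection_mul_self _)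

lemma closure_range_simpleRefl : Subgroup.closure (Set.range (simpleRefl P Δ)) = ⊤ := by
  have h := Subgroup.closure_closure_coe_preimage (k := 𝓈 P '' Δ)
  refine Eq.trans ?_ h
  congr 1
  ext g
  constructor
  · rintro ⟨d, rfl⟩
    exact ⟨d, d.2, rfl⟩
  · rintro ⟨d, hd, hg⟩
    exact ⟨⟨d, hd⟩, Subtype.ext hg⟩

lemma weyl_induction {p : weyl P Δ → Prop} (h1 : p 1)
    (hmul : ∀ d w, p w → p (simpleRefl P Δ d * w)) (w : weyl P Δ) : p w :=
  induction_of_closure simpleRefl_mul_self closure_range_simpleRefl h1 hmul w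

/-- The value of `ω` on the coroot with index `i`. -/
def cor (P : RootPairing ι ℤ X Y) (i : ι) : CartanDual X →ₗ[ℂ] ℂ := (pair P).flip (corootC P i)

lemma cor_apply (i : ι) (ω : CartanDual X) : cor P i ω = pair P ω (corootC P i) := rfl

lemma cor_smul_act (g : P.Aut) (i : ι) (ω : CartanDual X) :
    cor P (g • i) (act P g ω) = cor P i ω := pair_act P g ω i

lemma act_mul (g g' : P.Aut) (ω : CartanDual X) : act P (g * g') ω = act P g (act P g' ω) := by
  induction ω using TensorProduct.induction_on with
  | zero => simp
  | tmul z u => simp only [act_tmul, mul_smul]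
  | add a b ha hb => simp only [map_add, ha, hb]

lemma act_one (ω : CartanDual X) : act P (1 : P.Aut) ω = ω := by
  induction ω using TensorProduct.induction_on with
  | zero => simp
  | tmul z u => simp only [act_tmul, one_smul]
  | add a b ha hb => simp only [map_add, ha, hb]

lemma act_inv_act (g : P.Aut) (ω : CartanDual X) : act P g⁻¹ (act P g ω) = ω := by
  rw [← act_mul, inv_mul_cancel, act_one]

lemma act_act_inv (g : P.Aut) (ω : CartanDual X) : act P g (act P g⁻¹ ω) = ω := by
  rw [← act_mul, mul_inv_cancel, act_one]

lemma cor_smul (g : P.Aut) (i : ι) (ω : CartanDual X) :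
    cor P (g • i) ω = cor P i (act P g⁻¹ ω) := by
  rw [← cor_smul_act g i (act P g⁻¹ ω), act_act_inv]

lemma cor_opp (i : ι) (ω : CartanDual X) : cor P (opp P i) ω = -cor P i ω := by
  simp [cor, corootC, TensorProduct.tmul_neg]

lemma act_reflection (i : ι) (ω : CartanDual X) :
    act P (𝓈 P i) ω = ω - cor P i ω • rootC P i := by
  induction ω using TensorProduct.induction_on with
  | zero => simp
  | tmul z u =>
    rw [act_tmul, reflection_smul_weight, cor_apply, corootC, pair_tmul, rootC,
      TensorProduct.smul_tmul', TensorProduct.tmul_sub]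
    congr 1
    rw [TensorProduct.tmul_smul, ← TensorProduct.smul_tmul', ← Int.cast_smul_eq_zsmul ℂ,
      TensorProduct.smul_tmul']
    congr 1
    simp only [smul_eq_mul]; ring
  | add a b ha hb => rw [map_add, map_add, ha, hb]; module

lemma cor_self_root (i : ι) : cor P i (rootC P i) = 2 := by
  simp [cor, corootC, rootC]

lemma act_reflection_act_reflection (i : ι) (ω : CartanDual X) :
    act P (𝓈 P i) (act P (𝓈 P i) ω) = ω := by
  rw [← act_mul, reflection_mul_self, act_one]

variable {V : Type*} [AddCommGroup V] [Module ℂ V]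

lemma hecke_cross_apply (ρ : HeckeAlg P Δ c →ₐ[ℂ] Module.End ℂ V) (d : Δ) (ω : CartanDual X)
    (v : V) : ρ (Alg.x ω) (ρ (Alg.t (simpleRefl P Δ d)) v) =
      ρ (Alg.t (simpleRefl P Δ d)) (ρ (Alg.x (act P (𝓈 P d) ω)) v) +
        (c d * cor P d ω) • ρ Alg.r v := by
  rw [cross_apply, act_reflection]; rfl

/-! ### Signs of roots -/

variable (b : P.Base)

open Classical in
/-- The sign of a root. -/
def sgn (i : ι) : ℂ := if b.IsPos i then 1 else -1

lemma sgn_of_pos {i : ι} (h : b.IsPos i) : sgn b i = 1 := if_pos h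

lemma sgn_of_not_pos {i : ι} (h : ¬ b.IsPos i) : sgn b i = -1 := if_neg h

lemma sgn_opp (i : ι) : sgn b (opp P i) = -sgn b i := by
  by_cases h : b.IsPos i
  · rw [sgn_of_pos b h, sgn_of_not_pos b (by rwa [isPos_opp, not_not])]
  · rw [sgn_of_not_pos b h, sgn_of_pos b ((isPos_opp b i).2 h), neg_neg]

lemma sgn_congr {i j : ι} (h : b.IsPos i ↔ b.IsPos j) : sgn b i = sgn b j := by
  by_cases hi : b.IsPos i
  · rw [sgn_of_pos b hi, sgn_of_pos b (h.1 hi)]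
  · rw [sgn_of_not_pos b hi, sgn_of_not_pos b (fun hj => hi (h.2 hj))]

lemma ne_opp (i : ι) : i ≠ opp P i := by
  intro h
  have := Module.IsReflexive.of_isPerfPair P.toLinearMap
  have h1 := congrArg P.root h
  rw [root_opp, eq_neg_iff_add_eq_zero, ← two_nsmul] at h1
  have : IsAddTorsionFree X := .of_isTorsionFree ℤ X
  exact P.ne_zero i ((smul_eq_zero_iff_right (by norm_num)).1 h1)

variable [Fintype ι]

/-- A sum over the roots in which only the terms of `± d` survive. -/
lemma sum_sub_smul_eq {M : Type*} [AddCommGroup M] [Module ℂ M] (ε ε' : ι → ℂ) (d : ι)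
    (h1 : ∀ i, i ≠ d → i ≠ opp P d → ε i = ε' i) (hd : ε d - ε' d = 2)
    (hd' : ε (opp P d) - ε' (opp P d) = -2) {F : ι → M} (hF : F (opp P d) = -F d) :
    ∑ i, (ε i - ε' i) • F i = (4 : ℂ) • F d := by
  classical
  rw [← Finset.sum_subset (Finset.subset_univ {d, opp P d}) (fun i _ hi => ?_)]
  · rw [Finset.sum_pair (ne_opp d), hd, hd', hF]
    module
  · simp only [Finset.mem_insert, Finset.mem_singleton, not_or] at hi
    rw [h1 i hi.1 hi.2, sub_self, zero_smul]

lemma sgn_reflection {d i : ι} (hd : d ∈ b.support) (h : i ≠ d) (h' : i ≠ opp P d) :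
    sgn b i = sgn b (𝓈 P d • i) := by
  apply sgn_congr
  refine ⟨fun hi => isPos_simple_smul b hd hi h, fun hi => ?_⟩
  by_contra hcon
  rw [← isPos_opp] at hcon
  have := isPos_simple_smul b hd hcon (fun e => h' (by rw [← e, opp_opp]))
  rw [smul_opp, isPos_opp] at this
  exact this hi

lemma sum_sgn_sub {M : Type*} [AddCommGroup M] [Module ℂ M] {d : ι} (hd : d ∈ b.support)
    {F : ι → M} (hF : F (opp P d) = -F d) :
    ∑ i, (sgn b i - sgn b (𝓈 P d • i)) • F i = (4 : ℂ) • F d := by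
  have h1 := sgn_of_pos b (RootPairing.Base.isPos_of_mem_support hd)
  refine sum_sub_smul_eq _ _ d (fun i => sgn_reflection b hd) ?_ ?_ hF
  · rw [reflection_smul_self, sgn_opp, h1]; norm_num
  · rw [smul_opp, reflection_smul_self, opp_opp, sgn_opp, h1]; norm_num

/-- The reflection in an arbitrary root, as an element of the Weyl group of the base. -/
def reflW (i : ι) : weyl P (b.support : Set ι) := ⟨𝓈 P i, reflection_mem_weyl_support b i⟩

lemma coe_reflW (i : ι) : (reflW b i : P.Aut) = 𝓈 P i := rfl

lemma reflW_opp (i : ι) : reflW b (opp P i) = reflW b i := Subtype.ext (opp_eq_reflection_iff i)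

lemma reflW_smul (g : weyl P (b.support : Set ι)) (i : ι) :
    reflW b ((g : P.Aut) • i) = g * reflW b i * g⁻¹ := Subtype.ext (reflection_smul_eq P _ i)

lemma reflW_smul_mul (g : weyl P (b.support : Set ι)) (i : ι) :
    reflW b ((g : P.Aut) • i) * g = g * reflW b i := by
  rw [reflW_smul, inv_mul_cancel_right]

lemma reflW_mul_self (i : ι) : reflW b i * reflW b i = 1 := Subtype.ext (reflection_mul_self i)

lemma simpleRefl_eq_reflW (d : (b.support : Set ι)) : simpleRefl P _ d = reflW b d := rfl

variable {b}

lemma param_opp (hc : ∀ w ∈ weyl P (b.support : Set ι), ∀ i, c (w • i) = c i) (i : ι) :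
    c (opp P i) = c i :=
  hc _ (reflection_mem_weyl_support b i) i

/-- The commutation relation between `ω` and `t_g` for arbitrary `g`. The sum has a nonzero term
for the roots `i` that change sign under `g⁻¹`. -/
lemma x_t_apply (hc : ∀ w ∈ weyl P (b.support : Set ι), ∀ i, c (w • i) = c i)
    (ρ : HeckeAlg P (b.support : Set ι) c →ₐ[ℂ] Module.End ℂ V)
    (g : weyl P (b.support : Set ι)) (ω : CartanDual X) (v : V) :
    ρ (Alg.x ω) (ρ (Alg.t g) v) = ρ (Alg.t g) (ρ (Alg.x (act P (g : P.Aut)⁻¹ ω)) v) +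
      ∑ i, ((sgn b i - sgn b ((g : P.Aut)⁻¹ • i)) * (4⁻¹ * (c i * cor P i ω))) •
        ρ (Alg.t (reflW b i * g)) (ρ Alg.r v) := by
  refine weyl_induction (p := fun g => ∀ ω, ρ (Alg.x ω) (ρ (Alg.t g) v) =
    ρ (Alg.t g) (ρ (Alg.x (act P (g : P.Aut)⁻¹ ω)) v) +
      ∑ i, ((sgn b i - sgn b ((g : P.Aut)⁻¹ • i)) * (4⁻¹ * (c i * cor P i ω))) •
        ρ (Alg.t (reflW b i * g)) (ρ Alg.r v)) (fun ω => ?_) (fun d g ih ω => ?_) g ω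
  · simp [t_one_apply, act_one]
  · rw [← t_t_apply, hecke_cross_apply, ih, map_add, t_t_apply, r_t_apply, add_assoc]
    congr 1
    · rw [← act_mul, Subgroup.coe_mul, mul_inv_rev]
      have e : (simpleRefl P (b.support : Set ι) d : P.Aut)⁻¹ = 𝓈 P (d : ι) :=
        RootPairing.Equiv.reflection_inv P (d : ι)
      rw [e]
    · -- after the substitution `i ↦ s_d i` only the terms for `± d` are not accounted for
      have h1 : (4 : ℂ) • ((4⁻¹ * (c d * cor P d ω)) •
            ρ (Alg.t (reflW b d * (reflW b d * g))) (ρ Alg.r v)) =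
          ((c d : ℂ) * cor P d ω) • ρ (Alg.t g) (ρ Alg.r v) := by
        have e : reflW b d * (reflW b d * g) = g := by rw [← mul_assoc, reflW_mul_self, one_mul]
        rw [e]
        module
      rw [← h1, ← sum_sgn_sub b d.2 (F := fun i => (4⁻¹ * (c i * cor P i ω)) •
        ρ (Alg.t (reflW b i * (reflW b d * g))) (ρ Alg.r v))]
      · rw [map_sum, ← Equiv.sum_comp (RootPairing.Equiv.indexHom P (𝓈 P (d : ι)))]
        rw [← Finset.sum_add_distrib]
        refine Finset.sum_congr rfl fun i _ => ?_
        change ρ _ (((sgn b (𝓈 P (d : ι) • i) - sgn b (_ • 𝓈 P (d : ι) • i)) *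
          (4⁻¹ * (c (𝓈 P (d : ι) • i) * cor P (𝓈 P (d : ι) • i) _))) •
            ρ (Alg.t (reflW b (𝓈 P (d : ι) • i) * g)) _) + _ = _
        rw [map_smul, t_t_apply, cor_smul_act, hc _ (reflection_mem_weyl_support b _),
          simpleRefl_eq_reflW]
        have h2 : reflW b d * (reflW b (𝓈 P (d : ι) • i) * g) = reflW b i * (reflW b d * g) := by
          have := reflW_smul_mul b (reflW b d) i
          rw [coe_reflW] at this
          rw [← mul_assoc, ← mul_assoc]
          congr 1
          have h3 := reflW_smul b (reflW b d) i
          rw [coe_reflW] at h3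
          rw [h3, mul_assoc (reflW b ↑d), ← mul_assoc, reflW_mul_self, one_mul,
            inv_eq_of_mul_eq_one_left (reflW_mul_self b _)]
        have h3 : ((reflW b d * g : weyl P (b.support : Set ι)) : P.Aut)⁻¹ • i =
            (g : P.Aut)⁻¹ • 𝓈 P (d : ι) • i := by
          rw [Subgroup.coe_mul, mul_inv_rev, mul_smul, coe_reflW,
            RootPairing.Equiv.reflection_inv]
        rw [h2, h3]
        module
      · rw [reflW_opp, param_opp hc, cor_opp, ← neg_smul]
        congr 1; ring

end RootDatumLemmas

/-! ### A function model of induced modules -/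

section FunctionModel

variable {ι X Y : Type*} [AddCommGroup X] [AddCommGroup Y]
variable {P : RootPairing ι ℤ X Y} (b : P.Base) {Δ : Set ι} {c : ι → ℕ}
variable {U : Type*} [AddCommGroup U] [Module ℂ U]

open Classical in
/-- The sign that enters the action of `𝔥^*` on functions with values in an `ℍ_Δ`-module: minus
the sign of `i` for the roots of the subsystem, and the sign of `w i` for the other roots. -/
def relSgn (Δ : Set ι) (w : P.Aut) (i : ι) : ℂ :=
  if i ∈ generatedRoots P Δ then -sgn b i else sgn b (w • i)

variable [Fintype ι]

/-- The Weyl group of a subsystem is contained in that of the base. -/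
lemma weyl_le (Δ : Set ι) : weyl P Δ ≤ weyl P (b.support : Set ι) := by
  refine (Subgroup.closure_le _).2 ?_
  rintro _ ⟨d, -, rfl⟩
  exact reflection_mem_weyl_support b d

/-- The inclusion of the Weyl group of a subsystem. -/
def emb (Δ : Set ι) : weyl P Δ →* weyl P (b.support : Set ι) := Subgroup.inclusion (weyl_le b Δ)

lemma coe_emb (h : weyl P Δ) : (emb b Δ h : P.Aut) = h := rfl

lemma emb_simpleRefl (d : Δ) : emb b Δ (simpleRefl P Δ d) = reflW b (d : ι) := rfl

/-- Translation of functions on the Weyl group. -/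
def fnT (U : Type*) [AddCommGroup U] [Module ℂ U] (u : weyl P (b.support : Set ι)) :
    Module.End ℂ (weyl P (b.support : Set ι) → U) :=
  LinearMap.funLeft ℂ U fun g => u⁻¹ * g

omit [Fintype ι] in
lemma fnT_apply (u : weyl P (b.support : Set ι)) (f : weyl P (b.support : Set ι) → U) (g) :
    fnT b U u f g = f (u⁻¹ * g) := rfl

variable (ρ : HeckeAlg P Δ c →ₐ[ℂ] Module.End ℂ U) (w : P.Aut)

/-- The pointwise action of `r` on functions. -/
def fnR : Module.End ℂ (weyl P (b.support : Set ι) → U) :=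
  LinearMap.compLeft (ρ Alg.r) _

omit [Fintype ι] in
lemma fnR_apply (f : weyl P (b.support : Set ι) → U) (g) : fnR b ρ f g = ρ Alg.r (f g) := rfl

/-- The action of `ω` on functions on the Weyl group:
`(ω f)(g) = (g⁻¹ ω) f(g) + r ∑ᵢ ¼ c_i ⟨ω, α_i^∨⟩ (sgn i + relSgn (g⁻¹ i)) f(s_i g)`,
the sum being over all roots. The first sign produces the commutation relation with the left
translations (`fnX_fnT`), the second preserves the equivariance of functions (`fnX_mem`), and
together they make the inducing module appear at the coset of `w` (`fnX_fnDelta`). -/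
def fnX (ω : CartanDual X) : Module.End ℂ (weyl P (b.support : Set ι) → U) where
  toFun f g := ρ (Alg.x (act P (g : P.Aut)⁻¹ ω)) (f g) +
    ∑ i, ((sgn b i + relSgn b Δ w ((g : P.Aut)⁻¹ • i)) * (4⁻¹ * (c i * cor P i ω))) •
      ρ Alg.r (f (reflW b i * g))
  map_add' f f' := by
    ext g
    simp only [Pi.add_apply, map_add, smul_add, Finset.sum_add_distrib]
    abel
  map_smul' z f := by
    ext g
    simp only [Pi.smul_apply, map_smul, smul_add, Finset.smul_sum, RingHom.id_apply]
    congr 1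
    exact Finset.sum_congr rfl fun i _ => smul_comm _ _ _

lemma fnX_apply (ω : CartanDual X) (f : weyl P (b.support : Set ι) → U) (g) :
    fnX b ρ w ω f g = ρ (Alg.x (act P (g : P.Aut)⁻¹ ω)) (f g) +
      ∑ i, ((sgn b i + relSgn b Δ w ((g : P.Aut)⁻¹ • i)) * (4⁻¹ * (c i * cor P i ω))) •
        ρ Alg.r (f (reflW b i * g)) := rfl

lemma fnX_add (ω ω' : CartanDual X) : fnX b ρ w (ω + ω') = fnX b ρ w ω + fnX b ρ w ω' := by
  ext f g
  simp only [fnX_apply, LinearMap.add_apply, Pi.add_apply, map_add, Alg.x_add, mul_add, add_smul,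
    Finset.sum_add_distrib]
  abel

lemma fnX_smul (z : ℂ) (ω : CartanDual X) : fnX b ρ w (z • ω) = z • fnX b ρ w ω := by
  ext f g
  simp only [fnX_apply, LinearMap.smul_apply, Pi.smul_apply, map_smul, Alg.x_smul, smul_add,
    Finset.smul_sum]
  congr 1
  refine Finset.sum_congr rfl fun i _ => ?_
  rw [smul_smul, smul_eq_mul]
  congr 1
  ring

omit [Fintype ι] in
lemma fnT_one : fnT b U 1 = 1 := by
  ext f g
  simp [fnT_apply]

omit [Fintype ι] in
lemma fnT_mul (u u' : weyl P (b.support : Set ι)) : fnT b U u * fnT b U u' = fnT b U (u * u') := by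
  ext f g
  simp [fnT_apply, mul_assoc]

omit [Fintype ι] in
lemma fnR_fnT (u : weyl P (b.support : Set ι)) : fnR b ρ * fnT b U u = fnT b U u * fnR b ρ := rfl

lemma fnR_fnX (ω : CartanDual X) : fnR b ρ * fnX b ρ w ω = fnX b ρ w ω * fnR b ρ := by
  ext f g
  simp only [Module.End.mul_apply, fnR_apply, fnX_apply, map_add, map_sum, map_smul, r_x_apply]

variable {b} in
/-- The commutation relation of the graded Hecke algebra for the action on functions. -/
lemma fnX_fnT (hc : ∀ w ∈ weyl P (b.support : Set ι), ∀ i, c (w • i) = c i)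
    (d : (b.support : Set ι)) (ω : CartanDual X) :
    fnX b ρ w ω * fnT b U (reflW b d) =
      fnT b U (reflW b d) * fnX b ρ w (act P (𝓈 P (d : ι)) ω) +
        (c d * cor P d ω) • fnR b ρ := by
  have hinv : (reflW b (d : ι))⁻¹ = reflW b d := inv_eq_of_mul_eq_one_left (reflW_mul_self b _)
  have hinv' : (𝓈 P (d : ι))⁻¹ = 𝓈 P (d : ι) := RootPairing.Equiv.reflection_inv P (d : ι)
  refine LinearMap.ext fun f => funext fun g => ?_
  simp only [Module.End.mul_apply, LinearMap.add_apply, LinearMap.smul_apply, Pi.add_apply,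
    Pi.smul_apply, fnX_apply, fnT_apply, fnR_apply, hinv]
  rw [Subgroup.coe_mul, coe_reflW, mul_inv_rev, hinv', act_mul, act_reflection_act_reflection,
    add_assoc]
  congr 1
  have h1 : (4 : ℂ) • ((4⁻¹ * (c d * cor P d ω)) •
        ρ Alg.r (f (reflW b d * (reflW b d * g)))) =
      ((c d : ℂ) * cor P d ω) • ρ Alg.r (f g) := by
    have e : reflW b d * (reflW b d * g) = g := by rw [← mul_assoc, reflW_mul_self, one_mul]
    rw [e]
    module
  -- Only the roots `± d` change their sign under `s_d`, and they account for the additional term in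
  -- the relation.
  rw [← h1, ← sum_sgn_sub b d.2 (F := fun i => (4⁻¹ * (c i * cor P i ω)) •
    ρ Alg.r (f (reflW b d * (reflW b i * g))))]
  · rw [← Equiv.sum_comp (RootPairing.Equiv.indexHom P (𝓈 P (d : ι)))
      (fun i => (_ * (4⁻¹ * (c i * cor P i (act P (𝓈 P (d : ι)) ω)))) •
        ρ Alg.r (f (reflW b i * (reflW b d * g)))), ← Finset.sum_add_distrib]
    refine Finset.sum_congr rfl fun i _ => ?_
    change _ = ((sgn b (𝓈 P (d : ι) • i) + relSgn b Δ w (_ • 𝓈 P (d : ι) • i)) *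
      (4⁻¹ * (c (𝓈 P (d : ι) • i) * cor P (𝓈 P (d : ι) • i) _))) •
        ρ Alg.r (f (reflW b (𝓈 P (d : ι) • i) * (reflW b d * g))) + _
    rw [cor_smul_act, hc _ (reflection_mem_weyl_support b _), mul_smul (g : P.Aut)⁻¹,
      ← mul_smul (𝓈 P (d : ι)), reflection_mul_self, one_smul]
    have h2 : reflW b (𝓈 P (d : ι) • i) * (reflW b d * g) = reflW b d * (reflW b i * g) := by
      rw [← mul_assoc, ← mul_assoc]
      congr 1
      exact reflW_smul_mul b (reflW b d) i
    rw [h2]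
    module
  · rw [reflW_opp, param_opp hc, cor_opp, ← neg_smul]
    congr 1; ring

/-- The functions `f` with `f(g h) = h⁻¹ f(g)` for `h` in the Weyl group of the subsystem. -/
def fnSpace : Submodule ℂ (weyl P (b.support : Set ι) → U) where
  carrier := {f | ∀ g, ∀ h : weyl P Δ, f (g * emb b Δ h) = ρ (Alg.t h⁻¹) (f g)}
  add_mem' {f f'} hf hf' g h := by rw [Pi.add_apply, hf, hf', Pi.add_apply, map_add]
  zero_mem' g h := by simp
  smul_mem' z f hf g h := by rw [Pi.smul_apply, hf, Pi.smul_apply, map_smul]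

variable {b ρ}

lemma mem_fnSpace_iff {f : weyl P (b.support : Set ι) → U} : f ∈ fnSpace b ρ ↔
    ∀ g, ∀ h : weyl P Δ, f (g * emb b Δ h) = ρ (Alg.t h⁻¹) (f g) := Iff.rfl

lemma mem_fnSpace_of_simple {f : weyl P (b.support : Set ι) → U}
    (hf : ∀ g, ∀ d : Δ, f (g * reflW b (d : ι)) = ρ (Alg.t (simpleRefl P Δ d)) (f g)) :
    f ∈ fnSpace b ρ := by
  rw [mem_fnSpace_iff]
  intro g h
  refine weyl_induction (p := fun h => ∀ g, f (g * emb b Δ h) = ρ (Alg.t h⁻¹) (f g))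
    (fun g => ?_) (fun d h ih g => ?_) h g
  · simp [t_one_apply]
  · rw [map_mul, ← mul_assoc, ih, emb_simpleRefl, hf, t_t_apply, mul_inv_rev,
      inv_eq_of_mul_eq_one_left (simpleRefl_mul_self d)]

lemma fnSpace_simple {f : weyl P (b.support : Set ι) → U} (hf : f ∈ fnSpace b ρ) (g) (d : Δ) :
    f (g * reflW b (d : ι)) = ρ (Alg.t (simpleRefl P Δ d)) (f g) := by
  rw [← emb_simpleRefl, mem_fnSpace_iff.1 hf, inv_eq_of_mul_eq_one_left (simpleRefl_mul_self d)]

lemma fnT_mem (u) {f : weyl P (b.support : Set ι) → U} (hf : f ∈ fnSpace b ρ) :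
    fnT b U u f ∈ fnSpace b ρ := by
  intro g h
  rw [fnT_apply, fnT_apply, ← mul_assoc, mem_fnSpace_iff.1 hf]

lemma fnR_mem {f : weyl P (b.support : Set ι) → U} (hf : f ∈ fnSpace b ρ) :
    fnR b ρ f ∈ fnSpace b ρ := by
  intro g h
  rw [fnR_apply, fnR_apply, mem_fnSpace_iff.1 hf, r_t_apply]

variable {w}

omit [Fintype ι] in
lemma relSgn_opp (i : ι) : relSgn b Δ w (opp P i) = -relSgn b Δ w i := by
  rw [relSgn, relSgn, opp_mem_generatedRoots_iff, smul_opp, sgn_opp, sgn_opp]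
  split_ifs <;> rfl

omit [Fintype ι] in
lemma relSgn_simple (hw : IsStandardizing b Δ w) {d : ι} (hd : d ∈ Δ) : relSgn b Δ w d = -1 := by
  rw [relSgn, if_pos (subset_generatedRoots hd), sgn_of_pos]
  rw [hw.pos d (subset_generatedRoots hd)]
  exact RootPairing.Base.isPos_of_mem_support (hw.mem d hd)

/-- A reflection in `Δ` changes `relSgn` only at `± d`. -/
lemma relSgn_reflection (hw : IsStandardizing b Δ w) {d i : ι} (hd : d ∈ Δ) (h : i ≠ d)
    (h' : i ≠ opp P d) : relSgn b Δ w (𝓈 P d • i) = relSgn b Δ w i := by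
  have hdW : 𝓈 P d ∈ weyl P Δ := Subgroup.subset_closure ⟨d, hd, rfl⟩
  have h1 : sgn b (w • 𝓈 P d • i) = sgn b (w • i) := by
    rw [smul_reflection_smul]
    refine (sgn_reflection b (hw.mem d hd) (fun e => h (smul_left_cancel _ e)) fun e => h' ?_).symm
    rw [← smul_opp] at e
    exact smul_left_cancel _ e
  rw [relSgn, relSgn, smul_mem_generatedRoots hdW, h1]
  split_ifs with hi
  · rw [sgn_congr b (hw.pos i hi), ← h1,
      sgn_congr b (hw.pos _ ((smul_mem_generatedRoots hdW).2 hi))]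
  · rfl

/-- The action of `ω` preserves equivariant functions. -/
lemma fnX_mem (hc : ∀ w ∈ weyl P (b.support : Set ι), ∀ i, c (w • i) = c i)
    (hw : IsStandardizing b Δ w) (ω : CartanDual X) {f : weyl P (b.support : Set ι) → U}
    (hf : f ∈ fnSpace b ρ) : fnX b ρ w ω f ∈ fnSpace b ρ := by
  refine mem_fnSpace_of_simple fun g d => ?_
  set η := act P (g : P.Aut)⁻¹ ω with hη
  have hinv : (𝓈 P (d : ι))⁻¹ = 𝓈 P (d : ι) := RootPairing.Equiv.reflection_inv P (d : ι)
  have hη' : act P ((g * reflW b (d : ι) : weyl P (b.support : Set ι)) : P.Aut)⁻¹ ω =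
      act P (𝓈 P (d : ι)) η := by
    rw [Subgroup.coe_mul, mul_inv_rev, act_mul, coe_reflW, hinv]
  have hi : ∀ i : ι, ((g * reflW b (d : ι) : weyl P (b.support : Set ι)) : P.Aut)⁻¹ • i =
      𝓈 P (d : ι) • (g : P.Aut)⁻¹ • i := fun i => by
    rw [Subgroup.coe_mul, mul_inv_rev, mul_smul, coe_reflW, hinv]
  rw [fnX_apply, fnX_apply, hη', fnSpace_simple hf, hecke_cross_apply, ← hη,
    act_reflection_act_reflection, map_add, add_assoc]
  congr 1
  have h1 : cor P d (act P (𝓈 P (d : ι)) η) = - cor P d η := by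
    rw [act_reflection, map_sub, map_smul, cor_self_root, smul_eq_mul]; ring
  have h2 : cor P d η = cor P ((g : P.Aut) • (d : ι)) ω := (cor_smul _ _ _).symm
  -- Only the roots `± g d` contribute to the difference of the two sums, which cancels the term
  -- with `r` in the commutation relation of the module of values.
  have key := sum_sub_smul_eq (P := P) (fun i => relSgn b Δ w (𝓈 P (d : ι) • (g : P.Aut)⁻¹ • i))
    (fun i => relSgn b Δ w ((g : P.Aut)⁻¹ • i)) ((g : P.Aut) • (d : ι))
    (fun i h h' => relSgn_reflection hw d.2
      (fun e => h (by rw [← e, smul_inv_smul]))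
      (fun e => h' (by rw [← smul_opp, ← e, smul_inv_smul])))
    (by rw [inv_smul_smul, reflection_smul_self, relSgn_opp, relSgn_simple hw d.2]; norm_num)
    (by rw [← smul_opp, inv_smul_smul, smul_opp, reflection_smul_self, opp_opp, relSgn_opp,
      relSgn_simple hw d.2]; norm_num)
    (F := fun i => (4⁻¹ * (c i * cor P i ω)) • ρ Alg.r (f (reflW b i * (g * reflW b (d : ι)))))
    (by rw [reflW_opp, param_opp hc, cor_opp, ← neg_smul]; congr 1; ring)
  simp only [hi]
  rw [h1, h2, map_sum]
  have h3 : reflW b ((g : P.Aut) • (d : ι)) * (g * reflW b (d : ι)) = g := by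
    rw [← mul_assoc, reflW_smul_mul, mul_assoc, reflW_mul_self, mul_one]
  rw [h3, hc _ g.2] at key
  have h4 : ((c (d : ι) : ℂ) * -cor P ((g : P.Aut) • (d : ι)) ω) • ρ Alg.r (f g) =
      - ∑ i, (relSgn b Δ w (𝓈 P (d : ι) • (g : P.Aut)⁻¹ • i) - relSgn b Δ w ((g : P.Aut)⁻¹ • i)) •
        (4⁻¹ * (c i * cor P i ω)) • ρ Alg.r (f (reflW b i * (g * reflW b (d : ι)))) := by
    rw [key]
    module
  rw [h4, neg_add_eq_sub, ← Finset.sum_sub_distrib]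
  refine Finset.sum_congr rfl fun i _ => ?_
  rw [map_smul, ← r_t_apply, ← fnSpace_simple hf, mul_assoc]
  module

open Classical in
variable (b ρ w) in
/-- The function with value `u` at `w`, supported on the coset of `w`. -/
def fnDelta (u : U) (g : weyl P (b.support : Set ι)) : U :=
  if h : w⁻¹ * (g : P.Aut) ∈ weyl P Δ then ρ (Alg.t ⟨w⁻¹ * g, h⟩⁻¹) u else 0

omit [Fintype ι] in
lemma fnDelta_of_not_mem {u : U} {g : weyl P (b.support : Set ι)}
    (h : w⁻¹ * (g : P.Aut) ∉ weyl P Δ) : fnDelta b ρ w u g = 0 := dif_neg h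

omit [Fintype ι] in
lemma fnDelta_of_mem {u : U} {g : weyl P (b.support : Set ι)}
    (h : w⁻¹ * (g : P.Aut) ∈ weyl P Δ) : fnDelta b ρ w u g = ρ (Alg.t ⟨w⁻¹ * g, h⟩⁻¹) u :=
  dif_pos h

omit [Fintype ι] in
lemma fnDelta_self {hw : w ∈ weyl P (b.support : Set ι)} (u : U) :
    fnDelta b ρ w u ⟨w, hw⟩ = u := by
  have h : w⁻¹ * ((⟨w, hw⟩ : weyl P (b.support : Set ι)) : P.Aut) ∈ weyl P Δ := by
    rw [inv_mul_cancel]; exact one_mem _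
  have e : (⟨w⁻¹ * ((⟨w, hw⟩ : weyl P (b.support : Set ι)) : P.Aut), h⟩ : weyl P Δ) = 1 :=
    Subtype.ext (inv_mul_cancel w)
  rw [fnDelta_of_mem h, e, inv_one, t_one_apply]

lemma fnDelta_mem (u : U) : fnDelta b ρ w u ∈ fnSpace b ρ := by
  intro g h
  have e : w⁻¹ * ((g * emb b Δ h : weyl P (b.support : Set ι)) : P.Aut) = w⁻¹ * g * h := by
    rw [Subgroup.coe_mul, coe_emb, mul_assoc]
  by_cases hg : w⁻¹ * (g : P.Aut) ∈ weyl P Δ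
  · have hg' : w⁻¹ * ((g * emb b Δ h : weyl P (b.support : Set ι)) : P.Aut) ∈ weyl P Δ := by
      rw [e]; exact mul_mem hg h.2
    rw [fnDelta_of_mem hg, fnDelta_of_mem hg', t_t_apply, ← mul_inv_rev]
    congr 3
  · rw [fnDelta_of_not_mem hg, fnDelta_of_not_mem, map_zero]
    rw [e]
    exact fun h' => hg ((Subgroup.mul_mem_cancel_right _ h.2).1 h')

/-- An equivariant function is determined by its value at `w` and its values outside the coset of
`w`. -/
lemma eq_of_mem_fnSpace {f f' : weyl P (b.support : Set ι) → U} (hf : f ∈ fnSpace b ρ)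
    (hf' : f' ∈ fnSpace b ρ) {hw : w ∈ weyl P (b.support : Set ι)} (h : f ⟨w, hw⟩ = f' ⟨w, hw⟩)
    (h' : ∀ g : weyl P (b.support : Set ι), w⁻¹ * (g : P.Aut) ∉ weyl P Δ → f g = f' g) :
    f = f' := by
  funext g
  by_cases hg : w⁻¹ * (g : P.Aut) ∈ weyl P Δ
  · have e : g = ⟨w, hw⟩ * emb b Δ ⟨_, hg⟩ :=
      Subtype.ext (by rw [Subgroup.coe_mul, coe_emb, mul_inv_cancel_left])
    rw [e, hf, hf', h]
  · exact h' g hg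

/-- On functions supported on the coset of `w`, the element `w ω` acts as `ω` acts on the values. -/
lemma fnX_fnDelta (hw : IsStandardizing b Δ w)
    (hc : ∀ w ∈ weyl P (b.support : Set ι), ∀ i, c (w • i) = c i)
    (hwW : w ∈ weyl P (b.support : Set ι)) (ω : CartanDual X) (u : U) :
    fnX b ρ w (act P w ω) (fnDelta b ρ w u) = fnDelta b ρ w (ρ (Alg.x ω) u) := by
  refine eq_of_mem_fnSpace (w := w) (hw := hwW) (fnX_mem hc hw _ (fnDelta_mem _)) (fnDelta_mem _)
    ?_ fun g hg => ?_
  · rw [fnX_apply, fnDelta_self, fnDelta_self, act_inv_act, Finset.sum_eq_zero, add_zero]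
    intro i _
    -- The two signs cancel for the roots of `w Δ`; for the others, `s_i w` lies in a different
    -- coset.
    by_cases hi : w⁻¹ • i ∈ generatedRoots P Δ
    · have h1 : relSgn b Δ w (w⁻¹ • i) = - sgn b i := by
        rw [relSgn, if_pos hi, sgn_congr b (hw.pos _ hi), smul_inv_smul]
      rw [h1, add_neg_cancel, zero_mul, zero_smul]
    · rw [fnDelta_of_not_mem, map_zero, smul_zero]
      rw [Subgroup.coe_mul, coe_reflW]
      have h2 := reflection_smul_eq P w⁻¹ i
      rw [inv_inv, mul_assoc] at h2
      change w⁻¹ * (𝓈 P i * w) ∉ _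
      rwa [← h2, hw.reflection_mem_iff]
  · rw [fnX_apply, fnDelta_of_not_mem hg, fnDelta_of_not_mem hg, map_zero, zero_add,
      Finset.sum_eq_zero]
    intro i _
    by_cases hi : w⁻¹ * ((reflW b i * g : weyl P (b.support : Set ι)) : P.Aut) ∈ weyl P Δ
    · -- The value at `s_i g` is nonzero only if `i` is not a root of `w Δ`, and then the signs
      -- cancel.
      obtain ⟨h, hh⟩ : ∃ h, h = w⁻¹ * ((reflW b i * g : weyl P (b.support : Set ι)) : P.Aut) :=
        ⟨_, rfl⟩
      rw [← hh] at hi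
      have hg' : (g : P.Aut) = 𝓈 P i * w * h := by
        rw [hh, Subgroup.coe_mul, coe_reflW, mul_assoc, mul_inv_cancel_left, ← mul_assoc,
          reflection_mul_self, one_mul]
      set δ := h⁻¹ • w⁻¹ • i with hδ
      have hgi : (g : P.Aut)⁻¹ • i = opp P δ := by
        rw [hg', mul_inv_rev, mul_inv_rev, mul_smul, mul_smul, RootPairing.Equiv.reflection_inv,
          reflection_smul_self, smul_opp, smul_opp]
      have hδ' : δ ∉ generatedRoots P Δ := by
        intro hcon
        have h1 : w⁻¹ • i ∈ generatedRoots P Δ := (smul_mem_generatedRoots (inv_mem hi)).1 hcon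
        apply hg
        have h2 := reflection_smul_eq P w⁻¹ i
        rw [inv_inv] at h2
        rw [hg', ← mul_assoc, ← mul_assoc, ← h2]
        exact mul_mem (reflection_mem_weyl_of_generatedRoots P Δ h1) hi
      have h3 : sgn b i = sgn b (w • δ) := by
        apply sgn_congr
        rw [← hw.isPos_smul_smul hi hδ', hδ, smul_inv_smul, smul_inv_smul]
      rw [hgi, relSgn_opp, relSgn, if_neg hδ', h3, add_neg_cancel, zero_mul, zero_smul]
    · rw [fnDelta_of_not_mem hi, map_zero, smul_zero]

end FunctionModel

/-! ### Induced modules -/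

section InducedModules

section

variable {W E D : Type*} [Group W] [AddCommGroup E] [Module ℂ E]
variable {s : D → W} {α : D → E} {αv : D → Module.Dual ℂ E} {c : D → ℂ}
variable {B : Type*} [Ring B] [Algebra ℂ B] (fT : W → B) (fR : B) (fX : E → B)
    (h1 : fT 1 = 1) (hm : ∀ w w', fT w * fT w' = fT (w * w'))
    (hrt : ∀ w, fR * fT w = fT w * fR) (hrx : ∀ ω, fR * fX ω = fX ω * fR)
    (hadd : ∀ ω ω', fX (ω + ω') = fX ω + fX ω') (hsmul : ∀ (z : ℂ) ω, fX (z • ω) = z • fX ω)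
    (hcomm : ∀ ω ω', fX ω * fX ω' = fX ω' * fX ω)
    (hcross : ∀ d ω, fX ω * fT (s d) =
      fT (s d) * fX (ω - αv d ω • α d) + (c d * αv d ω) • fR)

lemma Alg.lift_t (w : W) :
    Alg.lift fT fR fX h1 hm hrt hrx hadd hsmul hcomm hcross (Alg.t w) = fT w := by
  simp [Alg.lift, Alg.t]

lemma Alg.lift_r : Alg.lift fT fR fX h1 hm hrt hrx hadd hsmul hcomm hcross Alg.r = fR := by
  simp [Alg.lift, Alg.r]

lemma Alg.lift_x (ω : E) :
    Alg.lift fT fR fX h1 hm hrt hrx hadd hsmul hcomm hcross (Alg.x ω) = fX ω := by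
  simp [Alg.lift, Alg.x]

end

variable {A B : Type*} [Ring A] [Algebra ℂ A] [Ring B] [Algebra ℂ B]
variable {V Z : Type*} [AddCommGroup V] [Module ℂ V] [AddCommGroup Z] [Module ℂ Z]
variable (j : A →ₐ[ℂ] B) (ρ : A →ₐ[ℂ] Module.End ℂ V)

/-- The map `v ↦ 1 ⊗ v`. -/
def indOne : V →ₗ[ℂ] Induced j ρ := (inducedRel j ρ).mkQ ∘ₗ TensorProduct.mk ℂ B V 1

variable {j ρ}

lemma inducedRep_indOne (a : B) (v : V) :
    inducedRep j ρ a (indOne j ρ v) = (inducedRel j ρ).mkQ (a ⊗ₜ v) := by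
  change (inducedRel j ρ).mkQ ((a * 1) ⊗ₜ v) = _
  rw [mul_one]

lemma inducedRep_apply_indOne (a : A) (v : V) :
    inducedRep j ρ (j a) (indOne j ρ v) = indOne j ρ (ρ a v) := by
  rw [inducedRep_indOne, Submodule.mkQ_apply, eq_comm, indOne, LinearMap.comp_apply,
    Submodule.mkQ_apply, eq_comm, Submodule.Quotient.eq]
  exact Submodule.subset_span ⟨1, a, v, by rw [one_mul]; rfl⟩

lemma induced_induction {p : Induced j ρ → Prop} (h : ∀ a v, p (inducedRep j ρ a (indOne j ρ v)))
    (hadd : ∀ x y, p x → p y → p (x + y)) (y : Induced j ρ) : p y := by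
  obtain ⟨y, rfl⟩ := (inducedRel j ρ).mkQ_surjective y
  induction y using TensorProduct.induction_on with
  | zero => simpa using h 0 0
  | tmul a v => rw [← inducedRep_indOne]; exact h a v
  | add x y hx hy => rw [map_add]; exact hadd _ _ hx hy

/-- Frobenius reciprocity: an `A`-homomorphism from `V` to a `B`-module extends to the induced
module. -/
def indLift (π : B →ₐ[ℂ] Module.End ℂ Z) (φ : V →ₗ[ℂ] Z) (hφ : ∀ a v, φ (ρ a v) = π (j a) (φ v)) :
    Induced j ρ →ₗ[ℂ] Z :=
  (inducedRel j ρ).liftQ (TensorProduct.lift (LinearMap.lcomp ℂ Z φ ∘ₗ π.toLinearMap)) (by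
    refine Submodule.span_le.2 ?_
    rintro _ ⟨a, a', v, rfl⟩
    simp [hφ])

lemma indLift_apply (π : B →ₐ[ℂ] Module.End ℂ Z) (φ : V →ₗ[ℂ] Z)
    (hφ : ∀ a v, φ (ρ a v) = π (j a) (φ v)) (a : B) (v : V) :
    indLift π φ hφ (inducedRep j ρ a (indOne j ρ v)) = π a (φ v) := by
  rw [inducedRep_indOne]
  change TensorProduct.lift (LinearMap.lcomp ℂ Z φ ∘ₗ π.toLinearMap) (a ⊗ₜ v) = _
  simp

lemma indLift_indOne (π : B →ₐ[ℂ] Module.End ℂ Z) (φ : V →ₗ[ℂ] Z)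
    (hφ : ∀ a v, φ (ρ a v) = π (j a) (φ v)) (v : V) :
    indLift π φ hφ (indOne j ρ v) = φ v := by
  have := indLift_apply π φ hφ 1 v
  rwa [map_one, map_one] at this

lemma indLift_inducedRep (π : B →ₐ[ℂ] Module.End ℂ Z) (φ : V →ₗ[ℂ] Z)
    (hφ : ∀ a v, φ (ρ a v) = π (j a) (φ v)) (a : B) (y : Induced j ρ) :
    indLift π φ hφ (inducedRep j ρ a y) = π a (indLift π φ hφ y) := by
  refine induced_induction (p := fun y => indLift π φ hφ (inducedRep j ρ a y) =
    π a (indLift π φ hφ y)) (fun a' v => ?_) (fun x y hx hy => ?_) y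
  · rw [← Module.End.mul_apply, ← map_mul, indLift_apply, indLift_apply, map_mul]; rfl
  · rw [map_add, map_add, map_add, map_add, hx, hy]

/-- A stable subspace of an induced module that contains the inducing module is everything. -/
lemma eq_top_of_indOne_mem {N : Submodule ℂ (Induced j ρ)} (hN : IsStable (inducedRep j ρ) N)
    (h : ∀ v, indOne j ρ v ∈ N) : N = ⊤ :=
  eq_top_iff.2 fun y _ => induced_induction (p := fun y => y ∈ N) (fun a v => hN a _ (h v))
    (fun _ _ => N.add_mem) y

end InducedModules

/-! ### The Hecke module of functions -/

section FunctionModule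

variable {ι X Y : Type*} [AddCommGroup X] [AddCommGroup Y]
variable {P : RootPairing ι ℤ X Y} {b : P.Base} {Δ : Set ι} {c : ι → ℕ}
variable {U : Type*} [AddCommGroup U] [Module ℂ U] [Fintype ι]
variable {ρ : HeckeAlg P Δ c →ₐ[ℂ] Module.End ℂ U} {w : P.Aut}

variable (b Δ) in
open Classical in
/-- The order of the Weyl group of a subsystem. -/
def weylCard [Fintype (weyl P (b.support : Set ι))] : ℂ :=
  ∑ g : weyl P (b.support : Set ι), if (g : P.Aut) ∈ weyl P Δ then 1 else 0

omit [Fintype ι] in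
lemma weylCard_ne_zero [Fintype (weyl P (b.support : Set ι))] : weylCard b Δ ≠ 0 := by
  classical
  rw [weylCard, Finset.sum_boole, Nat.cast_ne_zero, Finset.card_ne_zero]
  exact ⟨1, by simp⟩

/-- Every function in the model is a combination of translates of the functions supported on the
coset of `w`. -/
lemma sum_fnT_fnDelta [Fintype (weyl P (b.support : Set ι))] (hw : w ∈ weyl P (b.support : Set ι))
    {f : weyl P (b.support : Set ι) → U} (hf : f ∈ fnSpace b ρ) :
    ∑ g : weyl P (b.support : Set ι), fnT b U (g * ⟨w, hw⟩⁻¹) (fnDelta b ρ w (f g)) =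
      weylCard b Δ • f := by
  classical
  funext g'
  rw [Finset.sum_apply, weylCard, Pi.smul_apply, Finset.sum_smul]
  refine Fintype.sum_equiv ((Equiv.inv _).trans (Equiv.mulRight g')) _ _ fun g => ?_
  have e : w⁻¹ * (((g * ⟨w, hw⟩⁻¹)⁻¹ * g' : weyl P (b.support : Set ι)) : P.Aut) =
      (g : P.Aut)⁻¹ * g' := by
    rw [Subgroup.coe_mul, mul_inv_rev, inv_inv, Subgroup.coe_mul, Subgroup.coe_inv, mul_assoc,
      inv_mul_cancel_left]
  rw [fnT_apply]
  change _ = (if (g : P.Aut)⁻¹ * g' ∈ weyl P Δ then (1 : ℂ) else 0) • f g'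
  split_ifs with h
  · have h' := h
    rw [← e] at h'
    have e2 : g' = g * emb b Δ ⟨_, h⟩ :=
      Subtype.ext (by rw [Subgroup.coe_mul, coe_emb, mul_inv_cancel_left])
    rw [fnDelta_of_mem h', one_smul]
    nth_rewrite 2 [e2]
    rw [mem_fnSpace_iff.1 hf]
    congr 5
  · rw [← e] at h
    rw [fnDelta_of_not_mem h, zero_smul]

variable (b ρ w) in
/-- The commutator of two of the operators by which `𝔥^*` acts on functions. -/
def fnComm (ω ω' : CartanDual X) : Module.End ℂ (weyl P (b.support : Set ι) → U) :=
  fnX b ρ w ω * fnX b ρ w ω' - fnX b ρ w ω' * fnX b ρ w ω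

/-- The commutator satisfies the commutation relation with simple reflections without the term in
`r`. -/
lemma fnComm_fnT_simple (hc : ∀ w ∈ weyl P (b.support : Set ι), ∀ i, c (w • i) = c i)
    (d : (b.support : Set ι)) (ω ω' : CartanDual X) :
    fnComm b ρ w ω ω' * fnT b U (reflW b d) =
      fnT b U (reflW b d) * fnComm b ρ w (act P (𝓈 P (d : ι)) ω) (act P (𝓈 P (d : ι)) ω') := by
  have key : ∀ ω ω', fnX b ρ w ω * fnX b ρ w ω' * fnT b U (reflW b d) =
      fnT b U (reflW b d) * (fnX b ρ w (act P (𝓈 P (d : ι)) ω) *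
        fnX b ρ w (act P (𝓈 P (d : ι)) ω')) +
      fnR b ρ * ((c d * cor P d ω) • fnX b ρ w (act P (𝓈 P (d : ι)) ω') +
        (c d * cor P d ω') • fnX b ρ w ω) := by
    intro ω ω'
    rw [mul_assoc, fnX_fnT ρ w hc d ω', mul_add, ← mul_assoc, fnX_fnT ρ w hc d ω, add_mul,
      mul_assoc, add_assoc, mul_add, smul_mul_assoc, mul_smul_comm, ← fnR_fnX, mul_smul_comm,
      mul_smul_comm]
  have h2 : (c d * cor P d ω) • fnX b ρ w (act P (𝓈 P (d : ι)) ω') +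
      (c d * cor P d ω') • fnX b ρ w ω = (c d * cor P d ω') • fnX b ρ w (act P (𝓈 P (d : ι)) ω) +
        (c d * cor P d ω) • fnX b ρ w ω' := by
    rw [← fnX_smul, ← fnX_smul, ← fnX_smul, ← fnX_smul, ← fnX_add, ← fnX_add]
    congr 1
    rw [act_reflection, act_reflection]
    module
  rw [fnComm, sub_mul, key, key, h2, fnComm, mul_sub]
  abel

lemma fnComm_fnT (hc : ∀ w ∈ weyl P (b.support : Set ι), ∀ i, c (w • i) = c i)
    (u : weyl P (b.support : Set ι)) (ω ω' : CartanDual X) :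
    fnComm b ρ w ω ω' * fnT b U u =
      fnT b U u * fnComm b ρ w (act P (u : P.Aut)⁻¹ ω) (act P (u : P.Aut)⁻¹ ω') := by
  refine weyl_induction (p := fun u => ∀ ω ω', fnComm b ρ w ω ω' * fnT b U u =
      fnT b U u * fnComm b ρ w (act P (u : P.Aut)⁻¹ ω) (act P (u : P.Aut)⁻¹ ω'))
    (fun ω ω' => ?_) (fun d u ih ω ω' => ?_) u ω ω'
  · rw [fnT_one, mul_one, one_mul, Subgroup.coe_one, inv_one, act_one, act_one]
  · rw [← fnT_mul, ← mul_assoc, simpleRefl_eq_reflW, fnComm_fnT_simple hc, mul_assoc, ih, mul_assoc,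
      Subgroup.coe_mul, mul_inv_rev, coe_reflW, RootPairing.Equiv.reflection_inv, act_mul, act_mul]

/-- The operators `fnX` commute on equivariant functions: their commutators commute with
translations up to a twist and vanish on the functions supported on the coset of `w`, whose
translates span the space. -/
lemma fnX_comm_apply (hw : IsStandardizing b Δ w)
    (hc : ∀ w ∈ weyl P (b.support : Set ι), ∀ i, c (w • i) = c i)
    (hwW : w ∈ weyl P (b.support : Set ι)) (ω ω' : CartanDual X)
    {f : weyl P (b.support : Set ι) → U} (hf : f ∈ fnSpace b ρ) :
    fnX b ρ w ω (fnX b ρ w ω' f) = fnX b ρ w ω' (fnX b ρ w ω f) := by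
  have := finite_weyl b
  have := Fintype.ofFinite (weyl P (b.support : Set ι))
  have hdelta : ∀ ω ω' u, fnComm b ρ w ω ω' (fnDelta b ρ w u) = 0 := by
    intro ω ω' u
    rw [← act_act_inv w ω, ← act_act_inv w ω']
    simp only [fnComm, LinearMap.sub_apply, Module.End.mul_apply]
    rw [fnX_fnDelta hw hc hwW, fnX_fnDelta hw hc hwW, fnX_fnDelta hw hc hwW,
      fnX_fnDelta hw hc hwW, ← Module.End.mul_apply, ← map_mul, Alg.x_comm, map_mul,
      Module.End.mul_apply, sub_self]
  have h1 : weylCard b Δ • fnComm b ρ w ω ω' f = 0 := by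
    rw [← map_smul, ← sum_fnT_fnDelta hwW hf, map_sum, Finset.sum_eq_zero]
    intro g _
    rw [← Module.End.mul_apply, fnComm_fnT hc, Module.End.mul_apply, hdelta, map_zero]
  have h2 := (smul_eq_zero_iff_right weylCard_ne_zero).1 h1
  simpa [fnComm, sub_eq_zero] using h2

/-- The `ℍ`-module of functions on the Weyl group that are equivariant for the Weyl group of the
subsystem, with values in an `ℍ_Δ`-module. -/
def fnRep (ρ : HeckeAlg P Δ c →ₐ[ℂ] Module.End ℂ U) (hw : IsStandardizing b Δ w)
    (hc : ∀ w ∈ weyl P (b.support : Set ι), ∀ i, c (w • i) = c i)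
    (hwW : w ∈ weyl P (b.support : Set ι)) :
    HeckeAlg P (b.support : Set ι) c →ₐ[ℂ] Module.End ℂ (fnSpace b ρ) :=
  Alg.lift (fun u => (fnT b U u).restrict fun _ => fnT_mem u)
    ((fnR b ρ).restrict fun _ => fnR_mem)
    (fun ω => (fnX b ρ w ω).restrict fun _ => fnX_mem hc hw ω)
    (by ext1 f; exact Subtype.ext (LinearMap.congr_fun (fnT_one b) f.1))
    (fun u u' => by ext1 f; exact Subtype.ext (LinearMap.congr_fun (fnT_mul b u u') f.1))
    (fun u => by ext1 f; exact Subtype.ext (LinearMap.congr_fun (fnR_fnT b ρ u) f.1))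
    (fun ω => by ext1 f; exact Subtype.ext (LinearMap.congr_fun (fnR_fnX b ρ w ω) f.1))
    (fun ω ω' => by
      ext1 f; exact Subtype.ext (LinearMap.congr_fun (fnX_add b ρ w ω ω') f.1))
    (fun z ω => by
      ext1 f; exact Subtype.ext (LinearMap.congr_fun (fnX_smul b ρ w z ω) f.1))
    (fun ω ω' => by ext1 f; exact Subtype.ext (fnX_comm_apply hw hc hwW ω ω' f.2))
    (fun d ω => by
      ext1 f
      have h := LinearMap.congr_fun (fnX_fnT ρ w hc d ω) f.1
      rw [act_reflection] at h
      exact Subtype.ext h)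

section

variable (hw : IsStandardizing b Δ w)
  (hc : ∀ w ∈ weyl P (b.support : Set ι), ∀ i, c (w • i) = c i)
  (hwW : w ∈ weyl P (b.support : Set ι))

lemma coe_fnRep_t (u) (f : fnSpace b ρ) :
    (fnRep ρ hw hc hwW (Alg.t u) f : _ → U) = fnT b U u f := by
  rw [fnRep, Alg.lift_t]; rfl

lemma coe_fnRep_r (f : fnSpace b ρ) :
    (fnRep ρ hw hc hwW Alg.r f : _ → U) = fnR b ρ f := by
  rw [fnRep, Alg.lift_r]; rfl

lemma coe_fnRep_x (ω) (f : fnSpace b ρ) :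
    (fnRep ρ hw hc hwW (Alg.x ω) f : _ → U) = fnX b ρ w ω f := by
  rw [fnRep, Alg.lift_x]; rfl

variable (b ρ w) in
/-- The map that sends `u` to the function with value `u` at `w`, supported on the coset of `w`. -/
def fnDeltaHom : U →ₗ[ℂ] fnSpace b ρ where
  toFun u := ⟨fnDelta b ρ w u, fnDelta_mem u⟩
  map_add' u u' := by
    ext g
    by_cases hg : w⁻¹ * (g : P.Aut) ∈ weyl P Δ
    · simp [fnDelta_of_mem hg]
    · simp [fnDelta_of_not_mem hg]
  map_smul' z u := by
    ext g
    by_cases hg : w⁻¹ * (g : P.Aut) ∈ weyl P Δ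
    · simp [fnDelta_of_mem hg]
    · simp [fnDelta_of_not_mem hg]

lemma coe_fnDeltaHom (u : U) : (fnDeltaHom b ρ w u : _ → U) = fnDelta b ρ w u := rfl

lemma fnDeltaHom_apply (h : ∀ d ∈ Δ, w • d ∈ (b.support : Set ι)) (hcw : ∀ i, c (w • i) = c i)
    (a : HeckeAlg P Δ c) (u : U) : fnDeltaHom b ρ w (ρ a u) =
      fnRep ρ hw hc hwW (conjHom P w h hcw a) (fnDeltaHom b ρ w u) := by
  refine intertwines_of_generators (φ := fnDeltaHom b ρ w) (ρ := ρ)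
    (ρ' := (fnRep ρ hw hc hwW).comp (conjHom P w h hcw)) (fun k u => ?_) (fun u => ?_)
    (fun ω u => ?_) a u
  · refine Subtype.ext ?_
    rw [AlgHom.comp_apply, conjHom, Alg.lift_t, coe_fnRep_t]
    change fnDelta b ρ w _ = fnT b U _ (fnDelta b ρ w u)
    funext g
    have e : w⁻¹ * (((⟨w * k * w⁻¹, conj_mem_weyl P w h k.2⟩ : weyl P (b.support : Set ι))⁻¹ * g :
        weyl P (b.support : Set ι)) : P.Aut) = (k : P.Aut)⁻¹ * (w⁻¹ * g) := by
      rw [Subgroup.coe_mul, Subgroup.coe_inv]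
      group
    rw [fnT_apply]
    by_cases hg : w⁻¹ * (g : P.Aut) ∈ weyl P Δ
    · have hg' := mul_mem (inv_mem k.2) hg
      rw [← e] at hg'
      have e' : (⟨_, hg'⟩ : weyl P Δ) = k⁻¹ * ⟨_, hg⟩ := Subtype.ext e
      rw [fnDelta_of_mem hg, fnDelta_of_mem hg', t_t_apply, e', mul_inv_rev, inv_inv]
    · rw [fnDelta_of_not_mem hg, fnDelta_of_not_mem]
      rw [e]
      exact fun h' => hg ((Subgroup.mul_mem_cancel_left _ (inv_mem k.2)).1 h')
  · refine Subtype.ext ?_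
    rw [AlgHom.comp_apply, conjHom, Alg.lift_r, coe_fnRep_r]
    change fnDelta b ρ w _ = fnR b ρ (fnDelta b ρ w u)
    funext g
    rw [fnR_apply]
    by_cases hg : w⁻¹ * (g : P.Aut) ∈ weyl P Δ
    · rw [fnDelta_of_mem hg, fnDelta_of_mem hg, r_t_apply]
    · rw [fnDelta_of_not_mem hg, fnDelta_of_not_mem hg, map_zero]
  · refine Subtype.ext ?_
    rw [AlgHom.comp_apply, conjHom, Alg.lift_x, coe_fnRep_x]
    exact (fnX_fnDelta hw hc hwW ω u).symm

end

end FunctionModule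

/-! ### Homomorphisms between Hecke algebras -/

section Homomorphisms

variable {ι X Y : Type*} [AddCommGroup X] [AddCommGroup Y]
variable {P : RootPairing ι ℤ X Y} {Δ Δ' : Set ι} {c : ι → ℕ}

lemma incl_t (h : Δ ⊆ Δ') (g : weyl P Δ) :
    incl P c h (Alg.t g) = Alg.t ⟨g, Subgroup.closure_mono (Set.image_mono h) g.2⟩ :=
  Alg.lift_t _ _ _ _ _ _ _ _ _ _ _ _

lemma incl_r (h : Δ ⊆ Δ') : incl P c h Alg.r = Alg.r := Alg.lift_r _ _ _ _ _ _ _ _ _ _ _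

lemma incl_x (h : Δ ⊆ Δ') (ω : CartanDual X) : incl P c h (Alg.x ω) = Alg.x ω :=
  Alg.lift_x _ _ _ _ _ _ _ _ _ _ _ _

lemma conjHom_t (w : P.Aut) (h : ∀ d ∈ Δ, w • d ∈ Δ') (hc : ∀ i, c (w • i) = c i) (g : weyl P Δ) :
    conjHom P w h hc (Alg.t g) = Alg.t ⟨w * g * w⁻¹, conj_mem_weyl P w h g.2⟩ :=
  Alg.lift_t _ _ _ _ _ _ _ _ _ _ _ _

lemma conjHom_r (w : P.Aut) (h : ∀ d ∈ Δ, w • d ∈ Δ') (hc : ∀ i, c (w • i) = c i) :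
    conjHom P w h hc Alg.r = Alg.r := Alg.lift_r _ _ _ _ _ _ _ _ _ _ _

lemma conjHom_x (w : P.Aut) (h : ∀ d ∈ Δ, w • d ∈ Δ') (hc : ∀ i, c (w • i) = c i)
    (ω : CartanDual X) : conjHom P w h hc (Alg.x ω) = Alg.x (act P w ω) :=
  Alg.lift_x _ _ _ _ _ _ _ _ _ _ _ _

lemma evalAt_t (ν : Cartan Y) (hν : ν ∈ annih P Δ) (g : weyl P Δ) :
    evalAt P c ν hν (Alg.t g) = Alg.t g := Alg.lift_t _ _ _ _ _ _ _ _ _ _ _ _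

lemma evalAt_r (ν : Cartan Y) (hν : ν ∈ annih P Δ) :
    evalAt P c ν hν Alg.r = Alg.r := Alg.lift_r _ _ _ _ _ _ _ _ _ _ _

lemma evalAt_x (ν : Cartan Y) (hν : ν ∈ annih P Δ) (ω : CartanDual X) :
    evalAt P c ν hν (Alg.x ω) =
      Alg.x (restrictDual P Δ ω) + algebraMap ℂ _ (pair P ω ν) :=
  Alg.lift_x _ _ _ _ _ _ _ _ _ _ _ _

lemma shift_t (χ : Cartan Y) (hχ : χ ∈ annih P Δ) (g : weyl P Δ) :
    shift P c χ hχ (Alg.t g) = Alg.t g := Alg.lift_t _ _ _ _ _ _ _ _ _ _ _ _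

lemma shift_r (χ : Cartan Y) (hχ : χ ∈ annih P Δ) :
    shift P c χ hχ Alg.r = Alg.r := Alg.lift_r _ _ _ _ _ _ _ _ _ _ _

lemma shift_x (χ : Cartan Y) (hχ : χ ∈ annih P Δ) (ω : CartanDual X) :
    shift P c χ hχ (Alg.x ω) = Alg.x ω + algebraMap ℂ _ (pair P ω χ) :=
  Alg.lift_x _ _ _ _ _ _ _ _ _ _ _ _

/-- The natural homomorphism is the one attached to the identity. -/
lemma incl_eq_conjHom (hΔ : Δ ⊆ Δ') : incl P c hΔ =
    conjHom P 1 (fun d hd => by rw [one_smul]; exact hΔ hd) fun i => by rw [one_smul] := by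
  refine Alg.hom_ext (fun g => ?_) ?_ fun ω => ?_
  · rw [incl_t, conjHom_t]
    congr 1
    exact Subtype.ext (by simp)
  · rw [incl_r, conjHom_r]
  · rw [incl_x, conjHom_x, act_one]

lemma shift_shift_neg (χ : Cartan Y) (hχ : χ ∈ annih P Δ) :
    (shift P c χ hχ).comp (shift P c (-χ) (neg_mem hχ)) = AlgHom.id ℂ _ := by
  refine Alg.hom_ext (fun g => ?_) ?_ fun ω => ?_
  · rw [AlgHom.comp_apply, shift_t, shift_t]; rfl
  · rw [AlgHom.comp_apply, shift_r, shift_r]; rfl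
  · rw [AlgHom.comp_apply, shift_x, map_add, shift_x, AlgHom.commutes, map_neg, map_neg]
    simp

lemma evalAt_comp_shift (ν χ ν' : Cartan Y) (hν : ν ∈ annih P Δ) (hχ : χ ∈ annih P Δ)
    (hν' : ν' ∈ annih P Δ) (h : ν + χ = ν') :
    (evalAt P c ν hν).comp (shift P c χ hχ) = evalAt P c ν' hν' := by
  subst h
  refine Alg.hom_ext (fun g => ?_) ?_ fun ω => ?_
  · rw [AlgHom.comp_apply, shift_t, evalAt_t, evalAt_t]
  · rw [AlgHom.comp_apply, shift_r, evalAt_r, evalAt_r]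
  · rw [AlgHom.comp_apply, shift_x, map_add, evalAt_x, AlgHom.commutes, evalAt_x, map_add, map_add]
    abel

lemma shift_incl (χ : Cartan Y) (hχ : χ ∈ annih P Δ) (h : Δ ⊆ Δ') (hχ' : χ ∈ annih P Δ') :
    (shift P c χ hχ').comp (incl P c h) = (incl P c h).comp (shift P c χ hχ) := by
  refine Alg.hom_ext (fun g => ?_) ?_ fun ω => ?_
  · simp only [AlgHom.comp_apply, shift_t, incl_t]
  · simp only [AlgHom.comp_apply, shift_r, incl_r]
  · simp only [AlgHom.comp_apply, shift_x, incl_x, map_add, AlgHom.commutes]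

end Homomorphisms

section InducedGenerators

variable {ι X Y : Type*} [AddCommGroup X] [AddCommGroup Y]
variable {P : RootPairing ι ℤ X Y} {Δ Δ' : Set ι} {c : ι → ℕ}
variable {U : Type*} [AddCommGroup U] [Module ℂ U]
variable {ρ : HeckeAlg P Δ c →ₐ[ℂ] Module.End ℂ U} {w : P.Aut}
variable (h : ∀ d ∈ Δ, w • d ∈ Δ') (hcw : ∀ i, c (w • i) = c i)

lemma inducedRep_t_indOne (k : weyl P Δ) (u : U) :
    inducedRep (conjHom P w h hcw) ρ (Alg.t ⟨w * k * w⁻¹, conj_mem_weyl P w h k.2⟩)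
      (indOne (conjHom P w h hcw) ρ u) = indOne (conjHom P w h hcw) ρ (ρ (Alg.t k) u) := by
  rw [← inducedRep_apply_indOne, conjHom_t]

lemma inducedRep_x_indOne (ω : CartanDual X) (u : U) :
    inducedRep (conjHom P w h hcw) ρ (Alg.x (act P w ω))
      (indOne (conjHom P w h hcw) ρ u) = indOne (conjHom P w h hcw) ρ (ρ (Alg.x ω) u) := by
  rw [← inducedRep_apply_indOne, conjHom_x]

lemma inducedRep_r_indOne (u : U) : inducedRep (conjHom P w h hcw) ρ Alg.r
      (indOne (conjHom P w h hcw) ρ u) = indOne (conjHom P w h hcw) ρ (ρ Alg.r u) := by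
  rw [← inducedRep_apply_indOne, conjHom_r]

end InducedGenerators

/-! ### Induced modules and the function model -/

section InducedFunctionModel

variable {ι X Y : Type*} [AddCommGroup X] [AddCommGroup Y]
variable {P : RootPairing ι ℤ X Y} {b : P.Base} {Δ : Set ι} {c : ι → ℕ}
variable {U Z : Type*} [AddCommGroup U] [Module ℂ U] [AddCommGroup Z] [Module ℂ Z] [Fintype ι]
variable {ρ : HeckeAlg P Δ c →ₐ[ℂ] Module.End ℂ U} {w : P.Aut}

section

variable [Fintype (weyl P (b.support : Set ι))]
  (π : HeckeAlg P (b.support : Set ι) c →ₐ[ℂ] Module.End ℂ Z)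
  (hwW : w ∈ weyl P (b.support : Set ι)) (φ : U →ₗ[ℂ] Z)

variable (ρ) in
/-- The map from the function model to an `ℍ`-module that is obtained from a linear map on the
inducing module by summation over the Weyl group. -/
def fnSum : fnSpace b ρ →ₗ[ℂ] Z where
  toFun f := ∑ g : weyl P (b.support : Set ι), π (Alg.t (g * ⟨w, hwW⟩⁻¹)) (φ (f.1 g))
  map_add' f f' := by
    rw [← Finset.sum_add_distrib]
    exact Finset.sum_congr rfl fun g _ => by rw [← map_add, ← map_add]; rfl
  map_smul' z f := by
    rw [Finset.smul_sum]
    exact Finset.sum_congr rfl fun g _ => by rw [RingHom.id_apply, ← map_smul, ← map_smul]; rfl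

omit [Fintype ι] in
open Classical in
lemma sum_ite_mem_weyl (hwW : w ∈ weyl P (b.support : Set ι)) (z : Z) :
    ∑ g : weyl P (b.support : Set ι), (if w⁻¹ * (g : P.Aut) ∈ weyl P Δ then z else 0) =
      weylCard b Δ • z := by
  rw [weylCard, Finset.sum_smul]
  refine Fintype.sum_equiv (Equiv.mulLeft ⟨w, hwW⟩⁻¹) _ _ fun g => ?_
  change _ = (if w⁻¹ * (g : P.Aut) ∈ weyl P Δ then (1 : ℂ) else 0) • z
  split_ifs <;> simp

/-- Up to the order of the Weyl group of the subsystem, `fnSum` maps the translate by `x` of the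
function with value `u` at `w` to `t_x φ(u)`. -/
lemma fnSum_fnDelta (hφ : ∀ (k : weyl P Δ) u, φ (ρ (Alg.t k) u) =
      π (Alg.t (⟨w, hwW⟩ * emb b Δ k * ⟨w, hwW⟩⁻¹)) (φ u))
    (x : weyl P (b.support : Set ι)) (u : U) :
    fnSum ρ π hwW φ ⟨fnT b U x (fnDelta b ρ w u), fnT_mem x (fnDelta_mem u)⟩ =
      weylCard b Δ • π (Alg.t x) (φ u) := by
  classical
  rw [← sum_ite_mem_weyl hwW]
  change ∑ g : weyl P (b.support : Set ι), _ = _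
  refine Fintype.sum_equiv (Equiv.mulLeft x⁻¹) _ _ fun g => ?_
  change π (Alg.t (g * ⟨w, hwW⟩⁻¹)) (φ (fnT b U x (fnDelta b ρ w u) g)) =
    if w⁻¹ * ((x⁻¹ * g : weyl P (b.support : Set ι)) : P.Aut) ∈ weyl P Δ then _ else _
  rw [fnT_apply]
  split_ifs with h
  · have e : g = x * (⟨w, hwW⟩ * emb b Δ ⟨_, h⟩) := by
      refine Subtype.ext ?_
      simp only [Subgroup.coe_mul, coe_emb, Subgroup.coe_inv]
      group
    rw [fnDelta_of_mem h, hφ, t_t_apply]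
    nth_rewrite 1 [e]
    congr 4
    rw [map_inv]
    group
  · rw [fnDelta_of_not_mem h, map_zero, map_zero]

/-- If an `ℍ`-module is spanned by the translates of an image of the inducing module, its dimension
is at most that of the function model. -/
lemma finrank_le_fnSpace [FiniteDimensional ℂ U] (hφ : ∀ (k : weyl P Δ) u, φ (ρ (Alg.t k) u) =
      π (Alg.t (⟨w, hwW⟩ * emb b Δ k * ⟨w, hwW⟩⁻¹)) (φ u))
    (hspan : tSpan π (LinearMap.range φ) = ⊤) :
    Module.finrank ℂ Z ≤ Module.finrank ℂ (fnSpace b ρ) := by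
  refine LinearMap.finrank_le_finrank_of_surjective (f := fnSum ρ π hwW φ) ?_
  rw [← LinearMap.range_eq_top, eq_top_iff, ← hspan]
  refine tSpan_le ?_
  rintro x _ ⟨u, rfl⟩
  refine ⟨(weylCard b Δ)⁻¹ • ⟨fnT b U x (fnDelta b ρ w u), fnT_mem x (fnDelta_mem u)⟩, ?_⟩
  rw [map_smul, fnSum_fnDelta π hwW φ hφ, inv_smul_smul₀ weylCard_ne_zero]

end

variable (hw : IsStandardizing b Δ w)
  (hc : ∀ w ∈ weyl P (b.support : Set ι), ∀ i, c (w • i) = c i)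
  (hwW : w ∈ weyl P (b.support : Set ι)) (h : ∀ d ∈ Δ, w • d ∈ (b.support : Set ι))
  (hcw : ∀ i, c (w • i) = c i)

omit [Fintype ι] in
/-- The translates of the inducing module under the elements `t_w` span the induced module. -/
lemma tSpan_range_indOne {Δ' : Set ι} (h : ∀ d ∈ Δ, w • d ∈ Δ') :
    tSpan (inducedRep (conjHom P w h hcw) ρ)
      (LinearMap.range (indOne (conjHom P w h hcw) ρ)) = ⊤ := by
  refine eq_top_of_indOne_mem (isStable_tSpan simpleRefl_mul_self closure_range_simpleRefl ?_
    fun ω => ?_) fun v => le_tSpan ⟨v, rfl⟩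
  · rintro _ ⟨u, rfl⟩
    refine ⟨ρ Alg.r u, ?_⟩
    rw [← inducedRep_apply_indOne, conjHom_r]
  · rintro _ ⟨u, rfl⟩
    refine ⟨ρ (Alg.x (act P w⁻¹ ω)) u, ?_⟩
    rw [← inducedRep_apply_indOne, conjHom_x, act_act_inv]

/-- The map from the induced module to the function model. -/
def fnMap : Induced (conjHom P w h hcw) ρ →ₗ[ℂ] fnSpace b ρ :=
  indLift (fnRep ρ hw hc hwW) (fnDeltaHom b ρ w) (fnDeltaHom_apply hw hc hwW h hcw)

lemma fnMap_indOne (u : U) :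
    fnMap hw hc hwW h hcw (indOne (conjHom P w h hcw) ρ u) = fnDeltaHom b ρ w u :=
  indLift_indOne _ _ _ u

lemma fnMap_inducedRep (a) (y : Induced (conjHom P w h hcw) ρ) :
    fnMap hw hc hwW h hcw (inducedRep _ ρ a y) = fnRep ρ hw hc hwW a (fnMap hw hc hwW h hcw y) :=
  indLift_inducedRep _ _ _ a y

/-- The induced module is isomorphic to the function model. -/
lemma fnMap_bijective : Function.Bijective (fnMap (ρ := ρ) hw hc hwW h hcw) := by
  have := finite_weyl b
  have := Fintype.ofFinite (weyl P (b.support : Set ι))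
  constructor
  · set I := indOne (conjHom P w h hcw) ρ
    have hφ : ∀ (k : weyl P Δ) u, I (ρ (Alg.t k) u) = inducedRep (conjHom P w h hcw) ρ
        (Alg.t (⟨w, hwW⟩ * emb b Δ k * ⟨w, hwW⟩⁻¹)) (I u) := fun k u =>
      (inducedRep_t_indOne h hcw k u).symm
    -- Summation over the Weyl group is a left inverse of the map up to a nonzero scalar.
    have key : ∀ y, fnSum ρ (inducedRep (conjHom P w h hcw) ρ) hwW I (fnMap hw hc hwW h hcw y) =
        weylCard b Δ • y := by
      suffices hle : ⊤ ≤ LinearMap.eqLocus (fnSum ρ (inducedRep (conjHom P w h hcw) ρ) hwW I ∘ₗ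
          fnMap hw hc hwW h hcw) (weylCard b Δ • LinearMap.id) from fun y =>
        hle (Submodule.mem_top (x := y))
      rw [← tSpan_range_indOne hcw h]
      refine tSpan_le ?_
      rintro x _ ⟨u, rfl⟩
      rw [LinearMap.mem_eqLocus, LinearMap.comp_apply, LinearMap.smul_apply, LinearMap.id_apply,
        ← fnSum_fnDelta _ hwW I hφ]
      congr 1
      refine Subtype.ext ?_
      rw [fnMap_inducedRep, coe_fnRep_t, fnMap_indOne]
      rfl
    intro y y' hyy
    have := key y
    rw [hyy, key] at this
    exact ((smul_right_injective _ weylCard_ne_zero) this).symm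
  · rw [← LinearMap.range_eq_top, eq_top_iff]
    intro f _
    have hsum : f = (weylCard b Δ)⁻¹ • ∑ g : weyl P (b.support : Set ι),
        fnRep ρ hw hc hwW (Alg.t (g * ⟨w, hwW⟩⁻¹)) (fnDeltaHom b ρ w (f.1 g)) := by
      refine Subtype.ext ?_
      rw [Submodule.coe_smul, Submodule.coe_sum]
      simp only [coe_fnRep_t, coe_fnDeltaHom]
      rw [sum_fnT_fnDelta hwW f.2, inv_smul_smul₀ weylCard_ne_zero]
    rw [hsum]
    refine Submodule.smul_mem _ _ (Submodule.sum_mem _ fun g _ => ?_)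
    exact ⟨inducedRep _ ρ (Alg.t (g * ⟨w, hwW⟩⁻¹)) (indOne _ ρ (f.1 g)), by
      rw [fnMap_inducedRep, fnMap_indOne]⟩

include hw hc hwW in
/-- The inducing module embeds into the induced module. -/
lemma indOne_injective : Function.Injective (indOne (conjHom P w h hcw) ρ) := by
  intro u u' huu
  have h1 := congrArg (fun y => (fnMap hw hc hwW h hcw y).1 ⟨w, hwW⟩) huu
  simp only [fnMap_indOne] at h1
  change fnDelta b ρ w u _ = fnDelta b ρ w u' _ at h1
  rwa [fnDelta_self, fnDelta_self] at h1

include hw hc hwW in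
lemma finrank_induced :
    Module.finrank ℂ (Induced (conjHom P w h hcw) ρ) = Module.finrank ℂ (fnSpace b ρ) :=
  (LinearEquiv.ofBijective _ (fnMap_bijective hw hc hwW h hcw)).finrank_eq

omit [Fintype ι] in
lemma finiteDimensional_of_tSpan [Finite (weyl P Δ)] {π : HeckeAlg P Δ c →ₐ[ℂ] Module.End ℂ Z}
    {Q : Submodule ℂ Z} [FiniteDimensional ℂ Q] (h : tSpan π Q = ⊤) : FiniteDimensional ℂ Z := by
  have : FiniteDimensional ℂ (tSpan π Q) := Submodule.finiteDimensional_iSup _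
  exact Module.Finite.equiv (LinearEquiv.ofTop _ h)

end InducedFunctionModel

/-! ### Weights of Hecke modules -/

section HeckeWeights

variable {ι X Y : Type*} [AddCommGroup X] [AddCommGroup Y]
variable {P : RootPairing ι ℤ X Y} {Δ : Set ι} {c : ι → ℕ}
variable {V Z : Type*} [AddCommGroup V] [Module ℂ V] [AddCommGroup Z] [Module ℂ Z]

/-- Weights of a vector in a stable subspace may be computed in this subspace. -/
lemma mem_wtSum_restrictFamily {E : Type*} [AddCommGroup E] [Module ℂ E] [FiniteDimensional ℂ Z]
    {f : E →ₗ[ℂ] Module.End ℂ Z} (hf : ∀ ω ω', Commute (f ω) (f ω')) {N : Submodule ℂ Z}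
    (hN : ∀ ω, ∀ v ∈ N, f ω v ∈ N) {S : Set (E →ₗ[ℂ] ℂ)} (v : N) (hv : (v : Z) ∈ wtSum f S) :
    v ∈ wtSum (restrictFamily f N hN) S := by
  have hs : ∀ ω (v : N), N.subtype (restrictFamily f N hN ω v) = f ω (N.subtype v) :=
    coe_restrictFamily hN
  obtain ⟨x, hx, x', hx', rfl⟩ := exists_add_wtSum (restrictFamily_commute hf hN) S v
  have h1 : (x' : Z) ∈ wtSum f Sᶜ := map_mem_wtSum hs hx'
  have h2 : (x' : Z) ∈ wtSum f S := by
    have := Submodule.sub_mem _ hv (map_mem_wtSum hs hx)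
    rwa [Submodule.coe_add, Submodule.subtype_apply, add_sub_cancel_left] at this
  have h3 : x' = 0 := Subtype.ext (Submodule.disjoint_def.1 (isCompl_wtSum hf S).disjoint _ h2 h1)
  rwa [h3, add_zero]

/-- The set of the functionals `g l`, for `l ∈ S`. -/
def actSet (g : P.Aut) (S : Set (CartanDual X →ₗ[ℂ] ℂ)) : Set (CartanDual X →ₗ[ℂ] ℂ) :=
  {l | l ∘ₗ act P g ∈ S}

lemma comp_act_mem_actSet {g : P.Aut} {S : Set (CartanDual X →ₗ[ℂ] ℂ)} {l : CartanDual X →ₗ[ℂ] ℂ}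
    (hl : l ∈ S) : l ∘ₗ act P g⁻¹ ∈ actSet g S := by
  have : (l ∘ₗ act P g⁻¹) ∘ₗ act P g = l := LinearMap.ext fun ω => by simp [act_inv_act]
  rwa [actSet, Set.mem_ofPred_eq, this]

lemma mem_wtSum_comp_act (π : HeckeAlg P Δ c →ₐ[ℂ] Module.End ℂ Z) (g : P.Aut)
    {S : Set (CartanDual X →ₗ[ℂ] ℂ)} {v : Z} (hv : v ∈ wtSum (opX π) S) :
    v ∈ wtSum (opX π ∘ₗ act P g⁻¹) (actSet g S) := by
  refine wtSum_mono ?_ (mem_wtSum_comp (act P g⁻¹) hv)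
  rintro _ ⟨l, hl, rfl⟩
  exact comp_act_mem_actSet hl

lemma r_mem_wtSum (π : HeckeAlg P Δ c →ₐ[ℂ] Module.End ℂ Z)
    {S : Set (CartanDual X →ₗ[ℂ] ℂ)} {v : Z} (hv : v ∈ wtSum (opX π) S) :
    π Alg.r v ∈ wtSum (opX π) S :=
  map_mem_wtSum (g := π Alg.r) (fun ω u => r_x_apply π ω u) hv

lemma x_mem_wtSum (π : HeckeAlg P Δ c →ₐ[ℂ] Module.End ℂ Z)
    {S : Set (CartanDual X →ₗ[ℂ] ℂ)} {v : Z} (ω) (hv : v ∈ wtSum (opX π) S) :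
    π (Alg.x ω) v ∈ wtSum (opX π) S :=
  apply_mem_wtSum (opX_commute π) ω hv

/-- A simple reflection `t_s` maps the weights in `S` to weights in `S ∪ s S`. -/
lemma t_simple_mem_wtSum [FiniteDimensional ℂ Z] (π : HeckeAlg P Δ c →ₐ[ℂ] Module.End ℂ Z) (d : Δ)
    {S : Set (CartanDual X →ₗ[ℂ] ℂ)} {v : Z} (hv : v ∈ wtSum (opX π) S) :
    π (Alg.t (simpleRefl P Δ d)) v ∈ wtSum (opX π) (S ∪ actSet (𝓈 P (d : ι)) S) := by
  have hinv : (𝓈 P (d : ι))⁻¹ = 𝓈 P (d : ι) := RootPairing.Equiv.reflection_inv P (d : ι)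
  -- On the subspace of the weights in `S`, the operator `t_s` intertwines `ω` and `s ω` modulo this
  -- subspace.
  have hv' := mem_wtSum_restrictFamily (opX_commute π) (N := wtSum (opX π) S)
    (fun ω (v : Z) hv => x_mem_wtSum π ω hv) ⟨v, hv⟩ hv
  have h3 := mem_wtSum_comp (act P (𝓈 P (d : ι))⁻¹) hv'
  rw [wtSum_union]
  refine map_mem_sup_wtSum (opX_commute π) (T := wtSum (opX π) S) (fun ω _ => x_mem_wtSum π ω)
    (g := π (Alg.t (simpleRefl P Δ d)) ∘ₗ (wtSum (opX π) S).subtype) (fun ω u => ?_)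
    (wtSum_mono ?_ h3)
  · have h := hecke_cross_apply π d ω (u : Z)
    change π (Alg.x ω) (π (Alg.t (simpleRefl P Δ d)) (u : Z)) -
      π (Alg.t (simpleRefl P Δ d)) (π (Alg.x (act P (𝓈 P (d : ι))⁻¹ ω)) (u : Z)) ∈ _
    rw [h, hinv, add_sub_cancel_left]
    exact Submodule.smul_mem _ _ (r_mem_wtSum π u.2)
  · rintro _ ⟨l, hl, rfl⟩
    exact comp_act_mem_actSet hl

/-- The imaginary part of a functional on `𝔥^*`. -/
def imHom (l : CartanDual X →ₗ[ℂ] ℂ) : X →+ ℝ where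
  toFun x := (l (1 ⊗ₜ x)).im
  map_zero' := by simp
  map_add' x y := by simp [TensorProduct.tmul_add]

lemma imHom_apply (l : CartanDual X →ₗ[ℂ] ℂ) (x : X) : imHom l x = (l (1 ⊗ₜ x)).im := rfl

lemma imHom_comp_act (l : CartanDual X →ₗ[ℂ] ℂ) (g : P.Aut) (x : X) :
    imHom (l ∘ₗ act P g) x = imHom l (g • x) := by
  rw [imHom_apply, imHom_apply, LinearMap.comp_apply, act_tmul]

/-- A set of functionals that is determined by a condition on imaginary parts. -/
def IsImSaturated (S : Set (CartanDual X →ₗ[ℂ] ℂ)) : Prop :=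
  ∀ l ∈ S, ∀ l', imHom l' = imHom l → l' ∈ S

/-- If `S` and `s S` are disjoint, then `t_s` maps no nonzero combination of vectors with weights
in `S` to another one: for an eigenvector of weight `λ`, this would force `λ(α) = ± c_α r`, which
is real, so that `λ` and `s λ` have the same imaginary part. -/
lemma eq_zero_of_t_simple_mem [FiniteDimensional ℂ Z] {π : HeckeAlg P Δ c →ₐ[ℂ] Module.End ℂ Z}
    (hreal : HasRealParameter π) {S : Set (CartanDual X →ₗ[ℂ] ℂ)} (hS : IsImSaturated S) (d : Δ)
    (hdisj : Disjoint S (actSet (𝓈 P (d : ι)) S)) {a : Z} (ha : a ∈ wtSum (opX π) S)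
    (hta : π (Alg.t (simpleRefl P Δ d)) a ∈ wtSum (opX π) S) : a = 0 := by
  set s := 𝓈 P (d : ι)
  set T := π (Alg.t (simpleRefl P Δ d))
  have hTT : ∀ z, T (T z) = z := fun z => by
    rw [t_t_apply, simpleRefl_mul_self, t_one_apply]
  obtain ⟨r₀, hr₀⟩ := hreal
  by_contra ha0
  -- The vectors of the `S`-part that `t_s` maps to the `S`-part form a stable subspace, so that `a`
  -- may be replaced by an eigenvector `z`, of some weight `l`.
  set N : Submodule ℂ Z := wtSum (opX π) S ⊓ (wtSum (opX π) S).comap T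
  have hN : ∀ (ω : CartanDual X), ∀ v ∈ N, opX π ω v ∈ N := by
    rintro ω v ⟨hv, hv'⟩
    refine ⟨x_mem_wtSum π ω hv, ?_⟩
    have h := hecke_cross_apply π d (act P s ω) v
    rw [act_reflection_act_reflection] at h
    have h' := eq_sub_of_add_eq h.symm
    change T (π (Alg.x ω) v) ∈ wtSum (opX π) S
    rw [h']
    exact Submodule.sub_mem _ (x_mem_wtSum π _ hv') (Submodule.smul_mem _ _ (r_mem_wtSum π hv))
  obtain ⟨l, hl, z, hz, hz0, hlz⟩ := exists_eigenvector (opX_commute π) (N := N) hN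
    ((Submodule.ne_bot_iff N).2 ⟨a, ⟨ha, hta⟩, ha0⟩) (S := S) inf_le_left
  have hlz' : ∀ ω, π (Alg.x ω) z = l ω • z := hlz
  have hsl : l ∘ₗ act P s ∉ S := by
    intro hcon
    refine Set.disjoint_left.1 hdisj hcon ?_
    change (l ∘ₗ act P s) ∘ₗ act P s ∈ S
    have : (l ∘ₗ act P s) ∘ₗ act P s = l :=
      LinearMap.ext fun ω => by simp [s, act_reflection_act_reflection]
    rwa [this]
  have hslω : ∀ ω, l (act P s ω) = l ω - cor P d ω * l (rootC P d) := fun ω => by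
    rw [act_reflection, map_sub, map_smul, smul_eq_mul]
  have hα : l (rootC P d) ≠ 0 := by
    intro h0
    apply hsl
    have : l ∘ₗ act P s = l := LinearMap.ext fun ω => by
      rw [LinearMap.comp_apply, hslω, h0, mul_zero, sub_zero]
    rwa [this]
  set k : ℂ := c d * r₀
  set μ : ℂ := k / l (rootC P d)
  have hμ : μ * l (rootC P d) = k := div_mul_cancel₀ _ hα
  -- The vector `y` has weight `s l`, which is not in `S`, and lies in the `S`-part; so `y = 0`, and
  -- `μ = ± 1` since `t_s` is an involution.
  set y := T z - μ • z with hy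
  have hyS : y ∈ wtSum (opX π) S := Submodule.sub_mem _ hz.2 (Submodule.smul_mem _ _ hz.1)
  have hyl : y ∈ wt (opX π) (l ∘ₗ act P s) := by
    rw [wt, Module.End.mem_iInf_maxGenEigenspace_iff]
    intro ω
    refine ⟨1, ?_⟩
    have h := hecke_cross_apply π d ω z
    have h1 : π (Alg.x ω) y = l (act P s ω) • y := by
      rw [hy, map_sub, map_smul, h, hlz', hlz', hr₀, map_smul, hslω,
        smul_smul _ (r₀ : ℂ), mul_right_comm,
        show (c d : ℂ) * r₀ = μ * l (rootC P d) from hμ.symm]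
      change _ • T z + _ - _ = _
      module
    rw [pow_one]
    change π (Alg.x ω) y - l (act P s ω) • y = 0
    rw [h1, sub_self]
  have hy0 : y = 0 := Submodule.disjoint_def.1
    (disjoint_wtSum (opX_commute π) (Set.disjoint_singleton_left.2 hsl)) _
      (wt_le_wtSum (Set.mem_singleton _) hyl) hyS
  have hTz : T z = μ • z := sub_eq_zero.1 hy0
  have hμ2 : μ * μ = 1 := by
    have h1 := hTT z
    rw [hTz, map_smul, hTz, smul_smul] at h1
    have h2 : (μ * μ - 1) • z = 0 := by rw [sub_smul, one_smul, h1, sub_self]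
    exact sub_eq_zero.1 ((smul_eq_zero.1 h2).resolve_right hz0)
  have him : (l (rootC P d)).im = 0 := by
    have hk : k.im = 0 := by simp [k]
    rcases mul_self_eq_one_iff.1 hμ2 with h | h
    · rw [h, one_mul] at hμ
      rw [hμ, hk]
    · rw [h, neg_one_mul] at hμ
      rw [← neg_eq_zero, ← Complex.neg_im, hμ, hk]
  apply hsl
  refine hS l hl _ (AddMonoidHom.ext fun x => ?_)
  rw [imHom_apply, imHom_apply, LinearMap.comp_apply, hslω, Complex.sub_im, sub_eq_self]
  have : cor P d ((1 : ℂ) ⊗ₜ x) = ((P.toLinearMap x (P.coroot d) : ℝ) : ℂ) := by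
    rw [cor_apply, corootC, pair_tmul]; simp
  rw [this, Complex.mul_im, him, Complex.ofReal_im, mul_zero, zero_mul, add_zero]

section Low

variable (b : P.Base) (π : HeckeAlg P (b.support : Set ι) c →ₐ[ℂ] Module.End ℂ Z)

/-- The span of the translates of `Q` by the elements `t_u` with `u` of length less than `n`. -/
def tLow (Q : Submodule ℂ Z) (n : ℕ) : Submodule ℂ Z :=
  ⨆ u : {u : weyl P (b.support : Set ι) // len b (u : P.Aut) < n}, Q.map (π (Alg.t u.1))

variable {b π}

lemma t_mem_tLow {Q : Submodule ℂ Z} {n : ℕ} {u : weyl P (b.support : Set ι)}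
    (hu : len b (u : P.Aut) < n) {v : Z} (hv : v ∈ Q) : π (Alg.t u) v ∈ tLow b π Q n :=
  Submodule.mem_iSup_of_mem
    (p := fun u : {u : weyl P (b.support : Set ι) // len b (u : P.Aut) < n} =>
      Q.map (π (Alg.t u.1))) ⟨u, hu⟩ (Submodule.mem_map_of_mem hv)

lemma tLow_le {Q N : Submodule ℂ Z} {n : ℕ} (h : ∀ u : weyl P (b.support : Set ι),
    len b (u : P.Aut) < n → ∀ v ∈ Q, π (Alg.t u) v ∈ N) : tLow b π Q n ≤ N :=
  iSup_le fun u => Submodule.map_le_iff_le_comap.2 (h u.1 u.2)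

lemma tLow_mono {Q : Submodule ℂ Z} {n m : ℕ} (h : n ≤ m) : tLow b π Q n ≤ tLow b π Q m :=
  tLow_le fun _ hu _ hv => t_mem_tLow (hu.trans_le h) hv

variable [Fintype ι] (hc : ∀ w ∈ weyl P (b.support : Set ι), ∀ i, c (w • i) = c i)

include hc

/-- The operator `t_g` intertwines the action of `𝔥^*` and its twist by `g` up to shorter
elements. -/
lemma x_t_sub_mem_tLow {Q : Submodule ℂ Z} (hr : ∀ v ∈ Q, π Alg.r v ∈ Q)
    (g : weyl P (b.support : Set ι)) (ω : CartanDual X) {v : Z} (hv : v ∈ Q) :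
    π (Alg.x ω) (π (Alg.t g) v) - π (Alg.t g) (π (Alg.x (act P (g : P.Aut)⁻¹ ω)) v) ∈
      tLow b π Q (len b (g : P.Aut)) := by
  rw [x_t_apply hc, add_sub_cancel_left]
  refine Submodule.sum_mem _ fun i _ => ?_
  by_cases hi : b.IsPos i ↔ b.IsPos ((g : P.Aut)⁻¹ • i)
  · rw [sgn_congr b hi, sub_self, zero_mul, zero_smul]
    exact Submodule.zero_mem _
  · refine Submodule.smul_mem _ _ (t_mem_tLow ?_ (hr v hv))
    rw [Subgroup.coe_mul, coe_reflW]
    by_cases hpos : b.IsPos i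
    · exact len_reflection_mul_lt b g.2 hpos fun h => hi ⟨fun _ => h, fun _ => hpos⟩
    · rw [← opp_eq_reflection_iff]
      refine len_reflection_mul_lt b g.2 ((isPos_opp b i).2 hpos) fun h => hi ?_
      rw [smul_opp, isPos_opp] at h
      exact ⟨fun h' => absurd h' hpos, fun h' => absurd h' h⟩

/-- The translates by shorter elements span a subspace that is stable under `𝔥^*`. -/
lemma x_mem_tLow {Q : Submodule ℂ Z} (hr : ∀ v ∈ Q, π Alg.r v ∈ Q)
    (hx : ∀ ω, ∀ v ∈ Q, π (Alg.x ω) v ∈ Q) (n : ℕ) (ω : CartanDual X) :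
    ∀ v ∈ tLow b π Q n, π (Alg.x ω) v ∈ tLow b π Q n := by
  refine tLow_le (N := (tLow b π Q n).comap (π (Alg.x ω))) fun u hu v hv => ?_
  rw [Submodule.mem_comap, ← sub_add_cancel (π (Alg.x ω) (π (Alg.t u) v))]
  exact Submodule.add_mem _ (tLow_mono hu.le (x_t_sub_mem_tLow hc hr u ω hv))
    (t_mem_tLow hu (hx _ v hv))

/-- Up to translates by shorter elements, `t_g` maps weights in `S` to weights in `g S`. -/
lemma t_mem_tLow_sup [FiniteDimensional ℂ Z] {Q : Submodule ℂ Z} (hr : ∀ v ∈ Q, π Alg.r v ∈ Q)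
    (hx : ∀ ω, ∀ v ∈ Q, π (Alg.x ω) v ∈ Q) {S : Set (CartanDual X →ₗ[ℂ] ℂ)}
    (g : weyl P (b.support : Set ι)) {v : Z} (hv : v ∈ Q) (hvS : v ∈ wtSum (opX π) S) :
    π (Alg.t g) v ∈ tLow b π Q (len b (g : P.Aut)) ⊔ wtSum (opX π) (actSet (g : P.Aut) S) := by
  have hv' := mem_wtSum_restrictFamily (opX_commute π) (N := Q) hx ⟨v, hv⟩ hvS
  refine map_mem_sup_wtSum (opX_commute π) (x_mem_tLow hc hr hx _)
    (g := π (Alg.t g) ∘ₗ Q.subtype) (fun ω u => x_t_sub_mem_tLow hc hr g ω u.2)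
    (wtSum_mono ?_ (mem_wtSum_comp (act P (g : P.Aut)⁻¹) hv'))
  rintro _ ⟨l, hl, rfl⟩
  exact comp_act_mem_actSet hl

end Low

end HeckeWeights

/-! ### Blocks of weights -/

section Blocks

variable {ι X Y : Type*} [AddCommGroup X] [AddCommGroup Y]
variable {P : RootPairing ι ℤ X Y} {κ : X →+ ℝ} {Δ : Set ι} {c : ι → ℕ}
variable {Z : Type*} [AddCommGroup Z] [Module ℂ Z]

variable (κ Δ) in
/-- The functionals whose imaginary part lies in `u W_Δ κ`. -/
def blk (u : P.Aut) : Set (CartanDual X →ₗ[ℂ] ℂ) :=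
  {l | ∃ h ∈ weyl P Δ, ∀ x, imHom l x = κ ((u * h)⁻¹ • x)}

lemma isImSaturated_blk (u : P.Aut) : IsImSaturated (blk κ Δ u) := by
  rintro l ⟨h, hh, hl⟩ l' hl'
  exact ⟨h, hh, fun x => by rw [hl', hl]⟩

lemma actSet_blk (g u : P.Aut) : actSet g (blk κ Δ u) = blk κ Δ (g * u) := by
  ext l
  constructor
  · rintro ⟨h, hh, hl⟩
    refine ⟨h, hh, fun x => ?_⟩
    have := hl (g⁻¹ • x)
    rw [imHom_comp_act, smul_inv_smul] at this
    rw [this, ← mul_smul, mul_assoc g, mul_inv_rev g]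
  · rintro ⟨h, hh, hl⟩
    refine ⟨h, hh, fun x => ?_⟩
    rw [imHom_comp_act, hl, ← mul_smul, mul_assoc g, mul_inv_rev g, inv_mul_cancel_right]

lemma blk_mul (u : P.Aut) {g : P.Aut} (hg : g ∈ weyl P Δ) : blk κ Δ (u * g) = blk κ Δ u := by
  ext l
  constructor
  · rintro ⟨h, hh, hl⟩
    exact ⟨g * h, mul_mem hg hh, fun x => by rw [hl, mul_assoc]⟩
  · rintro ⟨h, hh, hl⟩
    exact ⟨g⁻¹ * h, mul_mem (inv_mem hg) hh, fun x => by rw [hl]; congr 2; group⟩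

variable (b : P.Base)

variable (Δ) in
/-- An element of minimal length in its coset for the Weyl group of a subsystem. -/
def IsShortest (u : P.Aut) : Prop := ∀ h ∈ weyl P Δ, len b u ≤ len b (u * h)

variable (κ Δ) in
/-- The union of the blocks attached to the elements of length less than `n`. -/
def blkLow (n : ℕ) : Set (CartanDual X →ₗ[ℂ] ℂ) :=
  {l | ∃ u ∈ weyl P (b.support : Set ι), len b u < n ∧ l ∈ blk κ Δ u}

variable (κ Δ) in
/-- The union of all the blocks. -/
def blkAll : Set (CartanDual X →ₗ[ℂ] ℂ) :=
  {l | ∃ u ∈ weyl P (b.support : Set ι), l ∈ blk κ Δ u}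

variable {b}

lemma actSet_simple_blkLow {d : ι} (hd : d ∈ b.support) (n : ℕ) :
    actSet (𝓈 P d) (blkLow κ Δ b n) ⊆ blkLow κ Δ b (n + 1) := by
  rintro l ⟨u, hu, hlen, hl⟩
  have hs : 𝓈 P d ∈ weyl P (b.support : Set ι) := Subgroup.subset_closure ⟨d, hd, rfl⟩
  refine ⟨𝓈 P d * u, mul_mem hs hu, (len_simple_mul_le b hd hu).trans_lt (by omega), ?_⟩
  rw [← actSet_blk]
  exact hl

lemma actSet_simple_blkAll {d : ι} (hd : d ∈ b.support) :
    actSet (𝓈 P d) (blkAll κ Δ b) ⊆ blkAll κ Δ b := by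
  rintro l ⟨u, hu, hl⟩
  have hs : 𝓈 P d ∈ weyl P (b.support : Set ι) := Subgroup.subset_closure ⟨d, hd, rfl⟩
  refine ⟨𝓈 P d * u, mul_mem hs hu, ?_⟩
  rw [← actSet_blk]
  exact hl

/-- Different blocks are disjoint when the stabilizer of `κ` is contained in the Weyl group of the
subsystem. -/
lemma inv_mul_mem_of_not_disjoint
    (hκ : ∀ g ∈ weyl P (b.support : Set ι), (∀ x, κ (g • x) = κ x) → g ∈ weyl P Δ) [Finite ι]
    {u u' : P.Aut} (hu : u ∈ weyl P (b.support : Set ι)) (hu' : u' ∈ weyl P (b.support : Set ι))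
    (h : ¬ Disjoint (blk κ Δ u) (blk κ Δ u')) : u⁻¹ * u' ∈ weyl P Δ := by
  have := Fintype.ofFinite ι
  obtain ⟨l, ⟨h, hh, hl⟩, ⟨h', hh', hl'⟩⟩ := Set.not_disjoint_iff.1 h
  have key : (u * h)⁻¹ * (u' * h') ∈ weyl P Δ := by
    refine hκ _ (mul_mem (inv_mem (mul_mem hu (weyl_le b Δ hh))) (mul_mem hu' (weyl_le b Δ hh')))
      fun x => ?_
    rw [mul_smul, ← hl, hl', inv_smul_smul]
  have e : u⁻¹ * u' = h * ((u * h)⁻¹ * (u' * h')) * h'⁻¹ := by group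
  rw [e]
  exact mul_mem (mul_mem hh key) (inv_mem hh')

section

variable [Fintype ι]
  (hκ : ∀ g ∈ weyl P (b.support : Set ι), (∀ x, κ (g • x) = κ x) → g ∈ weyl P Δ)

include hκ

/-- The block of an element that is shortest in its coset is disjoint from the blocks of all shorter
elements. -/
lemma blkLow_subset_compl {u : P.Aut} (hu : u ∈ weyl P (b.support : Set ι))
    (hmin : IsShortest Δ b u) : blkLow κ Δ b (len b u) ⊆ (blk κ Δ u)ᶜ := by
  rintro l ⟨u', hu', hlen, hl⟩ hlu
  have h1 := inv_mul_mem_of_not_disjoint hκ hu hu' (Set.not_disjoint_iff.2 ⟨l, hlu, hl⟩)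
  have := hmin _ h1
  rw [mul_inv_cancel_left] at this
  omega

variable [FiniteDimensional ℂ Z] {π : HeckeAlg P (b.support : Set ι) c →ₐ[ℂ] Module.End ℂ Z}
  (hc : ∀ w ∈ weyl P (b.support : Set ι), ∀ i, c (w • i) = c i)

omit hκ in
include hc in
/-- The weights of `t_u v`, for a vector `v` with weights in the first block, lie in the block of
`u` and in blocks of shorter elements. -/
lemma t_mem_wtSum_blk {v : Z} (hv : v ∈ wtSum (opX π) (blk κ Δ (1 : P.Aut)))
    (u : weyl P (b.support : Set ι)) : π (Alg.t u) v ∈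
      wtSum (opX π) (blk κ Δ (u : P.Aut) ∪ blkLow κ Δ b (len b (u : P.Aut))) := by
  have key : ∀ n, ∀ u : weyl P (b.support : Set ι), len b (u : P.Aut) < n →
      ∀ v ∈ wtSum (opX π) (blk κ Δ (1 : P.Aut)), π (Alg.t u) v ∈
        wtSum (opX π) (blk κ Δ (u : P.Aut) ∪ blkLow κ Δ b (len b (u : P.Aut))) := by
    intro n
    induction n with
    | zero => intro u hu; omega
    | succ n ih =>
      intro u hu v hv
      have h1 := t_mem_tLow_sup hc (Q := wtSum (opX π) (blk κ Δ (1 : P.Aut)))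
        (fun v => r_mem_wtSum π) (fun ω v => x_mem_wtSum π ω) u hv hv
      rw [actSet_blk, mul_one] at h1
      refine sup_le (tLow_le fun u' hu' v hv => wtSum_mono ?_ (ih u' (by omega) v hv))
        (wtSum_mono Set.subset_union_left) h1
      refine Set.union_subset (fun l hl => Or.inr ⟨u', u'.2, hu', hl⟩) ?_
      rintro l ⟨u'', hu'', hlen, hl⟩
      exact Or.inr ⟨u'', hu'', hlen.trans hu', hl⟩
  exact key _ u (Nat.lt_succ_self _) v hv

include hc

/-- If `u` is shortest in its coset, the component of `t_u v` in the block of `u` determines `v`. -/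
lemma eq_zero_of_t_mem_wtSum_compl (hreal : HasRealParameter π)
    (u : weyl P (b.support : Set ι)) (hmin : IsShortest Δ b (u : P.Aut)) {v : Z}
    (hv : v ∈ wtSum (opX π) (blk κ Δ (1 : P.Aut)))
    (hu : π (Alg.t u) v ∈ wtSum (opX π) (blk κ Δ (u : P.Aut))ᶜ) : v = 0 := by
  have hcomm := opX_commute π
  -- Induction on the length: for `u = s u'` and `a` the component of `t_{u'} v` in the block of
  -- `u'`, the vector `t_s a` has no component in the block of `u`, so that `a = 0` by
  -- `eq_zero_of_t_simple_mem`.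
  have key : ∀ n, ∀ u : weyl P (b.support : Set ι), len b (u : P.Aut) = n →
      IsShortest Δ b (u : P.Aut) →
      π (Alg.t u) v ∈ wtSum (opX π) (blk κ Δ (u : P.Aut))ᶜ → v = 0 := by
    intro n
    induction n with
    | zero =>
      intro u hlen hmin hu
      have hu1 : u = 1 := by
        by_contra hne
        obtain ⟨d, -, -, h⟩ := exists_descent b u.2 (fun h => hne (Subtype.ext h))
        omega
      subst hu1
      rw [t_one_apply] at hu
      exact Submodule.disjoint_def.1 (isCompl_wtSum hcomm _).disjoint _ hv hu
    | succ n ih =>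
      intro u hlen hmin hu
      have hne : (u : P.Aut) ≠ 1 := by
        intro h
        rw [h, len_one] at hlen
        omega
      obtain ⟨d, hd, -, hlen'⟩ := exists_descent b u.2 hne
      set s := simpleRefl P (b.support : Set ι) ⟨d, hd⟩ with hs
      have hss : s * s = 1 := simpleRefl_mul_self _
      set u' := s * u with hu'
      have hcoe : (u' : P.Aut) = 𝓈 P d * u := rfl
      have hn : len b (u' : P.Aut) = n := by rw [hcoe]; omega
      have hsu : 𝓈 P d * (u' : P.Aut) = u := by
        rw [hcoe, ← mul_assoc, reflection_mul_self, one_mul]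
      have hmin' : IsShortest Δ b (u' : P.Aut) := by
        intro h hh
        have h1 := hmin h hh
        have h2 := len_simple_mul_le b hd (mul_mem u'.2 (weyl_le b Δ hh))
        rw [← mul_assoc, hsu] at h2
        omega
      have htu : π (Alg.t s) (π (Alg.t u') v) = π (Alg.t u) v := by
        rw [t_t_apply, hu', ← mul_assoc, hss, one_mul]
      refine ih u' hn hmin' ?_
      have h1 := t_mem_wtSum_blk (κ := κ) (Δ := Δ) hc hv u'
      rw [wtSum_union] at h1
      obtain ⟨a, ha, a', ha', hsum⟩ := Submodule.mem_sup.1 h1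
      have hta' : π (Alg.t s) a' ∈ wtSum (opX π) (blk κ Δ (u : P.Aut))ᶜ := by
        refine wtSum_mono ?_ (t_simple_mem_wtSum π ⟨d, hd⟩ ha')
        refine Set.Subset.trans ?_ (blkLow_subset_compl hκ u.2 hmin)
        refine Set.union_subset ?_ ((actSet_simple_blkLow hd _).trans ?_)
        · rintro l ⟨x, hx, hlx, hl⟩
          exact ⟨x, hx, by omega, hl⟩
        · rw [hn, hlen]
      have hta : π (Alg.t s) a ∈ wtSum (opX π) (blk κ Δ (u' : P.Aut)) := by
        have h2 : π (Alg.t s) a ∈ wtSum (opX π) (blk κ Δ (u : P.Aut))ᶜ := by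
          have h3 : π (Alg.t s) a = π (Alg.t u) v - π (Alg.t s) a' := by
            rw [← htu, ← hsum, map_add, add_sub_cancel_right]
          rw [h3]
          exact Submodule.sub_mem _ hu hta'
        have h3 := t_simple_mem_wtSum π ⟨d, hd⟩ ha
        rw [actSet_blk, hsu] at h3
        refine wtSum_mono ?_ (mem_wtSum_inter hcomm h3 h2)
        rintro l ⟨hl | hl, hl'⟩
        · exact hl
        · exact absurd hl hl'
      have ha0 : a = 0 := by
        refine eq_zero_of_t_simple_mem hreal (isImSaturated_blk (u' : P.Aut)) ⟨d, hd⟩ ?_ ha hta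
        rw [actSet_blk, hsu]
        by_contra hcon
        have h2 := inv_mul_mem_of_not_disjoint hκ u.2 u'.2 (fun h => hcon h.symm)
        have h3 := hmin _ h2
        rw [mul_inv_cancel_left] at h3
        omega
      rw [← hsum, ha0, zero_add]
      exact wtSum_mono (blkLow_subset_compl hκ u'.2 hmin') ha'
  exact key _ u rfl hmin hu

omit hc in
/-- A nonzero submodule meets the weight spaces of every block. -/
lemma exists_mem_blk (hreal : HasRealParameter π) (hall : wtSum (opX π) (blkAll κ Δ b) = ⊤)
    {N : Submodule ℂ Z} (hN : IsStable π N) (hne : N ≠ ⊥) (w : weyl P (b.support : Set ι)) :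
    ∃ v ∈ N, v ≠ 0 ∧ v ∈ wtSum (opX π) (blk κ Δ (w : P.Aut)) := by
  have hcomm := opX_commute π
  have hNx : ∀ ω : CartanDual X, ∀ v ∈ N, opX π ω v ∈ N := fun ω v hv => hN _ v hv
  obtain ⟨l, ⟨u, hu, hl⟩, v, hv, hv0, hvl⟩ := exists_eigenvector hcomm hNx hne
    (S := blkAll κ Δ b) (by rw [hall]; exact le_top)
  have hstart : ∃ v ∈ N, v ≠ 0 ∧ v ∈ wtSum (opX π) (blk κ Δ u) := by
    refine ⟨v, hv, hv0, wt_le_wtSum hl ?_⟩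
    rw [wt, Module.End.mem_iInf_maxGenEigenspace_iff]
    exact fun ω => ⟨1, by rw [pow_one]; change opX π ω v - l ω • v = 0; rw [hvl, sub_self]⟩
  -- A simple reflection that changes the block carries a nonzero vector to one with nonzero
  -- component in the reflected block, and this component belongs to `N`.
  have key : ∀ x : weyl P (b.support : Set ι),
      ∃ v ∈ N, v ≠ 0 ∧ v ∈ wtSum (opX π) (blk κ Δ ((x : P.Aut) * u)) := by
    intro x
    refine weyl_induction (p := fun x : weyl P (b.support : Set ι) =>
      ∃ v ∈ N, v ≠ 0 ∧ v ∈ wtSum (opX π) (blk κ Δ ((x : P.Aut) * u))) ?_ (fun d x ih => ?_) x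
    · rw [Subgroup.coe_one, one_mul]
      exact hstart
    obtain ⟨v, hv, hv0, hvS⟩ := ih
    have hcoe :
        ((simpleRefl P (b.support : Set ι) d * x : weyl P (b.support : Set ι)) : P.Aut) * u =
          𝓈 P (d : ι) * ((x : P.Aut) * u) := mul_assoc _ _ _
    rw [hcoe]
    by_cases hd : Disjoint (blk κ Δ ((x : P.Aut) * u)) (blk κ Δ (𝓈 P (d : ι) * ((x : P.Aut) * u)))
    · have h1 := t_simple_mem_wtSum π d hvS
      rw [actSet_blk, wtSum_union] at h1
      obtain ⟨p, hp, q, hq, hsum⟩ := Submodule.mem_sup.1 h1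
      refine ⟨q, ?_, fun hq0 => hv0 ?_, hq⟩
      · refine mem_of_add_mem hcomm hNx hq (wtSum_mono ?_ hp) (a' := p) ?_
        · exact fun l hl hl' => Set.disjoint_left.1 hd hl hl'
        · rw [add_comm, hsum]; exact hN _ v hv
      · rw [hq0, add_zero] at hsum
        refine eq_zero_of_t_simple_mem hreal (isImSaturated_blk _) d ?_ hvS (hsum ▸ hp)
        rwa [actSet_blk]
    · have hxu : (x : P.Aut) * u ∈ weyl P (b.support : Set ι) := mul_mem x.2 hu
      have h1 := inv_mul_mem_of_not_disjoint hκ hxu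
        (mul_mem (reflection_mem_weyl_support b (d : ι)) hxu) hd
      refine ⟨v, hv, hv0, ?_⟩
      rwa [← blk_mul _ h1, mul_inv_cancel_left] at hvS
  have := key (w * ⟨u, hu⟩⁻¹)
  rwa [Subgroup.coe_mul, Subgroup.coe_inv, inv_mul_cancel_right] at this

omit hκ hc [Fintype ι] in
/-- A module generated by vectors with weights in the blocks has all its weights in the blocks. -/
lemma wtSum_blkAll_eq_top {Q : Submodule ℂ Z} (hspan : tSpan π Q = ⊤)
    (hQ : Q ≤ wtSum (opX π) (blkAll κ Δ b)) : wtSum (opX π) (blkAll κ Δ b) = ⊤ := by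
  rw [eq_top_iff, ← hspan]
  refine tSpan_le fun w v hv => ?_
  refine weyl_induction (p := fun w => π (Alg.t w) v ∈ wtSum (opX π) (blkAll κ Δ b)) ?_
    (fun d w ih => ?_) w
  · rw [t_one_apply]; exact hQ hv
  · rw [← t_t_apply]
    exact wtSum_mono (Set.union_subset subset_rfl (actSet_simple_blkAll d.2))
      (t_simple_mem_wtSum π d ih)

/-- In a module that is generated by a subspace `Q` with weights in the block of `w`, which is
stable under the subalgebra attached to `w Δ`, the subspace `Q` is the sum of the weight spaces for
this block. -/
lemma wtSum_blk_le {w : P.Aut} (hw : w ∈ weyl P (b.support : Set ι)) {Q : Submodule ℂ Z}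
    (hr : ∀ v ∈ Q, π Alg.r v ∈ Q) (hx : ∀ ω, ∀ v ∈ Q, π (Alg.x ω) v ∈ Q)
    (ht : ∀ g : weyl P (b.support : Set ι), w⁻¹ * g * w ∈ weyl P Δ → ∀ v ∈ Q, π (Alg.t g) v ∈ Q)
    (hspan : tSpan π Q = ⊤) (hQ : Q ≤ wtSum (opX π) (blk κ Δ w)) :
    wtSum (opX π) (blk κ Δ w) ≤ Q := by
  -- Up to translates by shorter elements, `t_g` maps `Q` to the block of `g w`, which differs from
  -- the block of `w` unless `t_g` preserves `Q`.
  have key : ∀ n, ∀ g : weyl P (b.support : Set ι), len b (g : P.Aut) < n → ∀ v ∈ Q,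
      π (Alg.t g) v ∈ Q ⊔ wtSum (opX π) (blk κ Δ w)ᶜ := by
    intro n
    induction n with
    | zero => intro g hg; omega
    | succ n ih =>
      intro g hg v hv
      by_cases hgw : w⁻¹ * g * w ∈ weyl P Δ
      · exact Submodule.mem_sup_left (ht g hgw v hv)
      · have h1 := t_mem_tLow_sup hc hr hx g hv (hQ hv)
        refine sup_le (tLow_le fun u hu v hv => ih u (by omega) v hv)
          (le_trans (wtSum_mono ?_) le_sup_right) h1
        rw [actSet_blk]
        intro l hl hl'
        apply hgw
        rw [mul_assoc]
        exact inv_mul_mem_of_not_disjoint hκ hw (mul_mem g.2 hw)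
          (Set.not_disjoint_iff.2 ⟨l, hl', hl⟩)
  intro y hy
  have h1 : y ∈ Q ⊔ wtSum (opX π) (blk κ Δ w)ᶜ := by
    have : tSpan π Q ≤ Q ⊔ wtSum (opX π) (blk κ Δ w)ᶜ :=
      tSpan_le fun g v hv => key _ g (Nat.lt_succ_self _) v hv
    exact this (hspan ▸ Submodule.mem_top)
  obtain ⟨q, hq, y', hy', hsum⟩ := Submodule.mem_sup.1 h1
  have h2 : y' = 0 := by
    refine Submodule.disjoint_def.1 (isCompl_wtSum (opX_commute π) (blk κ Δ w)).disjoint _ ?_ hy'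
    have := Submodule.sub_mem _ hy (hQ hq)
    rwa [← hsum, add_sub_cancel_left] at this
  rw [← hsum, h2, add_zero]
  exact hq

end

end Blocks

/-! ### Comparison of induced modules -/

section Projection

variable {E V : Type*} [AddCommGroup E] [Module ℂ E] [AddCommGroup V] [Module ℂ V]
  [FiniteDimensional ℂ V] {f : E →ₗ[ℂ] Module.End ℂ V} (hf : ∀ ω ω', Commute (f ω) (f ω'))
  (S : Set (E →ₗ[ℂ] ℂ))

/-- The projection to the sum of the weight spaces for the weights in `S`. -/
def wtProj : V →ₗ[ℂ] V := (wtSum f S).projection (wtSum f Sᶜ) (isCompl_wtSum hf S)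

lemma wtProj_mem (v : V) : wtProj hf S v ∈ wtSum f S := Submodule.projection_apply_mem _ v

lemma sub_wtProj_mem (v : V) : v - wtProj hf S v ∈ wtSum f Sᶜ := Submodule.sub_projection_mem _ v

variable {S}

lemma wtProj_of_mem {v : V} (hv : v ∈ wtSum f S) : wtProj hf S v = v :=
  Submodule.projection_apply_of_mem_left _ hv

lemma wtProj_of_mem_compl {v : V} (hv : v ∈ wtSum f Sᶜ) : wtProj hf S v = 0 :=
  (Submodule.projection_apply_eq_zero_iff _).2 hv

lemma wtProj_comm {g : V →ₗ[ℂ] V} (h1 : ∀ v ∈ wtSum f S, g v ∈ wtSum f S)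
    (h2 : ∀ v ∈ wtSum f Sᶜ, g v ∈ wtSum f Sᶜ) (v : V) : wtProj hf S (g v) = g (wtProj hf S v) := by
  have h3 : g v = g (wtProj hf S v) + g (v - wtProj hf S v) := by rw [← map_add]; congr 1; abel
  rw [h3, map_add, wtProj_of_mem hf (h1 _ (wtProj_mem hf S v)),
    wtProj_of_mem_compl hf (h2 _ (sub_wtProj_mem hf S v)), add_zero]

end Projection

section Representations

variable {A B : Type*} [Ring A] [Algebra ℂ A] [Ring B] [Algebra ℂ B]
variable {V V' V'' : Type*} [AddCommGroup V] [Module ℂ V] [AddCommGroup V'] [Module ℂ V']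
  [AddCommGroup V''] [Module ℂ V'']
variable {ρ : A →ₐ[ℂ] Module.End ℂ V} {ρ' : A →ₐ[ℂ] Module.End ℂ V'}
  {ρ'' : A →ₐ[ℂ] Module.End ℂ V''}

lemma AreIsomorphic.symm (h : AreIsomorphic ρ ρ') : AreIsomorphic ρ' ρ := by
  obtain ⟨e, he⟩ := h
  exact ⟨e.symm, fun a v => e.injective (by rw [he, e.apply_symm_apply, e.apply_symm_apply])⟩

lemma AreIsomorphic.trans (h : AreIsomorphic ρ ρ') (h' : AreIsomorphic ρ' ρ'') :
    AreIsomorphic ρ ρ'' := by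
  obtain ⟨e, he⟩ := h
  obtain ⟨e', he'⟩ := h'
  exact ⟨e.trans e', fun a v => by simp [he, he']⟩

/-- A surjective homomorphism whose kernel is the radical induces an isomorphism. -/
lemma areIsomorphic_of_ker_eq_radical (F : V →ₗ[ℂ] V') (hF : ∀ a v, F (ρ a v) = ρ' a (F v))
    (hsurj : Function.Surjective F) (hker : LinearMap.ker F = radical ρ) :
    AreIsomorphic (irreducibleQuotient ρ) ρ' := by
  refine ⟨(Submodule.quotEquivOfEq _ _ hker.symm).trans (F.quotKerEquivOfSurjective hsurj),
    fun a v => ?_⟩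
  obtain ⟨v, rfl⟩ := (radical ρ).mkQ_surjective v
  exact hF a v

lemma isStable_map {F : V →ₗ[ℂ] V'} (hF : ∀ a v, F (ρ a v) = ρ' a (F v)) {N : Submodule ℂ V}
    (hN : IsStable ρ N) : IsStable ρ' (N.map F) := by
  rintro a _ ⟨v, hv, rfl⟩
  exact ⟨ρ a v, hN a v hv, hF a v⟩

/-- An isomorphism maps the radical into the radical. -/
lemma comap_radical_le (e : V ≃ₗ[ℂ] V') (he : ∀ a v, e (ρ a v) = ρ' a (e v)) :
    radical ρ ≤ (radical ρ').comap (e : V →ₗ[ℂ] V') := by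
  refine sSup_le fun N hN v hv => ?_
  have h : N.map (e : V →ₗ[ℂ] V') ≤ radical ρ' := by
    refine le_sSup ⟨isStable_map (F := (e : V →ₗ[ℂ] V')) he hN.1, fun htop => hN.2 ?_⟩
    rw [eq_top_iff]
    intro v _
    obtain ⟨v', hv', hvv⟩ : e v ∈ N.map (e : V →ₗ[ℂ] V') := htop ▸ Submodule.mem_top
    rwa [← e.injective hvv]
  exact h ⟨v, hv, rfl⟩

lemma AreIsomorphic.irreducibleQuotient (h : AreIsomorphic ρ ρ') :
    AreIsomorphic (irreducibleQuotient ρ) (irreducibleQuotient ρ') := by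
  obtain ⟨e, he⟩ := h
  refine areIsomorphic_of_ker_eq_radical ((radical ρ').mkQ ∘ₗ (e : V →ₗ[ℂ] V')) (fun a v => ?_)
    ((radical ρ').mkQ_surjective.comp e.surjective) ?_
  · rw [LinearMap.comp_apply, LinearEquiv.coe_coe, he]; rfl
  · rw [LinearMap.ker_comp, Submodule.ker_mkQ]
    refine le_antisymm (fun v hv => ?_) (comap_radical_le e he)
    have := comap_radical_le e.symm (ρ := ρ') (ρ' := ρ)
      (fun a v => e.injective (by rw [he, e.apply_symm_apply, e.apply_symm_apply])) hv
    simpa using this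

/-- The radical does not change when the action is pulled back along a surjection of algebras. -/
lemma radical_comp (f : B →ₐ[ℂ] A) (hf : Function.Surjective f) :
    radical (ρ.comp f) = radical ρ := by
  have h : ∀ N, IsStable (ρ.comp f) N ↔ IsStable ρ N := by
    intro N
    constructor
    · intro h a v hv
      obtain ⟨a, rfl⟩ := hf a
      exact h a v hv
    · exact fun h a v hv => h (f a) v hv
  simp only [radical, h]

end Representations

section Induction

variable {ι X Y : Type*} [AddCommGroup X] [AddCommGroup Y]
variable {P : RootPairing ι ℤ X Y} {κ : X →+ ℝ} {Δ₀ Δ Δ' : Set ι} {c : ι → ℕ} {b : P.Base}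
variable {V U Z : Type*} [AddCommGroup V] [Module ℂ V] [AddCommGroup U] [Module ℂ U]
  [AddCommGroup Z] [Module ℂ Z]

lemma r_comm_apply (π : HeckeAlg P Δ c →ₐ[ℂ] Module.End ℂ Z) (a) (v : Z) :
    π Alg.r (π a v) = π a (π Alg.r v) :=
  (intertwines_of_generators (ρ := π) (ρ' := π) (φ := π Alg.r) (fun w v => r_t_apply π w v)
    (fun _ => rfl) (fun ω v => r_x_apply π ω v) a v)

lemma hasRealParameter_inducedRep {ρ : HeckeAlg P Δ c →ₐ[ℂ] Module.End ℂ U}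
    (h : HasRealParameter ρ) (j : HeckeAlg P Δ c →ₐ[ℂ] HeckeAlg P Δ' c) (hj : j Alg.r = Alg.r) :
    HasRealParameter (inducedRep j ρ) := by
  obtain ⟨r₀, hr₀⟩ := h
  refine ⟨r₀, induced_induction (fun a v => ?_) fun x y hx hy => ?_⟩
  · rw [r_comm_apply]
    nth_rewrite 1 [← hj]
    rw [inducedRep_apply_indOne, hr₀, map_smul, map_smul]
  · rw [map_add, hx, hy, smul_add]

/-- The inducing module contributes to the block of `w` in the module induced through conjugation by
`w`. -/
lemma indOne_mem_wtSum {ρ : HeckeAlg P Δ c →ₐ[ℂ] Module.End ℂ U} {w : P.Aut}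
    (h : ∀ d ∈ Δ, w • d ∈ Δ') (hcw : ∀ i, c (w • i) = c i) {u : U}
    (hu : u ∈ wtSum (opX ρ) (blk κ Δ₀ (1 : P.Aut))) : indOne (conjHom P w h hcw) ρ u ∈
      wtSum (opX (inducedRep (conjHom P w h hcw) ρ)) (blk κ Δ₀ w) := by
  have h1 := mem_wtSum_comp_act ρ w hu
  rw [actSet_blk, mul_one] at h1
  refine map_mem_wtSum (g := indOne (conjHom P w h hcw) ρ) (fun ω u => ?_) h1
  rw [LinearMap.comp_apply, opX_apply, opX_apply, ← inducedRep_x_indOne, act_act_inv]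

/-- A module of `ℍ_Δ` generated by vectors with weights in the first block has all its weights
there. -/
lemma wtSum_blk_one_eq_top [FiniteDimensional ℂ U] {ρ : HeckeAlg P Δ c →ₐ[ℂ] Module.End ℂ U}
    {Q : Submodule ℂ U} (hspan : tSpan ρ Q = ⊤)
    (hQ : Q ≤ wtSum (opX ρ) (blk κ Δ (1 : P.Aut))) : wtSum (opX ρ) (blk κ Δ (1 : P.Aut)) = ⊤ := by
  rw [eq_top_iff, ← hspan]
  refine tSpan_le fun w v hv => ?_
  refine weyl_induction (p := fun w => ρ (Alg.t w) v ∈ wtSum (opX ρ) (blk κ Δ (1 : P.Aut))) ?_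
    (fun d w ih => ?_) w
  · rw [t_one_apply]; exact hQ hv
  · rw [← t_t_apply]
    have h1 := t_simple_mem_wtSum ρ d ih
    have hd : 𝓈 P (d : ι) ∈ weyl P Δ := Subgroup.subset_closure ⟨d, d.2, rfl⟩
    have e : blk κ Δ (𝓈 P (d : ι) * 1) = blk κ Δ (1 : P.Aut) := by
      rw [mul_one, ← one_mul (𝓈 P (d : ι)), blk_mul _ hd]
    rwa [actSet_blk, e, Set.union_self] at h1

section

variable [Fintype ι] {w : P.Aut} (hw : IsStandardizing b Δ w)
  (hc : ∀ w ∈ weyl P (b.support : Set ι), ∀ i, c (w • i) = c i)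
  (hwW : w ∈ weyl P (b.support : Set ι)) (h : ∀ d ∈ Δ, w • d ∈ (b.support : Set ι))
  (hcw : ∀ i, c (w • i) = c i)
  (hκ : ∀ g ∈ weyl P (b.support : Set ι), (∀ x, κ (g • x) = κ x) → g ∈ weyl P Δ)

lemma finiteDimensional_induced [FiniteDimensional ℂ U] (ρ : HeckeAlg P Δ c →ₐ[ℂ] Module.End ℂ U) :
    FiniteDimensional ℂ (Induced (conjHom P w h hcw) ρ) := by
  have := finite_weyl b
  exact finiteDimensional_of_tSpan (tSpan_range_indOne hcw h)

include hc hwW hκ in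
/-- The sum of the weight spaces of an induced module for the block of `w` is the inducing
module. -/
lemma wtSum_blk_inducedRep_le [FiniteDimensional ℂ U] {ρ : HeckeAlg P Δ c →ₐ[ℂ] Module.End ℂ U}
    (hU : wtSum (opX ρ) (blk κ Δ (1 : P.Aut)) = ⊤) :
    wtSum (opX (inducedRep (conjHom P w h hcw) ρ)) (blk κ Δ w) ≤
      LinearMap.range (indOne (conjHom P w h hcw) ρ) := by
  have := finiteDimensional_induced h hcw ρ
  refine wtSum_blk_le hκ hc hwW ?_ ?_ ?_ (tSpan_range_indOne hcw h) ?_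
  · rintro _ ⟨u, rfl⟩
    exact ⟨_, (inducedRep_r_indOne h hcw u).symm⟩
  · rintro ω _ ⟨u, rfl⟩
    refine ⟨ρ (Alg.x (act P w⁻¹ ω)) u, ?_⟩
    rw [← inducedRep_x_indOne, act_act_inv]
  · rintro g hg _ ⟨u, rfl⟩
    refine ⟨ρ (Alg.t ⟨_, hg⟩) u, ?_⟩
    have e : (⟨w * (w⁻¹ * g * w) * w⁻¹, conj_mem_weyl P w h hg⟩ : weyl P (b.support : Set ι)) = g :=
      Subtype.ext (show w * (w⁻¹ * (g : P.Aut) * w) * w⁻¹ = g by group)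
    rw [← inducedRep_t_indOne h hcw]
    exact congrArg (fun x => inducedRep _ ρ (Alg.t x) (indOne _ ρ u)) e
  · rintro _ ⟨u, rfl⟩
    exact indOne_mem_wtSum h hcw (hU ▸ Submodule.mem_top)

/-- The homomorphism of induced modules defined by the passage to a quotient of the inducing
module. -/
def indQuotient {ρ : HeckeAlg P Δ c →ₐ[ℂ] Module.End ℂ U} (R : Submodule ℂ U)
    (ρq : HeckeAlg P Δ c →ₐ[ℂ] Module.End ℂ (U ⧸ R)) (hq : ∀ a u, ρq a (R.mkQ u) = R.mkQ (ρ a u)) :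
    Induced (conjHom P w h hcw) ρ →ₗ[ℂ] Induced (conjHom P w h hcw) ρq :=
  indLift (inducedRep (conjHom P w h hcw) ρq) (indOne (conjHom P w h hcw) ρq ∘ₗ R.mkQ)
    fun a v => by
      rw [LinearMap.comp_apply, LinearMap.comp_apply, inducedRep_apply_indOne, hq]

section

variable {ρ : HeckeAlg P Δ c →ₐ[ℂ] Module.End ℂ U} {R : Submodule ℂ U}
    {ρq : HeckeAlg P Δ c →ₐ[ℂ] Module.End ℂ (U ⧸ R)}
    (hq : ∀ a u, ρq a (R.mkQ u) = R.mkQ (ρ a u))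

omit [Fintype ι] in
lemma indQuotient_indOne (u : U) : indQuotient h hcw R ρq hq (indOne _ ρ u) =
    indOne _ ρq (R.mkQ u) := indLift_indOne _ _ _ u

omit [Fintype ι] in
lemma indQuotient_inducedRep (a) (y) : indQuotient h hcw R ρq hq (inducedRep _ ρ a y) =
    inducedRep _ ρq a (indQuotient h hcw R ρq hq y) := indLift_inducedRep _ _ _ a y

omit [Fintype ι] in
lemma indQuotient_surjective : Function.Surjective (indQuotient h hcw R ρq hq) := by
  rw [← LinearMap.range_eq_top]
  refine eq_top_of_indOne_mem (ρ := ρq) ?_ fun u => ?_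
  · rintro a _ ⟨y, rfl⟩
    exact ⟨_, indQuotient_inducedRep h hcw hq a y⟩
  · obtain ⟨u, rfl⟩ := R.mkQ_surjective u
    exact ⟨_, indQuotient_indOne h hcw hq u⟩

omit [Fintype ι] in
lemma isStable_ker_indQuotient :
    IsStable (inducedRep _ ρ) (LinearMap.ker (indQuotient h hcw R ρq hq)) := by
  intro a y hy
  rw [LinearMap.mem_ker, indQuotient_inducedRep, LinearMap.mem_ker.1 hy, map_zero]

include hw hc hwW in
/-- Induction of the quotient by a proper subspace is not zero. -/
lemma ker_indQuotient_ne_top (hR : R ≠ ⊤) :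
    LinearMap.ker (indQuotient h hcw R ρq hq) ≠ ⊤ := by
  intro htop
  apply hR
  rw [eq_top_iff]
  intro u _
  have h1 : indOne _ ρ u ∈ LinearMap.ker (indQuotient h hcw R ρq hq) := htop ▸ Submodule.mem_top
  rw [LinearMap.mem_ker, indQuotient_indOne, ← map_zero (indOne (conjHom P w h hcw) ρq)] at h1
  have h2 := indOne_injective hw hc hwW h hcw h1
  rwa [← Submodule.ker_mkQ R]

include hw hc hwW hκ in
/-- The kernel of the passage to the radical quotient of the inducing module is the radical of the
induced module. -/
lemma ker_indQuotient_eq_radical [FiniteDimensional ℂ U] (hreal : HasRealParameter ρ)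
    (hU : wtSum (opX ρ) (blk κ Δ (1 : P.Aut)) = ⊤) (hR : R = radical ρ) :
    LinearMap.ker (indQuotient h hcw R ρq hq) = radical (inducedRep (conjHom P w h hcw) ρ) := by
  have hUq : wtSum (opX ρq) (blk κ Δ (1 : P.Aut)) = ⊤ := by
    rw [eq_top_iff]
    intro u _
    obtain ⟨u, rfl⟩ := R.mkQ_surjective u
    exact map_mem_wtSum (f' := opX ρ) (fun ω u => (hq _ u).symm) (hU ▸ Submodule.mem_top)
  have hrealq : HasRealParameter ρq := by
    obtain ⟨r₀, hr₀⟩ := hreal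
    refine ⟨r₀, fun u => ?_⟩
    obtain ⟨u, rfl⟩ := R.mkQ_surjective u
    rw [hq, hr₀, map_smul]
  have := finiteDimensional_induced h hcw ρ
  have := finiteDimensional_induced h hcw ρq
  apply le_antisymm
  -- The radical is defined as a sum of proper submodules and may be everything, in which case each
  -- of these submodules is treated separately.
  · by_cases hRtop : R = ⊤
    · suffices htop : radical (inducedRep (conjHom P w h hcw) ρ) = ⊤ by rw [htop]; exact le_top
      refine eq_top_of_indOne_mem (isStable_radical _) ?_
      suffices hle : radical ρ ≤ (radical (inducedRep (conjHom P w h hcw) ρ)).comap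
          (indOne _ ρ) from fun u => hle (by rw [← hR, hRtop]; exact Submodule.mem_top)
      refine sSup_le fun K hK u hu => ?_
      have hqK : ∀ a u, quotientRep ρ K hK.1 a (K.mkQ u) = K.mkQ (ρ a u) := fun _ _ => rfl
      have hmem : indOne _ ρ u ∈ LinearMap.ker (indQuotient h hcw K _ hqK) := by
        rw [LinearMap.mem_ker, indQuotient_indOne, Submodule.mkQ_apply,
          (Submodule.Quotient.mk_eq_zero K).2 hu, map_zero]
      have hle : LinearMap.ker (indQuotient h hcw K _ hqK) ≤
          radical (inducedRep (conjHom P w h hcw) ρ) :=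
        le_sSup ⟨isStable_ker_indQuotient h hcw hqK,
          ker_indQuotient_ne_top hw hc hwW h hcw hqK hK.2⟩
      exact hle hmem
    · exact le_sSup ⟨isStable_ker_indQuotient h hcw hq,
        ker_indQuotient_ne_top hw hc hwW h hcw hq hRtop⟩
  · refine sSup_le fun N hN => ?_
    rw [LinearMap.le_ker_iff_map]
    -- If a proper submodule `N` had a nonzero image in the induced quotient, its image would
    -- contain a nonzero vector in the block of `w`, which comes from a vector of `N` in the
    -- inducing module. The latter belongs to the radical, since `N` is proper.
    by_contra hne
    have hall : wtSum (opX (inducedRep (conjHom P w h hcw) ρq)) (blkAll κ Δ b) = ⊤ := by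
      refine wtSum_blkAll_eq_top (tSpan_range_indOne hcw h) ?_
      rintro _ ⟨u, rfl⟩
      have hsub : blk κ Δ w ⊆ blkAll κ Δ b := fun l hl => ⟨w, hwW, hl⟩
      exact wtSum_mono hsub
        (indOne_mem_wtSum (κ := κ) (Δ₀ := Δ) h hcw (u := u) (hUq ▸ Submodule.mem_top))
    obtain ⟨_, ⟨n, hn, rfl⟩, hn0, hnw⟩ := exists_mem_blk hκ
      (hasRealParameter_inducedRep hrealq _ (conjHom_r w h hcw)) hall
      (isStable_map (indQuotient_inducedRep h hcw hq) hN.1) hne ⟨w, hwW⟩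
    apply hn0
    have hcomm := opX_commute (inducedRep (conjHom P w h hcw) ρ)
    obtain ⟨a, ha, a', ha', rfl⟩ := exists_add_wtSum hcomm (blk κ Δ w) n
    have haN : a ∈ N := mem_of_add_mem hcomm (fun ω v hv => hN.1 _ v hv) ha ha' hn
    obtain ⟨u, rfl⟩ := wtSum_blk_inducedRep_le hc hwW h hcw hκ hU ha
    have hu : u ∈ R := by
      rw [hR]
      have hK : N.comap (indOne _ ρ) ≤ radical ρ := by
        refine le_sSup ⟨fun a u hu => ?_, fun htop => hN.2 ?_⟩
        · rw [Submodule.mem_comap, ← inducedRep_apply_indOne]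
          exact hN.1 _ _ hu
        · refine eq_top_of_indOne_mem hN.1 fun v => ?_
          have : v ∈ N.comap (indOne _ ρ) := htop ▸ Submodule.mem_top
          exact this
      exact hK haN
    have h0 : indQuotient h hcw R ρq hq (indOne _ ρ u) = 0 := by
      rw [indQuotient_indOne, Submodule.mkQ_apply, (Submodule.Quotient.mk_eq_zero R).2 hu, map_zero]
    have h1 : indQuotient h hcw R ρq hq a' ∈
        wtSum (opX (inducedRep (conjHom P w h hcw) ρq)) (blk κ Δ w)ᶜ :=
      map_mem_wtSum (fun ω y => indQuotient_inducedRep h hcw hq _ y) ha'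
    rw [map_add, h0, zero_add] at hnw ⊢
    exact Submodule.disjoint_def.1 (isCompl_wtSum (opX_commute _) _).disjoint _ hnw h1

include hw hc hwW hκ hq in
/-- The radical quotient of an induced module is induced from the radical quotient of the inducing
module. -/
lemma areIsomorphic_irreducibleQuotient_inducedRep [FiniteDimensional ℂ U]
    (hreal : HasRealParameter ρ) (hU : wtSum (opX ρ) (blk κ Δ (1 : P.Aut)) = ⊤)
    (hR : R = radical ρ) :
    AreIsomorphic (irreducibleQuotient (inducedRep (conjHom P w h hcw) ρ))
      (inducedRep (conjHom P w h hcw) ρq) :=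
  areIsomorphic_of_ker_eq_radical _ (indQuotient_inducedRep h hcw hq)
    (indQuotient_surjective h hcw hq)
    (ker_indQuotient_eq_radical hw hc hwW h hcw hκ hq hreal hU hR)

end

end

end Induction

/-! ### Induction in stages through a conjugate subsystem -/

section Stages

variable {ι X Y : Type*} [AddCommGroup X] [AddCommGroup Y]
variable {P : RootPairing ι ℤ X Y} {κ : X →+ ℝ} {Δ₀ Δ : Set ι} {c : ι → ℕ} {b : P.Base}
variable {V U Z : Type*} [AddCommGroup V] [Module ℂ V] [AddCommGroup U] [Module ℂ U]
  [AddCommGroup Z] [Module ℂ Z]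
variable [Fintype ι] {w : P.Aut}
  (hc : ∀ w ∈ weyl P (b.support : Set ι), ∀ i, c (w • i) = c i)
  (hwW : w ∈ weyl P (b.support : Set ι)) (h : ∀ d ∈ Δ, w • d ∈ (b.support : Set ι))
  (hcw : ∀ i, c (w • i) = c i)
  (hκ : ∀ g ∈ weyl P (b.support : Set ι), (∀ x, κ (g • x) = κ x) → g ∈ weyl P Δ)
  {π : HeckeAlg P (b.support : Set ι) c →ₐ[ℂ] Module.End ℂ Z} [FiniteDimensional ℂ Z]

omit [Fintype ι] in
/-- The projection to the block of `w` commutes with the subalgebra attached to `w Δ`. -/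
lemma wtProj_conjHom (a : HeckeAlg P Δ c) (z : Z) :
    wtProj (opX_commute π) (blk κ Δ w) (π (conjHom P w h hcw a) z) =
      π (conjHom P w h hcw a) (wtProj (opX_commute π) (blk κ Δ w) z) := by
  refine intertwines_of_generators (ρ := π.comp (conjHom P w h hcw))
    (ρ' := π.comp (conjHom P w h hcw)) (φ := wtProj (opX_commute π) (blk κ Δ w))
    (fun g z => ?_) (fun z => ?_) (fun ω z => ?_) a z
  · revert z
    refine weyl_induction (p := fun g => ∀ z,
      wtProj (opX_commute π) (blk κ Δ w) ((π.comp (conjHom P w h hcw)) (Alg.t g) z) =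
        (π.comp (conjHom P w h hcw)) (Alg.t g) (wtProj (opX_commute π) (blk κ Δ w) z))
      (fun z => by rw [Alg.t_one, map_one]; rfl) (fun d g ih z => ?_) g
    have hd : 𝓈 P (d : ι) ∈ weyl P Δ := Subgroup.subset_closure ⟨d, d.2, rfl⟩
    have e : conjHom P w h hcw (Alg.t (simpleRefl P Δ d)) =
        Alg.t (simpleRefl P (b.support : Set ι) ⟨w • (d : ι), h d d.2⟩) := by
      rw [conjHom_t]
      congr 1
      exact Subtype.ext (reflection_smul_eq P w d).symm
    have hact : 𝓈 P (w • (d : ι)) * w = w * 𝓈 P (d : ι) := by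
      rw [reflection_smul_eq, inv_mul_cancel_right]
    have hS : actSet (𝓈 P (w • (d : ι))) (blk κ Δ w) = blk κ Δ w := by
      rw [actSet_blk, hact, blk_mul _ hd]
    have hSc : actSet (𝓈 P (w • (d : ι))) (blk κ Δ w)ᶜ = (blk κ Δ w)ᶜ := by
      nth_rewrite 2 [← hS]
      rfl
    rw [← Alg.t_mul, map_mul, Module.End.mul_apply, Module.End.mul_apply, ← ih,
      AlgHom.comp_apply, e]
    refine wtProj_comm _ (fun v hv => ?_) (fun v hv => ?_) _
    · have := t_simple_mem_wtSum π ⟨w • (d : ι), h d d.2⟩ hv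
      rwa [hS, Set.union_self] at this
    · have := t_simple_mem_wtSum π ⟨w • (d : ι), h d d.2⟩ hv
      rwa [hSc, Set.union_self] at this
  · rw [AlgHom.comp_apply, conjHom_r]
    exact wtProj_comm _ (fun v hv => r_mem_wtSum π hv) (fun v hv => r_mem_wtSum π hv) z
  · rw [AlgHom.comp_apply, conjHom_x]
    exact wtProj_comm _ (fun v hv => x_mem_wtSum π _ hv) (fun v hv => x_mem_wtSum π _ hv) z

variable (π) in
/-- The component of `t_w ξ(v)` in the block of `w`, for a linear map `ξ` to an `ℍ`-module. -/
def twist (hwW : w ∈ weyl P (b.support : Set ι)) (S : Set (CartanDual X →ₗ[ℂ] ℂ))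
    (ξ : V →ₗ[ℂ] Z) : V →ₗ[ℂ] Z :=
  wtProj (opX_commute π) S ∘ₗ π (Alg.t ⟨w, hwW⟩) ∘ₗ ξ

include hc hκ in
/-- For `w` shortest in its coset, the component of `t_w v` in the block of `w` depends on `v`
equivariantly. -/
lemma twist_apply (hΔ₀ : Δ₀ ⊆ (b.support : Set ι)) (hΔ : Δ₀ ⊆ Δ) (hmin : IsShortest Δ b w)
    {τ : HeckeAlg P Δ₀ c →ₐ[ℂ] Module.End ℂ V} {ξ : V →ₗ[ℂ] Z}
    (hξ : ∀ a v, ξ (τ a v) = π (incl P c hΔ₀ a) (ξ v))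
    (hV : ∀ v, ξ v ∈ wtSum (opX π) (blk κ Δ (1 : P.Aut))) (a : HeckeAlg P Δ₀ c) (v : V) :
    twist π hwW (blk κ Δ w) ξ (τ a v) =
      π (conjHom P w h hcw (incl P c hΔ a)) (twist π hwW (blk κ Δ w) ξ v) := by
  refine intertwines_of_generators (ρ := τ)
    (ρ' := (π.comp (conjHom P w h hcw)).comp (incl P c hΔ)) (φ := twist π hwW (blk κ Δ w) ξ)
    (fun g v => ?_) (fun v => ?_) (fun ω v => ?_) a v
  · change wtProj (opX_commute π) _ (π _ (ξ (τ _ v))) =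
      π (conjHom P w h hcw (incl P c hΔ (Alg.t g)))
        (wtProj (opX_commute π) _ (π _ (ξ v)))
    rw [← wtProj_conjHom h hcw, hξ, incl_t, incl_t, conjHom_t, t_t_apply, t_t_apply]
    exact congrArg (fun x : weyl P (b.support : Set ι) =>
      wtProj (opX_commute π) (blk κ Δ w) (π (Alg.t x) (ξ v)))
      (Subtype.ext (show w * (g : P.Aut) = w * g * w⁻¹ * w by group))
  · change wtProj (opX_commute π) _ (π _ (ξ (τ _ v))) = π (conjHom P w h hcw (incl P c hΔ Alg.r))
      (wtProj (opX_commute π) _ (π _ (ξ v)))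
    rw [← wtProj_conjHom h hcw, hξ, incl_r, incl_r, conjHom_r, r_t_apply]
  · change wtProj (opX_commute π) _ (π _ (ξ (τ _ v))) =
      π (conjHom P w h hcw (incl P c hΔ (Alg.x ω)))
        (wtProj (opX_commute π) _ (π _ (ξ v)))
    rw [← wtProj_conjHom h hcw, hξ, incl_x, incl_x, conjHom_x, eq_comm, ← sub_eq_zero, ← map_sub]
    refine wtProj_of_mem_compl _ ?_
    -- The terms for shorter elements have no component in the block of `w`.
    have h1 := x_t_sub_mem_tLow hc (π := π) (Q := wtSum (opX π) (blk κ Δ (1 : P.Aut)))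
      (fun v => r_mem_wtSum π) ⟨w, hwW⟩ (act P w ω) (hV v)
    rw [act_inv_act] at h1
    refine wtSum_mono (blkLow_subset_compl hκ hwW hmin) (tLow_le (fun u hu v hv => ?_) h1)
    have hsub : blk κ Δ (u : P.Aut) ⊆ blkLow κ Δ b (len b w) := fun l hl => ⟨u, u.2, hu, hl⟩
    refine wtSum_mono (Set.union_subset hsub ?_)
      (t_mem_wtSum_blk (κ := κ) (Δ := Δ) hc hv u)
    rintro l ⟨u', hu', hlen, hl⟩
    exact ⟨u', hu', hlen.trans hu, hl⟩

include hc hκ in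
/-- A vector in the first block lies in a submodule if the component of its translate by `t_w` in
the block of `w` does. This is the injectivity in `eq_zero_of_t_mem_wtSum_compl`, applied to the
quotient module. -/
lemma mem_of_wtProj_mem (hmin : IsShortest Δ b w) (hreal : HasRealParameter π) {N : Submodule ℂ Z}
    (hN : IsStable π N) {z : Z} (hz : z ∈ wtSum (opX π) (blk κ Δ (1 : P.Aut)))
    (hzN : wtProj (opX_commute π) (blk κ Δ w) (π (Alg.t ⟨w, hwW⟩) z) ∈ N) : z ∈ N := by
  have hq : ∀ a x, N.mkQ (π a x) = quotientRep π N hN a (N.mkQ x) := fun _ _ => rfl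
  rw [← Submodule.ker_mkQ N, LinearMap.mem_ker]
  have hrealN : HasRealParameter (quotientRep π N hN) := by
    obtain ⟨r₀, hr₀⟩ := hreal
    refine ⟨r₀, fun x => ?_⟩
    obtain ⟨x, rfl⟩ := N.mkQ_surjective x
    rw [← hq, hr₀, map_smul]
  refine eq_zero_of_t_mem_wtSum_compl hκ hc hrealN ⟨w, hwW⟩ hmin
    (map_mem_wtSum (fun ω x => hq _ x) hz) ?_
  have h2 : quotientRep π N hN (Alg.t ⟨w, hwW⟩) (N.mkQ z) =
      N.mkQ (π (Alg.t ⟨w, hwW⟩) z -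
        wtProj (opX_commute π) (blk κ Δ w) (π (Alg.t ⟨w, hwW⟩) z)) := by
    rw [map_sub, ← hq, Submodule.mkQ_apply, Submodule.mkQ_apply N (wtProj _ _ _),
      (Submodule.Quotient.mk_eq_zero N).2 hzN, sub_zero]
  rw [h2]
  exact map_mem_wtSum (fun ω x => hq _ x) (sub_wtProj_mem _ _ _)

omit [Fintype ι] [FiniteDimensional ℂ Z] in
/-- If the translates of a subspace span the inducing module, they span the induced module. -/
lemma tSpan_indOne_comp {ρ : HeckeAlg P Δ c →ₐ[ℂ] Module.End ℂ U} {ψ : V →ₗ[ℂ] U}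
    (hr : ∀ v, ∃ v', ρ Alg.r (ψ v) = ψ v') (hx : ∀ ω v, ∃ v', ρ (Alg.x ω) (ψ v) = ψ v')
    (hgen : tSpan ρ (LinearMap.range ψ) = ⊤) :
    tSpan (inducedRep (conjHom P w h hcw) ρ)
      (LinearMap.range (indOne (conjHom P w h hcw) ρ ∘ₗ ψ)) = ⊤ := by
  set N := tSpan (inducedRep (conjHom P w h hcw) ρ)
      (LinearMap.range (indOne (conjHom P w h hcw) ρ ∘ₗ ψ)) with hN
  have hstab : IsStable (inducedRep (conjHom P w h hcw) ρ) N := by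
    refine isStable_tSpan simpleRefl_mul_self closure_range_simpleRefl ?_ fun ω => ?_
    · rintro _ ⟨v, rfl⟩
      obtain ⟨v', hv'⟩ := hr v
      refine ⟨v', ?_⟩
      rw [LinearMap.comp_apply, LinearMap.comp_apply, inducedRep_r_indOne, hv']
    · rintro _ ⟨v, rfl⟩
      obtain ⟨v', hv'⟩ := hx (act P w⁻¹ ω) v
      refine ⟨v', ?_⟩
      nth_rewrite 1 [← act_act_inv w ω]
      rw [LinearMap.comp_apply, LinearMap.comp_apply, inducedRep_x_indOne, hv']
  refine eq_top_of_indOne_mem hstab ?_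
  suffices hle : tSpan ρ (LinearMap.range ψ) ≤ N.comap (indOne _ ρ) from fun u =>
    hle (hgen ▸ Submodule.mem_top)
  refine tSpan_le ?_
  rintro g _ ⟨v, rfl⟩
  rw [Submodule.mem_comap, ← inducedRep_apply_indOne]
  exact hstab _ _ (le_tSpan ⟨v, rfl⟩)

set_option maxHeartbeats 400000 in
include hc hwW hκ in
/-- A module induced from `ℍ_{Δ₀}`, with weights of the inducing module in a single block, is
induced from the subalgebra attached to `w Δ`. The hypothesis `hext` says that the module `ρ` of
`ℍ_Δ` is induced from `τ`. -/
lemma areIsomorphic_inducedRep_incl [FiniteDimensional ℂ V] (hΔ₀ : Δ₀ ⊆ (b.support : Set ι))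
    (hΔ : Δ₀ ⊆ Δ) (hw : IsStandardizing b Δ w)
    {τ : HeckeAlg P Δ₀ c →ₐ[ℂ] Module.End ℂ V} (hreal : HasRealParameter τ)
    (hV : wtSum (opX τ) (blk κ Δ (1 : P.Aut)) = ⊤)
    {ρ : HeckeAlg P Δ c →ₐ[ℂ] Module.End ℂ U} {ψ : V →ₗ[ℂ] U}
    (hψ : ∀ a v, ψ (τ a v) = ρ (incl P c hΔ a) (ψ v))
    (hgen : tSpan ρ (LinearMap.range ψ) = ⊤)
    (hext : ∀ (θ : HeckeAlg P Δ c →ₐ[ℂ] Module.End ℂ (Induced (incl P c hΔ₀) τ))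
      (φ : V →ₗ[ℂ] Induced (incl P c hΔ₀) τ), (∀ a v, φ (τ a v) = θ (incl P c hΔ a) (φ v)) →
        ∃ Ψ : U →ₗ[ℂ] Induced (incl P c hΔ₀) τ, (∀ v, Ψ (ψ v) = φ v) ∧
          ∀ a u, Ψ (ρ a u) = θ a (Ψ u)) :
    AreIsomorphic (inducedRep (incl P c hΔ₀) τ) (inducedRep (conjHom P w h hcw) ρ) := by
  have := finite_weyl b
  have := Fintype.ofFinite (weyl P (b.support : Set ι))
  have hmin : IsShortest Δ b w := fun g hg => hw.len_le hwW hg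
  have hΔ₀' : ∀ d ∈ Δ₀, (1 : P.Aut) • d ∈ (b.support : Set ι) := fun d hd => by
    rw [one_smul]; exact hΔ₀ hd
  have hc1 : ∀ i, c ((1 : P.Aut) • i) = c i := fun i => by rw [one_smul]
  have hfdX : FiniteDimensional ℂ (Induced (incl P c hΔ₀) τ) := by
    rw [incl_eq_conjHom]
    exact finiteDimensional_induced hΔ₀' hc1 τ
  set X := inducedRep (incl P c hΔ₀) τ with hX
  set ξ := indOne (incl P c hΔ₀) τ with hξdef
  have hξ : ∀ a v, ξ (τ a v) = X (incl P c hΔ₀ a) (ξ v) := fun a v =>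
    (inducedRep_apply_indOne a v).symm
  have hξV : ∀ v, ξ v ∈ wtSum (opX X) (blk κ Δ (1 : P.Aut)) := fun v => by
    refine map_mem_wtSum (f' := opX τ) (fun ω u => ?_) (hV ▸ Submodule.mem_top)
    rw [opX_apply, opX_apply, hξ, incl_x]
  have hrealX : HasRealParameter X := hasRealParameter_inducedRep hreal _ (incl_r hΔ₀)
  -- The block component of `t_w v` yields a homomorphism `Φ` from the module induced from `w Δ`; it
  -- is surjective by `mem_of_wtProj_mem`, and a comparison of dimensions shows that it is
  -- bijective.
  set φ := twist X hwW (blk κ Δ w) ξ with hφdef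
  obtain ⟨Ψ, hΨ, hΨ'⟩ := hext (X.comp (conjHom P w h hcw)) φ
    (twist_apply hc hwW h hcw hκ hΔ₀ hΔ hmin hξ hξV)
  set Φ := indLift X Ψ hΨ' with hΦdef
  have hΦ : ∀ a y, Φ (inducedRep _ ρ a y) = X a (Φ y) := indLift_inducedRep X Ψ hΨ'
  have hsurj : Function.Surjective Φ := by
    rw [← LinearMap.range_eq_top]
    have hN : IsStable X (LinearMap.range Φ) := by
      rintro a _ ⟨y, rfl⟩
      exact ⟨_, hΦ a y⟩
    refine eq_top_of_indOne_mem hN fun v => ?_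
    refine mem_of_wtProj_mem hc hwW hκ hmin hrealX hN (hξV v) ⟨indOne _ ρ (ψ v), ?_⟩
    exact (indLift_indOne X Ψ hΨ' (ψ v)).trans (hΨ v)
  have hspan : tSpan (inducedRep (conjHom P w h hcw) ρ)
      (LinearMap.range (indOne (conjHom P w h hcw) ρ ∘ₗ ψ)) = ⊤ := by
    refine tSpan_indOne_comp h hcw (fun v => ⟨τ Alg.r v, ?_⟩)
      (fun ω v => ⟨τ (Alg.x ω) v, ?_⟩) hgen
    · rw [hψ, incl_r]
    · rw [hψ, incl_x]
  have hfdY : FiniteDimensional ℂ (Induced (conjHom P w h hcw) ρ) :=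
    finiteDimensional_of_tSpan hspan
  have hdimX : Module.finrank ℂ (Induced (incl P c hΔ₀) τ) =
      Module.finrank ℂ (fnSpace b τ) := by
    rw [incl_eq_conjHom]
    exact finrank_induced (isStandardizing_one b hΔ₀) hc (one_mem _) hΔ₀' hc1
  have hdimY : Module.finrank ℂ (Induced (conjHom P w h hcw) ρ) ≤
      Module.finrank ℂ (fnSpace b τ) := by
    refine finrank_le_fnSpace _ hwW (indOne (conjHom P w h hcw) ρ ∘ₗ ψ) (fun k v => ?_) hspan
    rw [LinearMap.comp_apply, LinearMap.comp_apply, hψ, incl_t, ← inducedRep_t_indOne]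
    rfl
  have hinj : Function.Injective Φ := by
    refine (LinearMap.injective_iff_surjective_of_finrank_eq_finrank ?_).2 hsurj
    exact le_antisymm (hdimY.trans hdimX.ge) (LinearMap.finrank_le_finrank_of_surjective hsurj)
  exact AreIsomorphic.symm ⟨LinearEquiv.ofBijective Φ ⟨hinj, hsurj⟩, hΦ⟩

end Stages

/-! ### Real and imaginary parts -/

section PerfectPairing

variable {ι X Y : Type*} [AddCommGroup X] [AddCommGroup Y] (P : RootPairing ι ℤ X Y)

lemma pair_one_tmul_imPart (x : X) (y : Cartan Y) :
    pair P (1 ⊗ₜ x) (imPart y) = ((pair P (1 ⊗ₜ x) y).im : ℂ) := by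
  induction y using TensorProduct.induction_on with
  | zero => simp
  | tmul z y => simp
  | add a b ha hb => simp [ha, hb]

lemma imPart_rePart (y : Cartan Y) : imPart (rePart y) = 0 := by
  induction y using TensorProduct.induction_on with
  | zero => simp
  | tmul z y => simp
  | add a b ha hb => simp [ha, hb]

lemma imHom_flip_pair (y : Cartan Y) (x : X) : imHom ((pair P).flip y) x = (pair P (1 ⊗ₜ x) y).im :=
  rfl

/-- The coordinates with respect to a basis of the cocharacter lattice are pairings with
characters. -/
lemma exists_basis_pair [Module.Finite ℤ Y] : ∃ (n : Type) (_ : Fintype n)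
    (e : Module.Basis n ℂ (Cartan Y)) (u : n → X), ∀ i y, pair P (1 ⊗ₜ u i) y = e.repr y i := by
  have : Module.IsReflexive ℤ Y := Module.IsReflexive.of_isPerfPair P.toLinearMap.flip
  let e := Module.finBasis ℤ Y
  choose u hu using fun i => (LinearMap.IsPerfPair.bijective_left P.toLinearMap).2 (e.coord i)
  refine ⟨_, inferInstance, e.baseChange ℂ, u, fun i y => ?_⟩
  induction y using TensorProduct.induction_on with
  | zero => simp
  | tmul z y =>
    have := LinearMap.congr_fun (hu i) y
    rw [pair_tmul, this]
    simp [mul_comm]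
  | add a b ha hb => simp [ha, hb]

/-- The characters separate the points of `𝔥`. -/
lemma eq_zero_of_pair_eq_zero [Module.Finite ℤ Y] {y : Cartan Y}
    (h : ∀ x : X, pair P (1 ⊗ₜ x) y = 0) : y = 0 := by
  obtain ⟨n, _, e, u, hu⟩ := exists_basis_pair P
  refine e.repr.injective (Finsupp.ext fun i => ?_)
  rw [← hu, h]; simp

lemma pair_surjective [Module.Finite ℤ Y] : Function.Surjective (pair P) := by
  intro f
  obtain ⟨n, _, e, u, hu⟩ := exists_basis_pair P
  refine ⟨∑ i, f (e i) ⊗ₜ u i, LinearMap.ext fun y => ?_⟩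
  have h1 : ∀ i, pair P (f (e i) ⊗ₜ u i) y = e.repr y i * f (e i) := fun i => by
    rw [← hu, mul_comm, ← smul_eq_mul, ← LinearMap.smul_apply, ← map_smul,
      TensorProduct.smul_tmul', smul_eq_mul, mul_one]
  rw [map_sum, LinearMap.sum_apply]
  simp only [h1]
  nth_rewrite 2 [← e.sum_repr y]
  rw [map_sum]
  simp

/-- Every functional on the span of the coroots of `Δ` is the restriction of an element of `𝔥^*`. -/
lemma restrictDual_surjective [Module.Finite ℤ Y] (Δ : Set ι) :
    Function.Surjective (restrictDual P Δ) := by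
  intro f
  obtain ⟨g, hg⟩ := LinearMap.dualMap_surjective_of_injective (coSpan P Δ).injective_subtype f
  obtain ⟨ω, rfl⟩ := pair_surjective P g
  exact ⟨ω, hg⟩

end PerfectPairing

/-! ### The weights of the inducing module -/

section InducingModule

variable {ι X Y V : Type*} [AddCommGroup X] [AddCommGroup Y] [Module.Finite ℤ Y]
  [AddCommGroup V] [Module ℂ V]
variable {P : RootPairing ι ℤ X Y} {Δ₀ Δ : Set ι} {c : ι → ℕ} {κ : X →+ ℝ}
variable {σ : HeckeAlg₀ P Δ₀ c →ₐ[ℂ] Module.End ℂ V} {ν : Cartan Y} (hν : ν ∈ annih P Δ₀)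

omit [Module.Finite ℤ Y] in
lemma evalAt_rep_x (ω : CartanDual X) (v : V) : (σ.comp (evalAt P c ν hν)) (Alg.x ω) v =
    σ (Alg.x (restrictDual P Δ₀ ω)) v + pair P ω ν • v := by
  rw [AlgHom.comp_apply, evalAt_x, map_add, AlgHom.commutes]; rfl

/-- A nonzero finite dimensional module has a weight `l`, and `l + ν` is then a weight of its
extension by `ν`, for every `ν`. -/
lemma exists_weight [FiniteDimensional ℂ V] [Nontrivial V]
    (σ : HeckeAlg₀ P Δ₀ c →ₐ[ℂ] Module.End ℂ V) : ∃ l : coSpan P Δ₀, IsWeight₀ σ l ∧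
      ∀ (ν : Cartan Y) (hν : ν ∈ annih P Δ₀),
        wt (opX (σ.comp (evalAt P c ν hν))) ((pair P).flip ((l : Cartan Y) + ν)) ≠ ⊥ := by
  obtain ⟨χ, -, v, -, hv0, hv⟩ := exists_eigenvector (opX_commute σ) (N := ⊤)
    (fun _ _ _ => Submodule.mem_top) top_ne_bot (S := Set.univ) (by
      rw [wtSum_univ (opX_commute σ)])
  obtain ⟨l, hl⟩ := (Module.evalEquiv ℂ (coSpan P Δ₀)).surjective χ
  have hv' : ∀ ω, σ (Alg.x ω) v = ω l • v := fun ω => by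
    have := hv ω
    rw [← hl] at this
    exact this
  refine ⟨l, ?_, fun ν hν => ?_⟩
  · refine (Submodule.ne_bot_iff _).2 ⟨v, ?_, hv0⟩
    rw [weightSpace, Module.End.mem_iInf_maxGenEigenspace_iff]
    exact fun ω => ⟨1, by rw [pow_one]; change σ (Alg.x ω) v - ω l • v = 0; rw [hv', sub_self]⟩
  · refine (Submodule.ne_bot_iff _).2 ⟨v, ?_, hv0⟩
    rw [wt, Module.End.mem_iInf_maxGenEigenspace_iff]
    refine fun ω => ⟨1, ?_⟩
    rw [pow_one]
    change (σ.comp (evalAt P c ν hν)) (Alg.x ω) v - pair P ω ((l : Cartan Y) + ν) • v = 0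
    rw [evalAt_rep_x, hv', map_add, add_smul]
    exact sub_self _

/-- If one weight of an irreducible module lies in the first block, then so do all of them. -/
lemma wtSum_evalAt_eq_top [FiniteDimensional ℂ V] (hirr : IsIrreducible σ) (hΔ : Δ₀ ⊆ Δ)
    {l : CartanDual X →ₗ[ℂ] ℂ} (hl : l ∈ blk κ Δ (1 : P.Aut))
    (hwt : wt (opX (σ.comp (evalAt P c ν hν))) l ≠ ⊥) :
    wtSum (opX (σ.comp (evalAt P c ν hν))) (blk κ Δ (1 : P.Aut)) = ⊤ := by
  set τ := σ.comp (evalAt P c ν hν) with hτ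
  refine (hirr.2 _ (isStable_of_generators (fun w v hv => ?_) (fun v hv => ?_)
    (fun ω v hv => ?_))).resolve_left fun hbot => hwt ?_
  · have e : ∀ g : weyl P Δ₀, σ (Alg.t g) = τ (Alg.t g) := fun g => by
      rw [hτ, AlgHom.comp_apply, evalAt_t]
    rw [e]
    revert w
    refine weyl_induction ?_ fun d w ih => ?_
    · rwa [t_one_apply]
    · have h1 := t_simple_mem_wtSum τ d ih
      have hd : 𝓈 P (d : ι) ∈ weyl P Δ := Subgroup.subset_closure ⟨d, hΔ d.2, rfl⟩
      have e : blk κ Δ (𝓈 P (d : ι) * 1) = blk κ Δ (1 : P.Aut) := by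
        rw [mul_one, ← one_mul (𝓈 P (d : ι)), blk_mul _ hd]
      rwa [actSet_blk, e, Set.union_self, t_t_apply] at h1
  · have := r_mem_wtSum τ hv
    rwa [hτ, AlgHom.comp_apply, evalAt_r] at this
  · obtain ⟨ω, rfl⟩ := restrictDual_surjective P Δ₀ ω
    have e : σ (Alg.x (restrictDual P Δ₀ ω)) v = τ (Alg.x ω) v - pair P ω ν • v := by
      rw [hτ, evalAt_rep_x, add_sub_cancel_right]
    rw [e]
    exact Submodule.sub_mem _ (x_mem_wtSum τ ω hv) (Submodule.smul_mem _ _ hv)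
  · rw [← le_bot_iff, ← hbot]
    exact wt_le_wtSum hl

end InducingModule

/-! ### Standard modules of the centralizer -/

section Standard

variable {ι X Y V : Type*} [AddCommGroup X] [AddCommGroup Y]
  [AddCommGroup V] [Module ℂ V]
variable {P : RootPairing ι ℤ X Y} {Δ₀ Δ : Set ι} {c : ι → ℕ} {κ : X →+ ℝ}
variable {σ : HeckeAlg₀ P Δ₀ c →ₐ[ℂ] Module.End ℂ V} {ν : Cartan Y} (hν : ν ∈ annih P Δ₀)
  (h : Δ₀ ⊆ Δ)

lemma shift_neg_shift (χ : Cartan Y) (hχ : χ ∈ annih P Δ) :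
    (shift P c (-χ) (neg_mem hχ)).comp (shift P c χ hχ) = AlgHom.id ℂ _ := by
  refine Alg.hom_ext (fun g => ?_) ?_ fun ω => ?_
  · rw [AlgHom.comp_apply, shift_t, shift_t]; rfl
  · rw [AlgHom.comp_apply, shift_r, shift_r]; rfl
  · rw [AlgHom.comp_apply, shift_x, map_add, shift_x, AlgHom.commutes, map_neg, map_neg]
    simp

lemma shift_surjective (χ : Cartan Y) (hχ : χ ∈ annih P Δ) :
    Function.Surjective (shift P c χ hχ) := fun a =>
  ⟨_, AlgHom.congr_fun (shift_shift_neg χ hχ) a⟩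

lemma annih_mono (h : Δ₀ ⊆ Δ) : annih P Δ ≤ annih P Δ₀ := fun _ hy d hd => hy d (h hd)

/-- The translates of the inducing module span the standard module. -/
lemma tSpan_standardRep :
    tSpan (standardRep h σ ν hν) (LinearMap.range (indOne (incl P c h) _)) = ⊤ := by
  rw [standardRep, incl_eq_conjHom]
  exact tSpan_range_indOne _ _

lemma tSpan_comp_shift {U : Type*} [AddCommGroup U] [Module ℂ U]
    (ρ : HeckeAlg P Δ c →ₐ[ℂ] Module.End ℂ U) (χ : Cartan Y) (hχ : χ ∈ annih P Δ)
    (Q : Submodule ℂ U) : tSpan (ρ.comp (shift P c χ hχ)) Q = tSpan ρ Q := by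
  simp only [tSpan, AlgHom.comp_apply, shift_t]

variable {ν₁ χ : Cartan Y} (hν₁ : ν₁ ∈ annih P Δ₀) (hχ : χ ∈ annih P Δ)

/-- The twist of a standard module for `ν₁` by a central character `χ` contains the inducing module
for `ν₁ + χ`. -/
lemma indOne_standardRep_comp_shift (hsum : ν₁ + χ = ν) (a : HeckeAlg P Δ₀ c) (v : V) :
    indOne (incl P c h) _ ((σ.comp (evalAt P c ν hν)) a v) =
      ((standardRep h σ ν₁ hν₁).comp (shift P c χ hχ)) (incl P c h a)
        (indOne (incl P c h) _ v) := by
  have h1 := AlgHom.congr_fun (shift_incl (c := c) χ (annih_mono h hχ) h hχ) a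
  have h2 := inducedRep_apply_indOne (j := incl P c h) (ρ := σ.comp (evalAt P c ν₁ hν₁))
    (shift P c χ (annih_mono h hχ) a) v
  have h3 := AlgHom.congr_fun (evalAt_comp_shift (c := c) ν₁ χ ν hν₁ (annih_mono h hχ) hν hsum) a
  change _ = standardRep h σ ν₁ hν₁ (shift P c χ hχ (incl P c h a)) _
  have h1' : shift P c χ hχ (incl P c h a) = incl P c h (shift P c χ (annih_mono h hχ) a) := h1
  rw [h1']
  refine Eq.trans ?_ h2.symm
  rw [AlgHom.comp_apply, AlgHom.comp_apply, ← h3, AlgHom.comp_apply]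

/-- The universal property of the twist of a standard module by a character. -/
lemma exists_extension_standardRep (hsum : ν₁ + χ = ν) {Z : Type*} [AddCommGroup Z] [Module ℂ Z]
    (θ : HeckeAlg P Δ c →ₐ[ℂ] Module.End ℂ Z) (φ : V →ₗ[ℂ] Z)
    (hφ : ∀ a v, φ ((σ.comp (evalAt P c ν hν)) a v) = θ (incl P c h a) (φ v)) :
    ∃ Ψ : Induced (incl P c h) (σ.comp (evalAt P c ν₁ hν₁)) →ₗ[ℂ] Z,
      (∀ v, Ψ (indOne (incl P c h) _ v) = φ v) ∧
        ∀ a u, Ψ (((standardRep h σ ν₁ hν₁).comp (shift P c χ hχ)) a u) = θ a (Ψ u) := by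
  have hχ₀ := annih_mono h hχ
  have hφ' : ∀ a v, φ ((σ.comp (evalAt P c ν₁ hν₁)) a v) =
      (θ.comp (shift P c (-χ) (neg_mem hχ))) (incl P c h a) (φ v) := by
    intro a v
    have h1 := AlgHom.congr_fun (shift_incl (c := c) (-χ) (neg_mem hχ₀) h (neg_mem hχ)) a
    rw [AlgHom.comp_apply, AlgHom.comp_apply] at h1
    have h2 : ν + -χ = ν₁ := by rw [← hsum, add_neg_cancel_right]
    rw [AlgHom.comp_apply θ, h1, ← hφ, AlgHom.comp_apply, AlgHom.comp_apply,
      ← evalAt_comp_shift ν (-χ) ν₁ hν (neg_mem hχ₀) hν₁ h2, AlgHom.comp_apply]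
  refine ⟨indLift (θ.comp (shift P c (-χ) (neg_mem hχ))) φ hφ', indLift_indOne _ φ hφ',
    fun a u => ?_⟩
  rw [AlgHom.comp_apply, standardRep, indLift_inducedRep, AlgHom.comp_apply]
  have h1 := AlgHom.congr_fun (shift_neg_shift (c := c) χ hχ) a
  rw [AlgHom.comp_apply] at h1
  rw [h1]; rfl

lemma hasRealParameter_evalAt (hr : HasRealParameter σ) :
    HasRealParameter (σ.comp (evalAt P c ν hν)) := by
  obtain ⟨r₀, hr₀⟩ := hr
  exact ⟨r₀, fun v => by rw [AlgHom.comp_apply, evalAt_r, hr₀]⟩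

lemma hasRealParameter_standardRep (hr : HasRealParameter σ) :
    HasRealParameter (standardRep h σ ν hν) :=
  hasRealParameter_inducedRep (hasRealParameter_evalAt hν hr) _ (incl_r h)

lemma indOne_standardRep_mem_wtSum
    (hV : wtSum (opX (σ.comp (evalAt P c ν hν))) (blk κ Δ (1 : P.Aut)) = ⊤) :
    LinearMap.range (indOne (incl P c h) (σ.comp (evalAt P c ν hν))) ≤
      wtSum (opX (standardRep h σ ν hν)) (blk κ Δ (1 : P.Aut)) := by
  rintro _ ⟨v, rfl⟩
  refine map_mem_wtSum (f' := opX (σ.comp (evalAt P c ν hν))) (fun ω u => ?_)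
    (hV ▸ Submodule.mem_top)
  rw [opX_apply, opX_apply, ← inducedRep_apply_indOne, incl_x]; rfl

end Standard

/-! ### The centralizer of the imaginary part -/

section Centralizer

variable {ι X Y : Type*} [AddCommGroup X] [AddCommGroup Y]
variable {P : RootPairing ι ℤ X Y} (b : P.Base) (ν : Cartan Y)

lemma mem_centralizerRoots_iff {i : ι} :
    i ∈ centralizerRoots P ν ↔ imHom ((pair P).flip ν) (P.root i) = 0 := by
  change pair P (rootC P i) (imPart ν) = 0 ↔ _
  rw [pair_rootC_imPart, Complex.ofReal_eq_zero]
  rfl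

/-- The centralizer of the imaginary part of `ν` is the subsystem of the roots on which the
imaginary part, as a functional on characters, vanishes. -/
lemma centralizerSimple_eq : centralizerSimple b ν = kernelSimple b (imHom ((pair P).flip ν)) := by
  ext i
  simp only [centralizerSimple, kernelSimple, mem_centralizerRoots_iff]

lemma generatedRoots_centralizerSimple [Finite ι] :
    generatedRoots P (centralizerSimple b ν) = centralizerRoots P ν := by
  rw [centralizerSimple_eq, generatedRoots_kernelSimple]
  ext i
  exact (mem_centralizerRoots_iff ν).symm

variable [Module.Finite ℤ Y] {c : ι → ℕ} {PiM : Set ι} {V : Type*} [AddCommGroup V] [Module ℂ V]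
  {σ : HeckeAlg₀ P PiM c →ₐ[ℂ] Module.End ℂ V} {ν}

/-- The imaginary part of a weight of `σ ⊗ ℂ_ν`, and the properties that control its blocks. -/
lemma exists_block [Finite ι] (hL : IsLanglandsParameter (b.support : Set ι) σ ν)
    (hreg : ∀ l, IsWeight₀ σ l → ∀ i,
      pair P (rootC P i) (imPart ((l : Cartan Y) + ν)) = 0 →
        pair P (rootC P i) (imPart ν) = 0) :
    ∃ κ : X →+ ℝ, wtSum (opX (σ.comp (evalAt P c ν hL.mem)))
        (blk κ (centralizerSimple b ν) (1 : P.Aut)) = ⊤ ∧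
      ∀ g ∈ weyl P (b.support : Set ι), (∀ x, κ (g • x) = κ x) →
        g ∈ weyl P (centralizerSimple b ν) := by
  have := hL.finite
  have := hL.tempered.1.1
  obtain ⟨l, hl, hwt⟩ := exists_weight σ
  -- The functional is the imaginary part of `l + ν`. Its stabilizer is generated by reflections,
  -- and the regularity condition places these in the centralizer of the imaginary part of `ν`.
  refine ⟨imHom ((pair P).flip ((l : Cartan Y) + ν)), ?_, fun g hg hfix => ?_⟩
  · refine wtSum_evalAt_eq_top hL.mem hL.tempered.1 (subset_centralizerSimple b hL.subset hL.mem)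
      (l := (pair P).flip ((l : Cartan Y) + ν)) ⟨1, one_mem _, fun x => by simp⟩ (hwt ν hL.mem)
  · have h1 := mem_weyl_of_fixed b _ hg hfix
    refine (Subgroup.closure_le _).2 ?_ h1
    rintro _ ⟨i, hi, rfl⟩
    apply reflection_mem_weyl_of_generatedRoots
    rw [generatedRoots_centralizerSimple]
    refine hreg l hl i ?_
    rw [rootC, pair_one_tmul_imPart, Complex.ofReal_eq_zero]
    exact hi

end Centralizer

/-! ### Reduction to the centralizer of the imaginary part -/

section Reduction

variable {ι X Y V : Type*} [AddCommGroup X] [AddCommGroup Y] [AddCommGroup V] [Module ℂ V]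
  {P : RootPairing ι ℤ X Y} {b : P.Base} {c : ι → ℕ} {Δ₀ Δ : Set ι} {κ : X →+ ℝ}
  {σ : HeckeAlg₀ P Δ₀ c →ₐ[ℂ] Module.End ℂ V} {ν ν₁ χ : Cartan Y}
  (h : Δ₀ ⊆ Δ) (hν : ν ∈ annih P Δ₀) (hν₁ : ν₁ ∈ annih P Δ₀) (hχ : χ ∈ annih P Δ)

lemma finite_weyl_of_base [Finite ι] (b : P.Base) (Δ : Set ι) : Finite (weyl P Δ) := by
  have := Fintype.ofFinite ι
  have := finite_weyl b
  exact Finite.of_injective (emb b Δ) (Subgroup.inclusion_injective _)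

lemma finiteDimensional_standardRep [Finite ι] (b : P.Base) [FiniteDimensional ℂ V] :
    FiniteDimensional ℂ (Induced (incl P c h) (σ.comp (evalAt P c ν₁ hν₁))) := by
  have := finite_weyl_of_base b Δ
  exact finiteDimensional_of_tSpan (tSpan_standardRep hν₁ h)

/-- The weights of the twist of a standard module lie in the first block. -/
lemma wtSum_standardRep_comp_shift [Finite ι] (b : P.Base) [FiniteDimensional ℂ V]
    (hsum : ν₁ + χ = ν)
    (hV : wtSum (opX (σ.comp (evalAt P c ν hν))) (blk κ Δ (1 : P.Aut)) = ⊤) :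
    wtSum (opX ((standardRep h σ ν₁ hν₁).comp (shift P c χ hχ))) (blk κ Δ (1 : P.Aut)) = ⊤ := by
  have := finiteDimensional_standardRep (c := c) (σ := σ) h hν₁ b
  refine wtSum_blk_one_eq_top
    (Q := LinearMap.range (indOne (incl P c h) (σ.comp (evalAt P c ν₁ hν₁)))) ?_ ?_
  · rw [tSpan_comp_shift, tSpan_standardRep]
  · rintro _ ⟨v, rfl⟩
    refine map_mem_wtSum (f' := opX (σ.comp (evalAt P c ν hν))) (fun ω u => ?_)
      (hV ▸ Submodule.mem_top)
    rw [opX_apply, opX_apply, indOne_standardRep_comp_shift hν h hν₁ hχ hsum, incl_x]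

lemma hasRealParameter_comp_shift {U : Type*} [AddCommGroup U] [Module ℂ U]
    {ρ : HeckeAlg P Δ c →ₐ[ℂ] Module.End ℂ U} (hr : HasRealParameter ρ) :
    HasRealParameter (ρ.comp (shift P c χ hχ)) := by
  obtain ⟨r₀, hr₀⟩ := hr
  exact ⟨r₀, fun v => by rw [AlgHom.comp_apply, shift_r, hr₀]⟩

lemma hasRealParameter_irreducibleQuotient {U : Type*} [AddCommGroup U] [Module ℂ U]
    {ρ : HeckeAlg P Δ c →ₐ[ℂ] Module.End ℂ U} (hr : HasRealParameter ρ) :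
    HasRealParameter (irreducibleQuotient ρ) := by
  obtain ⟨r₀, hr₀⟩ := hr
  refine ⟨r₀, fun v => ?_⟩
  obtain ⟨v, rfl⟩ := (radical ρ).mkQ_surjective v
  change (radical ρ).mkQ (ρ Alg.r v) = _
  rw [hr₀, map_smul]

/-- The weights of `L(M, σ, ν₁) ⊗ ℂ_χ`. -/
lemma wtSum_langlandsQuotient_comp_shift [Finite ι] (b : P.Base) [FiniteDimensional ℂ V]
    (hsum : ν₁ + χ = ν)
    (hV : wtSum (opX (σ.comp (evalAt P c ν hν))) (blk κ Δ (1 : P.Aut)) = ⊤) :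
    wtSum (opX ((langlandsQuotient h σ ν₁ hν₁).comp (shift P c χ hχ))) (blk κ Δ (1 : P.Aut)) =
      ⊤ := by
  rw [eq_top_iff]
  intro v _
  obtain ⟨v, rfl⟩ := (radical (standardRep h σ ν₁ hν₁)).mkQ_surjective v
  refine map_mem_wtSum (f' := opX ((standardRep h σ ν₁ hν₁).comp (shift P c χ hχ)))
    (fun ω u => rfl) ?_
  rw [wtSum_standardRep_comp_shift h hν hν₁ hχ b hsum hV]
  exact Submodule.mem_top

/-- The Langlands quotient is induced from a twist of a Langlands quotient of the subsystem that
controls the imaginary parts of the weights. -/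
theorem areIsomorphic_langlandsQuotient [Finite ι] [FiniteDimensional ℂ V] {w : P.Aut}
    (hc : ∀ w ∈ weyl P (b.support : Set ι), ∀ i, c (w • i) = c i)
    (hwW : w ∈ weyl P (b.support : Set ι)) (hwΔ : ∀ d ∈ Δ, w • d ∈ (b.support : Set ι))
    (hcw : ∀ i, c (w • i) = c i)
    (hκ : ∀ g ∈ weyl P (b.support : Set ι), (∀ x, κ (g • x) = κ x) → g ∈ weyl P Δ)
    (hΔ₀ : Δ₀ ⊆ (b.support : Set ι)) (hw : IsStandardizing b Δ w) (hr : HasRealParameter σ)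
    (hV : wtSum (opX (σ.comp (evalAt P c ν hν))) (blk κ Δ (1 : P.Aut)) = ⊤)
    (hsum : ν₁ + χ = ν) :
    AreIsomorphic (langlandsQuotient hΔ₀ σ ν hν) (inducedRep (conjHom P w hwΔ hcw)
      ((langlandsQuotient h σ ν₁ hν₁).comp (shift P c χ hχ))) := by
  have := Fintype.ofFinite ι
  have := finiteDimensional_standardRep (c := c) (σ := σ) h hν₁ b
  have h1 : AreIsomorphic (standardRep hΔ₀ σ ν hν) (inducedRep (conjHom P w hwΔ hcw)
      ((standardRep h σ ν₁ hν₁).comp (shift P c χ hχ))) :=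
    areIsomorphic_inducedRep_incl hc hwW hwΔ hcw hκ hΔ₀ h hw (hasRealParameter_evalAt hν hr) hV
      (indOne_standardRep_comp_shift hν h hν₁ hχ hsum)
      (by rw [tSpan_comp_shift, tSpan_standardRep])
      (exists_extension_standardRep hν h hν₁ hχ hsum)
  refine h1.irreducibleQuotient.trans ?_
  exact areIsomorphic_irreducibleQuotient_inducedRep hw hc hwW hwΔ hcw hκ
    (R := radical (standardRep h σ ν₁ hν₁)) (fun _ _ => rfl)
    (hasRealParameter_comp_shift hχ (hasRealParameter_standardRep hν₁ h hr))
    (wtSum_standardRep_comp_shift h hν hν₁ hχ b hsum hV)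
    (radical_comp _ (shift_surjective χ hχ)).symm

/-- The functionals in the block of zero are the real ones. -/
lemma mem_blk_zero_iff {l : CartanDual X →ₗ[ℂ] ℂ} {u : P.Aut} :
    l ∈ blk (0 : X →+ ℝ) Δ u ↔ imHom l = 0 :=
  ⟨fun ⟨_, _, hl⟩ => AddMonoidHom.ext hl, fun hl => ⟨1, one_mem _, fun x => by rw [hl]; rfl⟩⟩

lemma imHom_flip_pair_eq_zero_iff [Module.Finite ℤ Y] {y : Cartan Y} :
    imHom ((pair P).flip y) = 0 ↔ imPart y = 0 := by
  constructor
  · intro hy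
    refine eq_zero_of_pair_eq_zero P fun x => ?_
    rw [pair_one_tmul_imPart, ← imHom_flip_pair, hy]; simp
  · intro hy
    ext x
    have := pair_one_tmul_imPart P x y
    rw [hy, map_zero, eq_comm, Complex.ofReal_eq_zero] at this
    exact this

/-- If `σ` and `ν₁` are real, then so are the weights of the Langlands quotient. -/
theorem hasRealCentralCharacter_langlandsQuotient [Finite ι] [Module.Finite ℤ Y]
    [FiniteDimensional ℂ V] (b : P.Base) (hirr : IsIrreducible σ)
    (hσ : HasRealCentralCharacter₀ σ) (him : imPart ν₁ = 0) :
    HasRealCentralCharacter (langlandsQuotient h σ ν₁ hν₁) := by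
  have := hirr.1
  have := finiteDimensional_standardRep (c := c) (σ := σ) h hν₁ b
  refine ⟨hasRealParameter_irreducibleQuotient (hasRealParameter_standardRep hν₁ h hσ.1),
    fun l hl => ?_⟩
  obtain ⟨l₀, hl₀, hwt⟩ := exists_weight σ
  have h1 : wtSum (opX (σ.comp (evalAt P c ν₁ hν₁))) (blk (0 : X →+ ℝ) Δ (1 : P.Aut)) = ⊤ := by
    refine wtSum_evalAt_eq_top hν₁ hirr h (mem_blk_zero_iff.2 ?_) (hwt ν₁ hν₁)
    rw [imHom_flip_pair_eq_zero_iff, map_add, hσ.2 l₀ hl₀, him, add_zero]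
  -- All weights lie in the block of the zero functional, and this block consists of the real
  -- weights.
  have h2 : wtSum (opX (langlandsQuotient h σ ν₁ hν₁)) (blk (0 : X →+ ℝ) Δ (1 : P.Aut)) = ⊤ := by
    rw [eq_top_iff]
    intro v _
    obtain ⟨v, rfl⟩ := (radical (standardRep h σ ν₁ hν₁)).mkQ_surjective v
    refine map_mem_wtSum (f' := opX (standardRep h σ ν₁ hν₁)) (fun ω u => rfl) ?_
    rw [wtSum_blk_one_eq_top (tSpan_standardRep hν₁ h)
      (indOne_standardRep_mem_wtSum hν₁ h h1)]
    exact Submodule.mem_top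
  by_contra hne
  refine hl ?_
  have hdisj := disjoint_wtSum (opX_commute (langlandsQuotient h σ ν₁ hν₁))
    (S := {(pair P).flip l}) (T := blk (0 : X →+ ℝ) Δ (1 : P.Aut)) (by
      rw [Set.disjoint_singleton_left, mem_blk_zero_iff, imHom_flip_pair_eq_zero_iff]
      exact hne)
  rw [h2, disjoint_top] at hdisj
  rw [eq_bot_iff, ← hdisj]
  exact wt_le_wtSum (f := opX (langlandsQuotient h σ ν₁ hν₁)) (Set.mem_singleton _)

end Reduction

/-! ### The `*`-operation and invariant forms -/

section Star

variable {ι X Y : Type*} [AddCommGroup X] [AddCommGroup Y]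
variable {P : RootPairing ι ℤ X Y} {b : P.Base} {Δ : Set ι} {c : ι → ℕ}
variable {Z : Type*} [AddCommGroup Z] [Module ℂ Z]

open Classical in
/-- The reflection in a root of a subsystem, as an element of its Weyl group; for the other roots
this is the identity. -/
def subRefl (P : RootPairing ι ℤ X Y) (Δ : Set ι) (i : ι) : weyl P Δ :=
  if h : i ∈ generatedRoots P Δ then ⟨𝓈 P i, reflection_mem_weyl_of_generatedRoots P Δ h⟩ else 1

lemma coe_subRefl {i : ι} (h : i ∈ generatedRoots P Δ) : (subRefl P Δ i : P.Aut) = 𝓈 P i := by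
  rw [subRefl, dif_pos h]

lemma subRefl_opp (i : ι) : subRefl P Δ (opp P i) = subRefl P Δ i := by
  by_cases h : i ∈ generatedRoots P Δ
  · refine Subtype.ext ?_
    rw [coe_subRefl h, coe_subRefl (opp_mem_generatedRoots h), opp_eq_reflection_iff]
  · rw [subRefl, subRefl, dif_neg h, dif_neg (by rwa [opp_mem_generatedRoots_iff])]

open Classical in
/-- The sign of a root of a subsystem, extended by zero to the other roots. -/
def subSgn (b : P.Base) (Δ : Set ι) (i : ι) : ℂ := if i ∈ generatedRoots P Δ then sgn b i else 0

lemma subSgn_of_mem {i : ι} (h : i ∈ generatedRoots P Δ) : subSgn b Δ i = sgn b i := if_pos h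

lemma subSgn_of_not_mem {i : ι} (h : i ∉ generatedRoots P Δ) : subSgn b Δ i = 0 := if_neg h

/-- An invariant form is one that is invariant under the generators. -/
lemma isStar_invariant {ρ : HeckeAlg P Δ c →ₐ[ℂ] Module.End ℂ Z} {B : Z →ₗ[ℂ] Z →ₗ⋆[ℂ] ℂ}
    (ht : ∀ w u v, B (ρ (Alg.t w) u) v = B u (ρ (Alg.t w⁻¹) v))
    (hr : ∀ u v, B (ρ Alg.r u) v = B u (ρ Alg.r v))
    (hx : ∀ ω u v, B (ρ (Alg.x ω) u) v = B u (ρ (-Alg.x (conjDual ω) +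
      Alg.r * ∑ᶠ i : posRoots Δ b, ((c i : ℂ) * pair P (conjDual ω) (corootC P i)) •
        Alg.t (posRefl Δ b i)) v))
    (a a' : HeckeAlg P Δ c) (h : IsStar Δ c b a a') (u v : Z) : B (ρ a u) v = B u (ρ a' v) := by
  induction h generalizing u v with
  | t w => exact ht w u v
  | r => exact hr u v
  | x ω => exact hx ω u v
  | add h1 h2 ih1 ih2 =>
    rw [map_add, map_add, LinearMap.add_apply, LinearMap.add_apply, map_add, map_add,
      LinearMap.add_apply, ih1, ih2]
  | smul z h1 ih1 =>
    rw [map_smul, map_smul, LinearMap.smul_apply, LinearMap.smul_apply, map_smul,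
      LinearMap.smul_apply, ih1, LinearMap.map_smulₛₗ, Complex.conj_conj]
  | mul h1 h2 ih1 ih2 =>
    rw [map_mul, map_mul, Module.End.mul_apply, Module.End.mul_apply, ih1, ih2]

/-- A sum over the positive roots of a subsystem, written as a signed sum over all roots, for
summands that are odd. -/
lemma sum_subSgn [Fintype ι] {F : ι → Z} (hF : ∀ i, F (opp P i) = -F i) :
    ∑ᶠ i : posRoots Δ b, F i = ∑ i, (subSgn b Δ i * 2⁻¹) • F i := by
  classical
  have h1 : ∑ᶠ i : posRoots Δ b, F i = ∑ i, if i ∈ posRoots Δ b then F i else 0 := by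
    rw [finsum_eq_sum_of_fintype, ← Finset.sum_filter]
    exact (Finset.sum_subtype _ (fun i => by simp) F).symm
  have hopp : Function.Involutive (opp P) := fun i => by simp
  have h2 : ∑ i, (if i ∈ posRoots Δ b then F i else 0) =
      ∑ i, if opp P i ∈ posRoots Δ b then -F i else 0 := by
    rw [← Equiv.sum_comp hopp.toPerm]
    refine Finset.sum_congr rfl fun i _ => ?_
    rw [Function.Involutive.coe_toPerm, hF]
  have h3 : ∑ i, subSgn b Δ i • F i = ∑ i, (if i ∈ posRoots Δ b then F i else 0) +
      ∑ i, if opp P i ∈ posRoots Δ b then -F i else 0 := by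
    rw [← Finset.sum_add_distrib]
    refine Finset.sum_congr rfl fun i _ => ?_
    by_cases hi : i ∈ generatedRoots P Δ
    · by_cases hp : b.IsPos i
      · rw [subSgn_of_mem hi, sgn_of_pos b hp, if_pos ⟨hi, hp⟩,
          if_neg fun h => (isPos_opp b i).1 h.2 hp, one_smul, add_zero]
      · rw [subSgn_of_mem hi, sgn_of_not_pos b hp, if_neg fun h => hp h.2,
          if_pos ⟨opp_mem_generatedRoots hi, (isPos_opp b i).2 hp⟩, neg_smul, one_smul, zero_add]
    · rw [subSgn_of_not_mem hi, if_neg fun h => hi h.1,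
        if_neg fun h => hi (opp_mem_generatedRoots_iff.1 h.1), zero_smul, add_zero]
  have h4 : ∑ i, (subSgn b Δ i * 2⁻¹) • F i = (2⁻¹ : ℂ) • ∑ i, subSgn b Δ i • F i := by
    rw [Finset.smul_sum]
    exact Finset.sum_congr rfl fun i _ => by rw [smul_smul, mul_comm]
  rw [h4, h3, ← h2, h1, ← two_smul ℂ, smul_smul, inv_mul_cancel₀ two_ne_zero, one_smul]

/-- The action of `ω^*`, with the sum over the positive roots replaced by a sum over all roots. -/
lemma star_x_apply [Fintype ι] (hc : ∀ w ∈ weyl P (b.support : Set ι), ∀ i, c (w • i) = c i)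
    (ρ : HeckeAlg P Δ c →ₐ[ℂ] Module.End ℂ Z) (ω : CartanDual X) (v : Z) :
    ρ (-Alg.x (conjDual ω) + Alg.r * ∑ᶠ i : posRoots Δ b,
      ((c i : ℂ) * pair P (conjDual ω) (corootC P i)) • Alg.t (posRefl Δ b i)) v =
    -ρ (Alg.x (conjDual ω)) v + ∑ i, (subSgn b Δ i * 2⁻¹) • (c i * cor P i (conjDual ω)) •
        ρ Alg.r (ρ (Alg.t (subRefl P Δ i)) v) := by
  have h1 : ∑ᶠ i : posRoots Δ b, ((c i : ℂ) * pair P (conjDual ω) (corootC P i)) •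
      (Alg.t (posRefl Δ b i) : HeckeAlg P Δ c) = ∑ i, (subSgn b Δ i * 2⁻¹) •
        (c i * cor P i (conjDual ω)) • (Alg.t (subRefl P Δ i) : HeckeAlg P Δ c) := by
    rw [← sum_subSgn (F := fun i => ((c i : ℂ) * cor P i (conjDual ω)) •
      (Alg.t (subRefl P Δ i) : HeckeAlg P Δ c)) fun i => ?_]
    · refine finsum_congr fun i => ?_
      rw [cor_apply]
      congr 2
      exact Subtype.ext (coe_subRefl i.2.1).symm
    · rw [cor_opp, subRefl_opp, param_opp hc, mul_neg]
      exact neg_smul (R := ℂ) (M := HeckeAlg P Δ c) _ _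
  rw [h1, map_add, map_neg, LinearMap.add_apply, LinearMap.neg_apply, map_mul,
    Module.End.mul_apply, map_sum, LinearMap.sum_apply, map_sum]
  simp only [map_smul, LinearMap.smul_apply]

lemma cor_conjDual (i : ι) (ω : CartanDual X) : cor P i (conjDual ω) = conj (cor P i ω) := by
  rw [cor_apply, cor_apply, corootC]
  induction ω using TensorProduct.induction_on with
  | zero => simp
  | tmul z x => simp
  | add a b ha hb => simp only [map_add, LinearMap.add_apply, ha, hb]

lemma act_conjDual (g : P.Aut) (ω : CartanDual X) :
    act P g (conjDual ω) = conjDual (act P g ω) := by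
  induction ω using TensorProduct.induction_on with
  | zero => simp
  | tmul z x => simp only [conjDual_tmul, act_tmul]
  | add a b ha hb => simp only [map_add, ha, hb]

/-- The character `I • imPart y` is purely imaginary. -/
lemma pair_conjDual_I_smul_imPart (ω : CartanDual X) (y : Cartan Y) :
    pair P (conjDual ω) (Complex.I • imPart y) = -conj (pair P ω (Complex.I • imPart y)) := by
  induction ω using TensorProduct.induction_on with
  | zero => simp
  | tmul z x =>
    have e : ∀ z : ℂ, z ⊗ₜ[ℤ] x = z • ((1 : ℂ) ⊗ₜ[ℤ] x) := fun z => by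
      rw [TensorProduct.smul_tmul', smul_eq_mul, mul_one]
    rw [conjDual_tmul, e, e z]
    simp only [map_smul, LinearMap.smul_apply, pair_one_tmul_imPart, smul_eq_mul, map_mul,
      Complex.conj_I, Complex.conj_ofReal]
    ring
  | add a b ha hb => simp only [map_add, LinearMap.add_apply, ha, hb]; ring

/-- The pullback of a sesquilinear form along a linear map. -/
def formComap {V V' : Type*} [AddCommGroup V] [Module ℂ V] [AddCommGroup V'] [Module ℂ V']
    (B : V' →ₗ[ℂ] V' →ₗ⋆[ℂ] ℂ) (f : V →ₗ[ℂ] V') : V →ₗ[ℂ] V →ₗ⋆[ℂ] ℂ :=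
  LinearMap.mk₂'ₛₗ (RingHom.id ℂ) (starRingEnd ℂ) (fun u v => B (f u) (f v))
    (by simp) (by simp) (by simp) (by simp)

/-- Unitarity is an invariant of isomorphism classes. -/
lemma IsUnitary.of_areIsomorphic {V V' : Type*} [AddCommGroup V] [Module ℂ V] [AddCommGroup V']
    [Module ℂ V'] {ρ : HeckeAlg P Δ c →ₐ[ℂ] Module.End ℂ V}
    {ρ' : HeckeAlg P Δ c →ₐ[ℂ] Module.End ℂ V'} (h : AreIsomorphic ρ ρ')
    (hu : IsUnitary b ρ') : IsUnitary b ρ := by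
  obtain ⟨e, he⟩ := h
  obtain ⟨B, h1, h2, h3⟩ := hu
  refine ⟨formComap B (e : V →ₗ[ℂ] V'), fun u v => h1 _ _, fun v hv => ?_,
    fun a a' ha u v => ?_⟩
  · exact h2 _ (by simpa using hv)
  · have := h3 a a' ha (e u) (e v)
    rw [← he, ← he] at this
    exact this

/-- Twisting by a purely imaginary character preserves unitarity. -/
lemma IsUnitary.comp_shift [Finite ι]
    (hc : ∀ w ∈ weyl P (b.support : Set ι), ∀ i, c (w • i) = c i)
    {ρ : HeckeAlg P Δ c →ₐ[ℂ] Module.End ℂ Z} (hu : IsUnitary b ρ) (χ : Cartan Y)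
    (hχ : χ ∈ annih P Δ) (him : ∀ ω, pair P (conjDual ω) χ = -conj (pair P ω χ)) :
    IsUnitary b (ρ.comp (shift P c χ hχ)) := by
  have := Fintype.ofFinite ι
  obtain ⟨B, h1, h2, h3⟩ := hu
  refine ⟨B, h1, h2, isStar_invariant (fun w u v => ?_) (fun u v => ?_) fun ω u v => ?_⟩
  · rw [AlgHom.comp_apply, AlgHom.comp_apply, shift_t, shift_t]
    exact h3 _ _ (.t w) u v
  · rw [AlgHom.comp_apply, shift_r]
    exact h3 _ _ .r u v
  · have := h3 _ _ (.x ω) u v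
    rw [star_x_apply hc] at this
    rw [star_x_apply hc]
    have hx : ∀ ω v, (ρ.comp (shift P c χ hχ)) (Alg.x ω) v =
        ρ (Alg.x ω) v + pair P ω χ • v := fun ω v => by
      rw [AlgHom.comp_apply, shift_x, map_add, AlgHom.commutes, LinearMap.add_apply,
        Module.algebraMap_end_apply]
    rw [hx, hx]
    simp only [AlgHom.comp_apply, shift_t, shift_r]
    rw [map_add, LinearMap.add_apply, this, him, neg_smul, neg_add, neg_neg, map_smul,
      LinearMap.smul_apply, map_add, map_add, map_add, LinearMap.map_smulₛₗ, Complex.conj_conj]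
    abel

/-- A module is unitary if its twist by a purely imaginary character is. -/
lemma IsUnitary.of_comp_shift [Finite ι]
    (hc : ∀ w ∈ weyl P (b.support : Set ι), ∀ i, c (w • i) = c i)
    {ρ : HeckeAlg P Δ c →ₐ[ℂ] Module.End ℂ Z} (χ : Cartan Y) (hχ : χ ∈ annih P Δ)
    (him : ∀ ω, pair P (conjDual ω) χ = -conj (pair P ω χ))
    (hu : IsUnitary b (ρ.comp (shift P c χ hχ))) : IsUnitary b ρ := by
  have h := hu.comp_shift hc (-χ) (neg_mem hχ) fun ω => by rw [map_neg, map_neg, him, map_neg]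
  have e : (ρ.comp (shift P c χ hχ)).comp (shift P c (-χ) (neg_mem hχ)) = ρ := by
    rw [AlgHom.comp_assoc, shift_shift_neg]
    exact AlgHom.comp_id ρ
  rwa [e] at h

end Star

/-! ### Unitary induction -/

section UnitaryInduction

variable {ι X Y : Type*} [AddCommGroup X] [AddCommGroup Y] [Fintype ι]
variable {P : RootPairing ι ℤ X Y} {b : P.Base} {Δ : Set ι} {c : ι → ℕ}

omit [Fintype ι] in
lemma conj_subSgn (i : ι) : conj (subSgn b Δ i) = subSgn b Δ i := by
  rw [subSgn, sgn]
  split_ifs <;> simp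

omit [Fintype ι] in
lemma conj_sgn_add_relSgn (i j : ι) (ω : CartanDual X) (w : P.Aut) :
    conj ((sgn b i + relSgn b Δ w j) * (4⁻¹ * (c i * cor P i (conjDual ω)))) =
      (sgn b i + relSgn b Δ w j) * (4⁻¹ * (c i * cor P i ω)) := by
  have h1 : ∀ i, conj (sgn b i) = sgn b i := fun i => by
    rw [sgn]
    split_ifs <;> simp
  have h2 : conj (relSgn b Δ w j) = relSgn b Δ w j := by
    rw [relSgn]
    split_ifs <;> simp [h1]
  rw [cor_conjDual, map_mul, map_mul, map_mul, map_add, h1, h2, Complex.conj_conj, map_inv₀,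
    Complex.conj_natCast, map_ofNat]

lemma mem_generatedRoots_support (b : P.Base) (i : ι) :
    i ∈ generatedRoots P (b.support : Set ι) :=
  (isStandardizing_one b subset_rfl).reflection_mem_iff.1 (reflection_mem_weyl_support b i)

lemma subSgn_support (i : ι) : subSgn b (b.support : Set ι) i = sgn b i :=
  subSgn_of_mem (mem_generatedRoots_support b i)

lemma subRefl_support (i : ι) : subRefl P (b.support : Set ι) i = reflW b i :=
  Subtype.ext (coe_subRefl (mem_generatedRoots_support b i))

section

variable {Z : Type*} [AddCommGroup Z] [Module ℂ Z]

/-- The adjoint of `ω` inside a sesquilinear form, with a sum over all roots. -/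
lemma form_star_x (hc : ∀ w ∈ weyl P (b.support : Set ι), ∀ i, c (w • i) = c i)
    (ρ : HeckeAlg P Δ c →ₐ[ℂ] Module.End ℂ Z) (B : Z →ₗ[ℂ] Z →ₗ⋆[ℂ] ℂ) (ω : CartanDual X)
    (u v : Z) :
    B u (ρ (-Alg.x (conjDual ω) + Alg.r * ∑ᶠ i : posRoots Δ b,
      ((c i : ℂ) * pair P (conjDual ω) (corootC P i)) • Alg.t (posRefl Δ b i)) v) =
    -B u (ρ (Alg.x (conjDual ω)) v) + ∑ i, subSgn b Δ i * 2⁻¹ * (c i * cor P i ω) *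
      B u (ρ Alg.r (ρ (Alg.t (subRefl P Δ i)) v)) := by
  rw [star_x_apply hc, map_add, map_neg, map_sum]
  congr 1
  refine Finset.sum_congr rfl fun i _ => ?_
  rw [LinearMap.map_smulₛₗ, LinearMap.map_smulₛₗ, cor_conjDual, map_mul, map_mul, conj_subSgn,
    Complex.conj_conj, map_inv₀, Complex.conj_natCast, smul_eq_mul, smul_eq_mul, map_ofNat]
  ring

end

variable {U : Type*} [AddCommGroup U] [Module ℂ U]
variable {ρ : HeckeAlg P Δ c →ₐ[ℂ] Module.End ℂ U} {w : P.Aut}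

/-- The terms of the roots of the subsystem cancel in the invariance of the form on the function
model. -/
lemma sum_form_subRefl_eq_zero [Fintype (weyl P (b.support : Set ι))]
    {B : U →ₗ[ℂ] U →ₗ⋆[ℂ] ℂ}
    (hB : ∀ k u v, B (ρ (Alg.t k) u) v = B u (ρ (Alg.t k⁻¹) v))
    {f f' : weyl P (b.support : Set ι) → U} (hf : f ∈ fnSpace b ρ) (hf' : f' ∈ fnSpace b ρ)
    (ω : CartanDual X) (j : ι) :
    ∑ g : weyl P (b.support : Set ι), subSgn b Δ j * 2⁻¹ *
      (c j * cor P j (act P (g : P.Aut)⁻¹ ω)) *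
        B (f g) (ρ Alg.r (ρ (Alg.t (subRefl P Δ j)) (f' g))) = 0 := by
  by_cases hj : j ∈ generatedRoots P Δ
  · set s := subRefl P Δ j with hs
    have hs2 : s * s = 1 := Subtype.ext (by
      rw [Subgroup.coe_mul, coe_subRefl hj, reflection_mul_self]; rfl)
    have hsinv : s⁻¹ = s := inv_eq_of_mul_eq_one_left hs2
    -- The substitution `g ↦ g s_j` changes the sign of the sum.
    refine CharZero.eq_neg_self_iff.1 ?_
    nth_rewrite 1 [← Equiv.sum_comp (Equiv.mulRight (emb b Δ s))]
    rw [← Finset.sum_neg_distrib]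
    refine Finset.sum_congr rfl fun g _ => ?_
    have h1 : cor P j (act P ((g * emb b Δ s : weyl P (b.support : Set ι)) : P.Aut)⁻¹ ω) =
        -cor P j (act P (g : P.Aut)⁻¹ ω) := by
      rw [Subgroup.coe_mul, mul_inv_rev, coe_emb, act_mul, coe_subRefl hj, ← cor_smul,
        reflection_smul_self, cor_opp]
    rw [Equiv.coe_mulRight, h1, hf, hf', hB, hsinv, hsinv, t_t_apply, hs2, t_one_apply,
      ← r_t_apply]
    ring
  · simp [subSgn_of_not_mem hj]

/-- The substitution `g ↦ s_i g` in the part of the form that involves the reflections. -/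
lemma sum_form_relSgn [Fintype (weyl P (b.support : Set ι))] {B : U →ₗ[ℂ] U →ₗ⋆[ℂ] ℂ}
    (hB : ∀ u v, B (ρ Alg.r u) v = B u (ρ Alg.r v)) (f f' : weyl P (b.support : Set ι) → U)
    (i : ι) (z : ℂ) :
    ∑ g : weyl P (b.support : Set ι), (sgn b i + relSgn b Δ w ((g : P.Aut)⁻¹ • i)) * z *
      B (ρ Alg.r (f (reflW b i * g))) (f' g) =
    ∑ g : weyl P (b.support : Set ι), (sgn b i - relSgn b Δ w ((g : P.Aut)⁻¹ • i)) * z *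
      B (f g) (ρ Alg.r (f' (reflW b i * g))) := by
  rw [← Equiv.sum_comp (Equiv.mulLeft (reflW b i))]
  refine Finset.sum_congr rfl fun g _ => ?_
  have h1 : ((reflW b i * g : weyl P (b.support : Set ι)) : P.Aut)⁻¹ • i =
      opp P ((g : P.Aut)⁻¹ • i) := by
    rw [Subgroup.coe_mul, mul_inv_rev, mul_smul, coe_reflW, RootPairing.Equiv.reflection_inv,
      reflection_smul_self, smul_opp]
  rw [Equiv.coe_mulLeft, h1, relSgn_opp, ← mul_assoc (reflW b i), reflW_mul_self, one_mul, hB,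
    sub_eq_add_neg]

variable (hw : IsStandardizing b Δ w)
  (hc : ∀ w ∈ weyl P (b.support : Set ι), ∀ i, c (w • i) = c i)
  (hwW : w ∈ weyl P (b.support : Set ι))

/-- The function model of a unitary module is unitary: the form is the sum of the values of the
form of the inducing module. -/
lemma isUnitary_fnRep (hu : IsUnitary b ρ) : IsUnitary b (fnRep ρ hw hc hwW) := by
  have := finite_weyl b
  have := Fintype.ofFinite (weyl P (b.support : Set ι))
  obtain ⟨B, h1, h2, h3⟩ := hu
  set B' : fnSpace b ρ →ₗ[ℂ] fnSpace b ρ →ₗ⋆[ℂ] ℂ :=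
    ∑ g, formComap B (LinearMap.proj g ∘ₗ (fnSpace b ρ).subtype) with hB'
  have hB : ∀ f f', B' f f' = ∑ g, B (f.1 g) (f'.1 g) := fun f f' => by
    rw [hB', LinearMap.sum_apply, LinearMap.sum_apply]; rfl
  have hnn : ∀ v, 0 ≤ (B v v).re := fun v => by
    by_cases hv : v = 0
    · rw [hv]; simp
    · exact (h2 v hv).le
  refine ⟨B', fun f f' => ?_, fun f hf => ?_,
    isStar_invariant (fun u f f' => ?_) (fun f f' => ?_) fun ω f f' => ?_⟩
  · rw [hB, hB, map_sum]
    exact Finset.sum_congr rfl fun g _ => h1 _ _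
  · rw [hB, Complex.re_sum]
    obtain ⟨g, hg⟩ : ∃ g, f.1 g ≠ 0 := by
      by_contra hcon
      push Not at hcon
      exact hf (Subtype.ext (funext hcon))
    exact Finset.sum_pos' (fun g _ => hnn _) ⟨g, Finset.mem_univ _, h2 _ hg⟩
  · rw [hB, hB, ← Equiv.sum_comp (Equiv.mulLeft u)]
    refine Finset.sum_congr rfl fun g _ => ?_
    rw [coe_fnRep_t, coe_fnRep_t, fnT_apply, fnT_apply, Equiv.coe_mulLeft, inv_mul_cancel_left,
      inv_inv]
  · rw [hB, hB]
    refine Finset.sum_congr rfl fun g _ => ?_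
    rw [coe_fnRep_r, coe_fnRep_r, fnR_apply, fnR_apply]
    exact h3 _ _ .r _ _
  · have ht := fun k u v => h3 _ _ (.t k) u v
    have hr := fun u v => h3 _ _ .r u v
    have hx : ∀ ω u v, B (ρ (Alg.x ω) u) v = _ := fun ω u v =>
      (h3 _ _ (.x ω) u v).trans (form_star_x hc ρ B ω u v)
    rw [form_star_x hc]
    simp only [hB, coe_fnRep_t, coe_fnRep_r, coe_fnRep_x, subSgn_support, subRefl_support,
      fnR_apply, fnT_apply, fnX_apply, map_add, map_sum, LinearMap.add_apply, LinearMap.sum_apply,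
      hx, map_smul, LinearMap.smul_apply, LinearMap.map_smulₛₗ, smul_eq_mul]
    have hinv : ∀ i, (reflW b i)⁻¹ = reflW b i := fun i =>
      inv_eq_of_mul_eq_one_left (reflW_mul_self b i)
    simp only [conj_sgn_add_relSgn, hinv, Finset.sum_add_distrib, act_conjDual,
      Finset.sum_neg_distrib, neg_add]
    -- The roots of the subsystem contribute `0`; in the remaining sums the terms with `relSgn`
    -- cancel after the substitution `g ↦ s_i g`, and those with `sgn` give the adjoint of `ω`.
    have e1 := Finset.sum_comm (s := (Finset.univ : Finset (weyl P (b.support : Set ι))))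
      (t := (Finset.univ : Finset ι)) (f := fun g j => subSgn b Δ j * 2⁻¹ *
        (c j * cor P j (act P (g : P.Aut)⁻¹ ω)) *
          B (f.1 g) (ρ Alg.r (ρ (Alg.t (subRefl P Δ j)) (f'.1 g))))
    rw [Finset.sum_eq_zero fun j _ => sum_form_subRefl_eq_zero ht f.2 f'.2 ω j] at e1
    rw [e1, add_zero, add_assoc]
    congr 1
    rw [Finset.sum_comm]
    simp only [sum_form_relSgn hr]
    rw [Finset.sum_comm, neg_add_eq_sub, eq_sub_iff_add_eq, ← Finset.sum_add_distrib]
    simp only [Finset.mul_sum]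
    rw [Finset.sum_comm (s := (Finset.univ : Finset ι))]
    refine Finset.sum_congr rfl fun g _ => ?_
    rw [← Finset.sum_add_distrib]
    refine Finset.sum_congr rfl fun i _ => ?_
    ring

/-- Induction from the subalgebra attached to `w Δ` preserves unitarity. -/
theorem isUnitary_inducedRep (hw : IsStandardizing b Δ w)
    (hc : ∀ w ∈ weyl P (b.support : Set ι), ∀ i, c (w • i) = c i)
    (hwW : w ∈ weyl P (b.support : Set ι)) (h : ∀ d ∈ Δ, w • d ∈ (b.support : Set ι))
    (hcw : ∀ i, c (w • i) = c i) (hu : IsUnitary b ρ) :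
    IsUnitary b (inducedRep (conjHom P w h hcw) ρ) :=
  IsUnitary.of_areIsomorphic ⟨LinearEquiv.ofBijective _ (fnMap_bijective hw hc hwW h hcw),
    fnMap_inducedRep hw hc hwW h hcw⟩ (isUnitary_fnRep hw hc hwW hu)

end UnitaryInduction

/-! ### Orthogonality of translates and restriction of unitary structures -/

section Pairing

variable {V V' : Type*} [AddCommGroup V] [Module ℂ V] [AddCommGroup V'] [Module ℂ V']
  {B : V →ₗ[ℂ] V' →ₗ⋆[ℂ] ℂ}

/-- If `-f'` is adjoint to `f`, then generalized eigenspaces are orthogonal unless the eigenvalues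
are `a` and `-conj a`. -/
lemma form_eq_zero_of_maxGenEigenspace {f : Module.End ℂ V} {f' : Module.End ℂ V'}
    (hf : ∀ u v, B (f u) v = -B u (f' v)) {a a' : ℂ} (ha : a ≠ -conj a') {u : V} {v : V'}
    (hu : u ∈ f.maxGenEigenspace a) (hv : v ∈ f'.maxGenEigenspace a') : B u v = 0 := by
  obtain ⟨n, hn⟩ := Module.End.mem_maxGenEigenspace _ _ _ |>.1 hu
  obtain ⟨m, hm⟩ := Module.End.mem_maxGenEigenspace _ _ _ |>.1 hv
  clear hu hv
  induction n generalizing u v m with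
  | zero => rw [pow_zero, Module.End.one_apply] at hn; rw [hn]; simp
  | succ n ihn =>
    induction m generalizing v with
    | zero => rw [pow_zero, Module.End.one_apply] at hm; rw [hm]; simp
    | succ m ihm =>
      rw [pow_succ, Module.End.mul_apply] at hn hm
      have h1 := ihn (u := (f - a • 1) u) (v := v) (m := m + 1) hn
        (by rw [pow_succ, Module.End.mul_apply]; exact hm)
      have h2 := ihm (v := (f' - a' • 1) v) hm
      simp only [LinearMap.sub_apply, LinearMap.smul_apply, Module.End.one_apply, map_sub,
        map_smul, LinearMap.map_smulₛₗ, smul_eq_mul, hf] at h1 h2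
      have h3 : (a + conj a') * B u v = 0 := by linear_combination -h1 - h2
      exact (mul_eq_zero.1 h3).resolve_left fun h => ha (eq_neg_of_add_eq_zero_left h)

variable {E : Type*} [AddCommGroup E] [Module ℂ E]

/-- Under a form for which `f ω` is minus the adjoint of `f' (τ ω)`, weight spaces are orthogonal
unless the weights correspond. -/
lemma form_eq_zero_of_mem_wtSum {f : E →ₗ[ℂ] Module.End ℂ V} {f' : E →ₗ[ℂ] Module.End ℂ V'}
    {τ : E → E} (hf : ∀ ω u v, B (f ω u) v = -B u (f' (τ ω) v)) {S S' : Set (E →ₗ[ℂ] ℂ)}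
    (hS : ∀ l ∈ S, ∀ l' ∈ S', ∃ ω, l ω ≠ -conj (l' (τ ω))) {u : V} {v : V'} (hu : u ∈ wtSum f S)
    (hv : v ∈ wtSum f' S') : B u v = 0 := by
  suffices h : wtSum f S ≤ LinearMap.ker (B.flip v) from h hu
  refine iSup₂_le fun l hl u hu => ?_
  suffices h : wtSum f' S' ≤ LinearMap.ker (B u) from h hv
  refine iSup₂_le fun l' hl' v hv => ?_
  obtain ⟨ω, hω⟩ := hS l hl l' hl'
  exact form_eq_zero_of_maxGenEigenspace (hf ω) hω ((Submodule.mem_iInf _).1 hu ω)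
    ((Submodule.mem_iInf _).1 hv (τ ω))

end Pairing

section Restriction

variable {ι X Y : Type*} [AddCommGroup X] [AddCommGroup Y] [Fintype ι]
variable {P : RootPairing ι ℤ X Y} {b : P.Base} {Δ : Set ι} {c : ι → ℕ} {κ : X →+ ℝ}
variable {U Z : Type*} [AddCommGroup U] [Module ℂ U] [AddCommGroup Z] [Module ℂ Z]
variable {ρ : HeckeAlg P Δ c →ₐ[ℂ] Module.End ℂ U} {w : P.Aut}

omit [Fintype ι] in
lemma conjDual_one_tmul (x : X) : conjDual ((1 : ℂ) ⊗ₜ[ℤ] x) = 1 ⊗ₜ x := by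
  rw [conjDual_tmul, map_one]

variable (hw : IsStandardizing b Δ w)
  (hc : ∀ w ∈ weyl P (b.support : Set ι), ∀ i, c (w • i) = c i)
  (hwW : w ∈ weyl P (b.support : Set ι)) (h : ∀ d ∈ Δ, w • d ∈ (b.support : Set ι))
  (hcw : ∀ i, c (w • i) = c i)
  (hκ : ∀ g ∈ weyl P (b.support : Set ι), (∀ x, κ (g • x) = κ x) → g ∈ weyl P Δ)

/-- The adjoint of `ω` on translates by `t_g`. A nonzero term of the sum comes from a root `i` for
which `i` and `g⁻¹ i` have the same sign, so that `s_i g` is longer than `g`. -/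
lemma star_x_t_apply (π : HeckeAlg P (b.support : Set ι) c →ₐ[ℂ] Module.End ℂ Z)
    (B : Z →ₗ[ℂ] Z →ₗ⋆[ℂ] ℂ) (g : weyl P (b.support : Set ι)) (ω : CartanDual X) (u v : Z)
    (hc : ∀ w ∈ weyl P (b.support : Set ι), ∀ i, c (w • i) = c i)
    (hB : ∀ ω u v, B (π (Alg.x ω) u) v = -B u (π (Alg.x (conjDual ω)) v) +
      ∑ i, sgn b i * 2⁻¹ * (c i * cor P i ω) * B u (π Alg.r (π (Alg.t (reflW b i)) v))) :
    B (π (Alg.x ω) u) (π (Alg.t g) v) =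
      -B u (π (Alg.t g) (π (Alg.x (act P (g : P.Aut)⁻¹ (conjDual ω))) v)) +
        ∑ i, (sgn b i + sgn b ((g : P.Aut)⁻¹ • i)) * (4⁻¹ * (c i * cor P i ω)) *
          B u (π (Alg.t (reflW b i * g)) (π Alg.r v)) := by
  have h1 : ∀ i j : ι, conj ((sgn b i - sgn b j) * (4⁻¹ * (c i * cor P i (conjDual ω)))) =
      (sgn b i - sgn b j) * (4⁻¹ * (c i * cor P i ω)) := fun i j => by
    have h1 : ∀ i, conj (sgn b i) = sgn b i := fun i => by
      rw [sgn]
      split_ifs <;> simp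
    rw [cor_conjDual, map_mul, map_mul, map_mul, map_sub, h1, h1, Complex.conj_conj, map_inv₀,
      Complex.conj_natCast, map_ofNat]
  rw [hB, x_t_apply hc, map_add, neg_add, add_assoc]
  congr 1
  rw [map_sum, ← Finset.sum_neg_distrib, ← Finset.sum_add_distrib]
  refine Finset.sum_congr rfl fun i _ => ?_
  rw [LinearMap.map_smulₛₗ, h1, smul_eq_mul, r_t_apply, r_t_apply, t_t_apply]
  ring

include hw in
/-- Reflections that make a product of elements of the Weyl group of the subsystem `w Δ` longer
cannot lead back into this group. -/
lemma not_mem_of_isPos_iff {g : P.Aut} (hg : w⁻¹ * g * w ∉ weyl P Δ) {i : ι}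
    (hi : b.IsPos i ↔ b.IsPos (g⁻¹ • i)) : w⁻¹ * (𝓈 P i * g) * w ∉ weyl P Δ := by
  intro hk
  set j := w⁻¹ • i with hj
  have hwj : w • j = i := smul_inv_smul _ _
  by_cases hjm : j ∈ generatedRoots P Δ
  · refine hg ?_
    have h1 := mul_mem (reflection_mem_weyl_of_generatedRoots P Δ hjm) hk
    rw [hj, reflection_smul_eq] at h1
    convert h1 using 1
    have := reflection_mul_self (P := P) i
    calc w⁻¹ * g * w = w⁻¹ * (𝓈 P i * 𝓈 P i) * g * w := by rw [this, mul_one]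
      _ = _ := by group
  · have h1 := hw.isPos_smul_smul (inv_mem hk) hjm
    have h2 : w • (w⁻¹ * (𝓈 P i * g) * w)⁻¹ • j = opp P (g⁻¹ • i) := by
      rw [hj, ← mul_smul, ← mul_smul]
      have e : w * (w⁻¹ * (𝓈 P i * g) * w)⁻¹ * w⁻¹ = g⁻¹ * (𝓈 P i)⁻¹ := by group
      rw [e, RootPairing.Equiv.reflection_inv, mul_smul, reflection_smul_self, smul_opp]
    rw [h2, hwj, isPos_opp, hi] at h1
    exact iff_not_self h1.symm

variable {π : HeckeAlg P (b.support : Set ι) c →ₐ[ℂ] Module.End ℂ Z} {I : U →ₗ[ℂ] Z}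

include hw hc in
/-- The form `⟨u, t_g v⟩` is invariant up to a twist by `g` if the forms for longer elements
vanish. -/
lemma form_x_t_apply {B : Z →ₗ[ℂ] Z →ₗ⋆[ℂ] ℂ}
    (hIx : ∀ ω u, I (ρ (Alg.x ω) u) = π (Alg.x (act P w ω)) (I u))
    (hIr : ∀ u, I (ρ Alg.r u) = π Alg.r (I u))
    (hB : ∀ ω u v, B (π (Alg.x ω) u) v = -B u (π (Alg.x (conjDual ω)) v) +
      ∑ i, sgn b i * 2⁻¹ * (c i * cor P i ω) * B u (π Alg.r (π (Alg.t (reflW b i)) v)))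
    {g : weyl P (b.support : Set ι)} (hg : w⁻¹ * g * w ∉ weyl P Δ)
    (hmax : ∀ g' : weyl P (b.support : Set ι), w⁻¹ * g' * w ∉ weyl P Δ →
      len b (g : P.Aut) < len b (g' : P.Aut) → ∀ u v, B (I u) (π (Alg.t g') (I v)) = 0)
    (ω : CartanDual X) (u v : U) : B (I (ρ (Alg.x ω) u)) (π (Alg.t g) (I v)) =
      -B (I u) (π (Alg.t g) (I (ρ (Alg.x (act P (w⁻¹ * g * w)⁻¹ (conjDual ω))) v))) := by
  have e1 : act P (g : P.Aut)⁻¹ (conjDual (act P w ω)) =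
      act P w (act P (w⁻¹ * g * w)⁻¹ (conjDual ω)) := by
    rw [← act_conjDual, ← act_mul, ← act_mul]
    congr 2
    group
  rw [hIx, star_x_t_apply π B g _ _ _ hc hB, e1, ← hIx]
  refine add_eq_left.2 (Finset.sum_eq_zero fun i _ => ?_)
  by_cases hs : b.IsPos i ↔ b.IsPos ((g : P.Aut)⁻¹ • i)
  · have hlen : len b (g : P.Aut) <
        len b ((reflW b i * g : weyl P (b.support : Set ι)) : P.Aut) := by
      rw [Subgroup.coe_mul, coe_reflW]
      by_cases hp : b.IsPos i
      · exact len_lt_reflection_mul b g.2 hp (hs.1 hp)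
      · rw [← opp_eq_reflection_iff]
        refine len_lt_reflection_mul b g.2 ((isPos_opp b i).2 hp) ?_
        rw [smul_opp, isPos_opp, ← hs]
        exact hp
    have hnm : w⁻¹ * ((reflW b i * g : weyl P (b.support : Set ι)) : P.Aut) * w ∉ weyl P Δ := by
      rw [Subgroup.coe_mul, coe_reflW]
      exact not_mem_of_isPos_iff hw hg hs
    rw [← hIr, hmax (reflW b i * g) hnm hlen, mul_zero]
  · have h0 : sgn b i + sgn b ((g : P.Aut)⁻¹ • i) = 0 := by
      by_cases hp : b.IsPos i
      · rw [sgn_of_pos b hp, sgn_of_not_pos b fun h' => hs ⟨fun _ => h', fun _ => hp⟩,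
          add_neg_cancel]
      · by_cases hq : b.IsPos ((g : P.Aut)⁻¹ • i)
        · rw [sgn_of_not_pos b hp, sgn_of_pos b hq, neg_add_cancel]
        · exact absurd ⟨fun h' => absurd h' hp, fun h' => absurd h' hq⟩ hs
    rw [h0, zero_mul, zero_mul]

include hκ in
/-- Two weights in the first block have imaginary parts that are conjugate only under the Weyl group
of the subsystem. -/
lemma mem_weyl_of_imHom_eq {l l' : CartanDual X →ₗ[ℂ] ℂ} (hl : l ∈ blk κ Δ (1 : P.Aut))
    (hl' : l' ∈ blk κ Δ (1 : P.Aut)) {k : P.Aut} (hk : k ∈ weyl P (b.support : Set ι))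
    (h : ∀ x, imHom l x = imHom l' (k⁻¹ • x)) : k ∈ weyl P Δ := by
  obtain ⟨h₁, hh₁, hl⟩ := hl
  obtain ⟨h₂, hh₂, hl'⟩ := hl'
  have e2 : h₂⁻¹ * k⁻¹ * h₁ ∈ weyl P Δ := by
    refine hκ _ (mul_mem (mul_mem (weyl_le b Δ (inv_mem hh₂)) (inv_mem hk)) (weyl_le b Δ hh₁))
      fun x => ?_
    have := h (h₁ • x)
    rw [hl, hl', one_mul, one_mul, inv_smul_smul] at this
    rw [this, mul_smul, mul_smul]
  have e3 : k = (h₂ * (h₂⁻¹ * k⁻¹ * h₁) * h₁⁻¹)⁻¹ := by group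
  rw [e3]
  exact inv_mem (mul_mem (mul_mem hh₂ e2) (inv_mem hh₁))

include hw hc hwW hκ in
/-- Let `I` embed a module with weights in the first block into a unitary module, equivariantly for
the subalgebra attached to `w Δ`. Then the translate by `t_g` of the image is orthogonal to it,
unless `g` lies in the Weyl group of `w Δ`. For an element `g` of maximal length for which this
fails, the form `⟨u, t_g v⟩` pairs the weight `λ` with `μ` only if the imaginary parts of `λ` and
`μ` are conjugate under `w⁻¹ g w`. -/
lemma form_t_eq_zero {B : Z →ₗ[ℂ] Z →ₗ⋆[ℂ] ℂ}
    (hU : wtSum (opX ρ) (blk κ Δ (1 : P.Aut)) = ⊤)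
    (hIx : ∀ ω u, I (ρ (Alg.x ω) u) = π (Alg.x (act P w ω)) (I u))
    (hIr : ∀ u, I (ρ Alg.r u) = π Alg.r (I u))
    (hB : ∀ ω u v, B (π (Alg.x ω) u) v = -B u (π (Alg.x (conjDual ω)) v) +
      ∑ i, sgn b i * 2⁻¹ * (c i * cor P i ω) * B u (π Alg.r (π (Alg.t (reflW b i)) v)))
    (g : weyl P (b.support : Set ι)) (hg : w⁻¹ * g * w ∉ weyl P Δ) (u v : U) :
    B (I u) (π (Alg.t g) (I v)) = 0 := by
  have := finite_weyl b
  by_contra hne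
  -- For a counterexample `g` of maximal length, the correction terms in the adjoint of `ω` vanish.
  obtain ⟨g, ⟨hg, u, v, hne⟩, hmax⟩ := Set.exists_max_image
    {g : weyl P (b.support : Set ι) |
      w⁻¹ * g * w ∉ weyl P Δ ∧ ∃ u v, B (I u) (π (Alg.t g) (I v)) ≠ 0}
    (fun g => len b (g : P.Aut)) (Set.toFinite _) ⟨g, hg, u, v, hne⟩
  have hx := form_x_t_apply hw hc hIx hIr hB hg fun g' hg' hlen u v => by
    by_contra hcon
    exact absurd (hmax g' ⟨hg', u, v, hcon⟩) (not_le.2 hlen)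
  let C : U →ₗ[ℂ] U →ₗ⋆[ℂ] ℂ := LinearMap.mk₂'ₛₗ (RingHom.id ℂ) (starRingEnd ℂ)
    (fun u v => B (I u) (π (Alg.t g) (I v))) (by simp) (by simp) (by simp) (by simp)
  refine hne (form_eq_zero_of_mem_wtSum (B := C) (f := opX ρ) (f' := opX ρ) hx
    (S := blk κ Δ (1 : P.Aut)) (S' := blk κ Δ (1 : P.Aut)) (fun l hl l' hl' => ?_)
    (hU ▸ Submodule.mem_top) (hU ▸ Submodule.mem_top))
  by_contra hcon
  push Not at hcon
  -- On real elements of `𝔥^*`, a pair of weights that is not excluded has imaginary parts conjugate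
  -- under `w⁻¹ g w`.
  refine hg (mem_weyl_of_imHom_eq hκ hl hl' (mul_mem (mul_mem (inv_mem hwW) g.2) hwW) fun x => ?_)
  rw [imHom_apply, hcon, conjDual_one_tmul, act_tmul, imHom_apply, Complex.neg_im,
    Complex.conj_im, neg_neg]

include hw hc hwW hκ in
/-- A module with weights in the first block that embeds into a unitary module, equivariantly for
the subalgebra attached to `w Δ`, is unitary. -/
theorem isUnitary_of_injective (hU : wtSum (opX ρ) (blk κ Δ (1 : P.Aut)) = ⊤)
    (hI : ∀ a u, I (ρ a u) = π (conjHom P w h hcw a) (I u)) (hinj : Function.Injective I)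
    (hu : IsUnitary b π) : IsUnitary b ρ := by
  obtain ⟨B, h1, h2, h3⟩ := hu
  have hIx : ∀ ω u, I (ρ (Alg.x ω) u) = π (Alg.x (act P w ω)) (I u) := fun ω u => by
    rw [hI, conjHom_x]
  have hIr : ∀ u, I (ρ Alg.r u) = π Alg.r (I u) := fun u => by rw [hI, conjHom_r]
  have hIt : ∀ k u, I (ρ (Alg.t k) u) =
      π (Alg.t ⟨w * k * w⁻¹, conj_mem_weyl P w h k.2⟩) (I u) := fun k u => by rw [hI, conjHom_t]
  have hB : ∀ ω u v, B (π (Alg.x ω) u) v = -B u (π (Alg.x (conjDual ω)) v) +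
      ∑ i, sgn b i * 2⁻¹ * (c i * cor P i ω) * B u (π Alg.r (π (Alg.t (reflW b i)) v)) :=
    fun ω u v => by
      have := (h3 _ _ (.x ω) u v).trans (form_star_x hc π B ω u v)
      simpa only [subSgn_support, subRefl_support] using this
  refine ⟨formComap B I, fun u v => h1 _ _, fun v hv => h2 _ fun h0 => hv ?_,
    isStar_invariant (fun k u v => ?_) (fun u v => ?_) fun ω u v => ?_⟩
  · exact hinj (h0.trans (map_zero _).symm)
  · change B (I (ρ (Alg.t k) u)) (I v) = B (I u) (I (ρ (Alg.t k⁻¹) v))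
    rw [hIt, hIt, h3 _ _ (.t _)]
    congr 4
    refine Subtype.ext ?_
    change (w * (k : P.Aut) * w⁻¹)⁻¹ = w * (k : P.Aut)⁻¹ * w⁻¹
    group
  · change B (I (ρ Alg.r u)) (I v) = B (I u) (I (ρ Alg.r v))
    rw [hIr, hIr]
    exact h3 _ _ .r _ _
  · rw [form_star_x hc]
    change B (I (ρ (Alg.x ω) u)) (I v) = -B (I u) (I (ρ (Alg.x (conjDual ω)) v)) +
      ∑ i, subSgn b Δ i * 2⁻¹ * (c i * cor P i ω) *
        B (I u) (I (ρ Alg.r (ρ (Alg.t (subRefl P Δ i)) v)))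
    rw [hIx, hIx, hB, act_conjDual]
    congr 1
    -- The roots outside `w Δ` contribute translates that are orthogonal to the image.
    rw [← Equiv.sum_comp (MulAction.toPerm w)]
    refine Finset.sum_congr rfl fun i _ => ?_
    rw [MulAction.toPerm_apply, cor_smul_act, hcw]
    by_cases hi : i ∈ generatedRoots P Δ
    · have e : reflW b (w • i) = ⟨w * subRefl P Δ i * w⁻¹, conj_mem_weyl P w h (subRefl P Δ i).2⟩ :=
        Subtype.ext (by
          change 𝓈 P (w • i) = w * (subRefl P Δ i : P.Aut) * w⁻¹
          rw [reflection_smul_eq, coe_subRefl hi])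
      rw [subSgn_of_mem hi, sgn_congr b (hw.pos i hi), hIr, hIt, e]
    · rw [subSgn_of_not_mem hi, zero_mul, zero_mul, zero_mul]
      have h0 := form_t_eq_zero hw hc hwW hκ hU hIx hIr hB (reflW b (w • i)) (by
        rw [coe_reflW, reflection_smul_eq]
        have e : w⁻¹ * (w * 𝓈 P i * w⁻¹) * w = 𝓈 P i := by group
        rw [e, hw.reflection_mem_iff]
        exact hi) u (ρ Alg.r v)
      rw [hIr, ← r_t_apply] at h0
      rw [h0, mul_zero]

end Restriction

end GradedHecke

end

theorem corollary1p7 {ι X Y V : Type*} [Finite ι] [AddCommGroup X] [AddCommGroup Y]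
    [Module.Finite ℤ X] [Module.Finite ℤ Y] [AddCommGroup V] [Module ℂ V]
    (P : RootDatum ι X Y) (b : P.Base)
    (c : ι → ℕ) (hcpos : ∀ i, 0 < c i) (hc : ∀ w ∈ P.weylGroup, ∀ i, c (w • i) = c i)
    (PiM : Set ι) (σ : HeckeAlg₀ P PiM c →ₐ[ℂ] Module.End ℂ V) (ν : Cartan Y)
    (hL : IsLanglandsParameter (b.support : Set ι) σ ν)
    (hIm : imPart ν ≠ 0)
    (hr : HasRealParameter σ)
    (hreg : ∀ l, IsWeight₀ σ l → ∀ i,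
      pair P (rootC P i) (imPart ((l : Cartan Y) + ν)) = 0 →
        pair P (rootC P i) (imPart ν) = 0) :
    (∃ w ∈ P.weylGroup, ∀ d ∈ centralizerSimple b ν, w • d ∈ (b.support : Set ι)) ∧
    (∀ (w : P.Aut) (hw : w ∈ P.weylGroup)
        (h : ∀ d ∈ centralizerSimple b ν, w • d ∈ (b.support : Set ι)),
      AreIsomorphic (langlandsQuotient hL.subset σ ν hL.mem)
        (inducedRep (conjHom P w h (hc w hw))
          ((langlandsQuotient (subset_centralizerSimple b hL.subset hL.mem) σ (rePart ν)
            (rePart_mem_annih P hL.mem)).comp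
              (shift P c (Complex.I • imPart ν) (I_smul_imPart_mem_annih b ν))))) ∧
    (IsUnitary b (langlandsQuotient hL.subset σ ν hL.mem) ↔
      IsUnitary b (langlandsQuotient (subset_centralizerSimple b hL.subset hL.mem) σ (rePart ν)
        (rePart_mem_annih P hL.mem))) ∧
    (HasRealCentralCharacter₀ σ →
      HasRealCentralCharacter
        (langlandsQuotient (subset_centralizerSimple b hL.subset hL.mem) σ (rePart ν)
          (rePart_mem_annih P hL.mem))) := by
  have := Fintype.ofFinite ι
  have := hL.finite
  have hcW : ∀ w ∈ weyl P (b.support : Set ι), ∀ i, c (w • i) = c i := by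
    rwa [weyl_support]
  have hsub := subset_centralizerSimple b hL.subset hL.mem
  obtain ⟨κ, hV, hκ⟩ := exists_block b hL hreg
  have hst : ∀ w : P.Aut, (∀ d ∈ centralizerSimple b ν, w • d ∈ (b.support : Set ι)) →
      IsStandardizing b (centralizerSimple b ν) w := by
    rw [centralizerSimple_eq]
    exact fun w hw => isStandardizing_kernelSimple _ hw
  have hex : ∃ w ∈ P.weylGroup, ∀ d ∈ centralizerSimple b ν, w • d ∈ (b.support : Set ι) := by
    rw [centralizerSimple_eq, ← weyl_support b]
    exact exists_smul_kernelSimple b _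
  have hiso : ∀ (w : P.Aut) (hw : w ∈ P.weylGroup)
      (h : ∀ d ∈ centralizerSimple b ν, w • d ∈ (b.support : Set ι)),
      AreIsomorphic (langlandsQuotient hL.subset σ ν hL.mem)
        (inducedRep (conjHom P w h (hc w hw))
          ((langlandsQuotient hsub σ (rePart ν) (rePart_mem_annih P hL.mem)).comp
            (shift P c (Complex.I • imPart ν) (I_smul_imPart_mem_annih b ν)))) := fun w hw h =>
    areIsomorphic_langlandsQuotient hsub hL.mem _ _ hcW (by rwa [weyl_support]) h (hc w hw) hκ
      hL.subset (hst w h) hr hV (rePart_add_imPart ν)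
  refine ⟨hex, hiso, ?_, fun hσ => hasRealCentralCharacter_langlandsQuotient hsub _ b
    hL.tempered.1 hσ (imPart_rePart ν)⟩
  obtain ⟨w, hw, h⟩ := hex
  have hwW : w ∈ weyl P (b.support : Set ι) := by rwa [weyl_support]
  have hU := wtSum_langlandsQuotient_comp_shift hsub hL.mem (rePart_mem_annih P hL.mem)
    (I_smul_imPart_mem_annih b ν) b (rePart_add_imPart ν) hV
  constructor
  · intro hu
    exact IsUnitary.of_comp_shift hcW _ (I_smul_imPart_mem_annih b ν)
      (pair_conjDual_I_smul_imPart · ν)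
      (isUnitary_of_injective (hst w h) hcW hwW h (hc w hw) hκ hU
        (fun a u => (inducedRep_apply_indOne a u).symm)
        (indOne_injective (hst w h) hcW hwW h (hc w hw))
        (IsUnitary.of_areIsomorphic (hiso w hw h).symm hu))
  · intro hu
    exact IsUnitary.of_areIsomorphic (hiso w hw h) (isUnitary_inducedRep (hst w h) hcW hwW h
      (hc w hw) (hu.comp_shift hcW _ _ (pair_conjDual_I_smul_imPart · ν)))
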